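/- Let $A,B$ be finite alphabets, $\varphi\colon A^*\to A^*$ a primitive morphism (for some $k\ge 1$ every letter of $A$ occurs in $\varphi^k(a)$ for every $a\in A$), and $a_1\in A$ with $\varphi(a_1)=a_1u$, where no $\varphi^k(u)$ is empty, so that $\varphi^\infty(a_1)=a_1u\varphi(u)\varphi^2(u)\dots$ is a right-infinite word. Let $\psi\colon A^*\to B^*$ be any morphism such that $W=\psi(\varphi^\infty(a_1))$ is infinite, and suppose that $W$ is not eventually periodic. Rauzy schemes. A graph with words is a finite directed graph (parallel edges allowed) in which every vertex is either distributing (in-degree $1$, out-degree $>1$) or collecting (in-degree $>1$, out-degree $1$), and in which every edge carries two words, a front word and a back word. A path is a non-empty sequence of consecutive edges. For a path $s$, $F(s)$ is the concatenation, in order, of the front words of its first edge and of all its edges that leave distributing vertices; $B(s)$ is the concatenation of the back words of all its edges that enter collecting vertices and of its last edge. A path is symmetric if it begins in a collecting vertex and ends in a distributing vertex. Write $x\sqsubseteq y$ if $x$ is a factor of $y$, and $x\sqsubseteq_k y$ if $x$ has at least $k$ occurrences in $y$ (also for paths as words over the set of edges). The graph $S$ is a Rauzy scheme for $W$ if: (1)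 it is strongly connected and has more than one edge; (2) edges leaving the same distributing vertex have front words with pairwise different first letters, and edges entering the same collecting vertex have back words with pairwise different last letters (in particular these words are non-empty); (3) $F(s)=B(s)$ for every symmetric path $s$; (4) for symmetric paths $s_1,s_2$ and every $k$, $F(s_1)\sqsubseteq_k F(s_2)$ implies $s_1\sqsubseteq_k s_2$; (5) all words on the edges are factors of $W$; (6) every factor of $W$ is a factor of $F(s)$ for some symmetric path $s$; (7) for every edge $e$ there is a factor $u_e$ of $W$ such that every symmetric path $s$ with $u_e\sqsubseteq F(s)$ passes through $e$. Evolution. An edge $v$ is supporting if it leads from a collecting vertex to a distributing one. Let $x_i$ be the edges that enter the beginning of $v$, $y_j$ the edges that leave its end, $V=F(v)$, $X_i$ the back word of $x_i$, $Y_j$ the front word of $y_j$. The graph $S'$ is obtained from $S$ by removing $v$, replacing its beginning by vertices $A_i$ (with $x_i$ now ending in $A_i$) and its end by vertices $B_j$ (with $y_j$ now starting in $B_j$), and adding edges $v_{ij}$ from $A_i$ to $B_j$. In $S'$ the front word of $y_j$ is $VY_j$, the front word of $v_{ij}$ is $Y_j$, the back word of $x_i$ is $X_iV$, the back word of $v_{ij}$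 is $X_i$, and all other words are kept. The edge $v_{ij}$ is bad if $X_iVY_j$ is not a factor of $W$; all other edges are good. A vertex of $S'$ is non-vanishing if more than one good edge leaves it or more than one good edge enters it. The elementary evolution $S''$ of $S$ by $v$ has the non-vanishing vertices as its vertices; its edges are the paths of good edges of $S'$ that start and end in non-vanishing vertices and have no other non-vanishing vertices. The front word of an edge $e$ of $S''$ is the front word, computed in $S'$, of the shortest path of $S''$ that begins with $e$ and ends in a distributing vertex; the back word is the back word of the shortest path that ends with $e$ and begins in a collecting vertex. A numbered scheme is a Rauzy scheme whose edges carry distinct natural numbers; erasing the words gives its lightened numbered scheme, a finite directed graph with numbered edges, considered up to isomorphism. A method of evolution $\mathcal M$ is a function that gives to each finite directed graph whose edges are marked with distinct numbers or pairs of numbers (considered up to isomorphism) a new numbering in which each of $1,\dots,n$ is used exactly once ($n$ being the number of edges). The deterministic evolution $\mathrm{Evol}_{\mathcal M}(S)$ of a numbered scheme $S$ is its elementary evolution $S''$ by the supporting edge with the least number, numbered as follows: in $S'$ the old edges keep their numbers and $v_{ij}$ is marked with the pair of the numbers of $x_i$ and $y_j$; each edge of $S''$ is marked with the mark of the first edge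 of the corresponding path of $S'$; the resulting marked graph without words is renumbered by $\mathcal M$. Then the following hold. (a) There is a constant $C_7$, depending only on $W$, such that every Rauzy scheme for $W$ has at most $C_7$ vertices. (b) Only finitely many lightened numbered schemes occur in the deterministic evolution. Precisely, for every method of evolution $\mathcal M$, the set of the lightened numbered schemes of $\mathrm{Evol}_{\mathcal M}^{\,n}(S)$, where $S$ runs over all numbered Rauzy schemes for $W$ and $n$ over all integers $n\ge 1$, is finite up to isomorphism; and for every single numbered Rauzy scheme $S$ for $W$, the set of the lightened numbered schemes of $\mathrm{Evol}_{\mathcal M}^{\,n}(S)$, $n\ge 0$, is finite up to isomorphism. -/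

import Mathlib

/-! ### Finite and infinite words -/

/-- The letters of `W` at the places `i, i + 1, …, i + n - 1`. -/
def window {B : Type*} (W : ℕ → B) (i n : ℕ) : List B :=
  (List.range n).map fun j => W (i + j)

/-- `u` is a subword (factor) of the right-infinite word `W`. -/
def FactorOf {B : Type*} (u : List B) (W : ℕ → B) : Prop :=
  ∃ i, window W i u.length = u

/-- `u` is a beginning (prefix) of the right-infinite word `W`. -/
def BeginningOf {B : Type*} (u : List B) (W : ℕ → B) : Prop :=
  window W 0 u.length = u

def EventuallyPeriodic {B : Type*} (W : ℕ → B) : Prop :=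
  ∃ N k, 0 < k ∧ ∀ i, N ≤ i → W (i + k) = W i

/-- The finite word `u` has at least `k` occurrences in the finite word `w`; an occurrence is given
by the part of `w` that precedes it. -/
def OccursAtLeast {α : Type*} (k : ℕ) (u w : List α) : Prop :=
  k ≤ {l : List α | ∃ r, w = l ++ u ++ r}.ncard

/-! ### Morphic words -/

/-- Some power of `φ` sends every letter to a word that contains all the letters. -/
def IsPrimitiveMorphism {A : Type*} (φ : FreeMonoid A →* FreeMonoid A) : Prop :=
  ∃ k, 0 < k ∧ ∀ a b : A, b ∈ (φ^[k] (FreeMonoid.of a)).toList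

/-- `X` is the purely morphic word `φ^∞(a) = a u φ(u) φ²(u) …`, where `φ(a) = a u` and no `φ^k(u)`
is empty. -/
def IsPurelyMorphic {A : Type*} (φ : FreeMonoid A →* FreeMonoid A) (a : A) (X : ℕ → A) : Prop :=
  ∃ u : FreeMonoid A, φ (FreeMonoid.of a) = FreeMonoid.of a * u ∧ (∀ k, φ^[k] u ≠ 1) ∧
    ∀ n, BeginningOf
      (FreeMonoid.of a * ((List.range n).map fun k => φ^[k] u).prod).toList X

/-- The right-infinite word `W` is the image `ψ(X)`; in particular `ψ(X)` is infinite. -/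
def IsMorphicImage {A B : Type*} (ψ : FreeMonoid A →* FreeMonoid B) (X : ℕ → A) (W : ℕ → B) :
    Prop :=
  (∀ n, BeginningOf (ψ (FreeMonoid.ofList (window X 0 n))).toList W) ∧
    ∀ N, ∃ n, N ≤ (ψ (FreeMonoid.ofList (window X 0 n))).toList.length

/-! ### Directed graphs, in which parallel edges are allowed -/

structure MGraph where
  V : Type
  E : Type
  src : E → V
  tgt : E → V

namespace MGraph

variable (G : MGraph)

/-- In-degree one and out-degree more than one. -/
def Distributing (u : G.V) : Prop :=
  (∃! e, G.tgt e = u) ∧ ∃ e e', e ≠ e' ∧ G.src e = u ∧ G.src e' = u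

/-- In-degree more than one and out-degree one. -/
def Collecting (u : G.V) : Prop :=
  (∃ e e', e ≠ e' ∧ G.tgt e = u ∧ G.tgt e' = u) ∧ ∃! e, G.src e = u

def StronglyConnected : Prop :=
  ∀ u w : G.V, Relation.ReflTransGen (fun x y => ∃ e, G.src e = x ∧ G.tgt e = y) u w

/-- A path, given by its edge record. -/
def IsPath (p : List G.E) : Prop :=
  p ≠ [] ∧ p.IsChain fun e f => G.tgt e = G.src f

/-- The first vertex of `p` has the property `P`. -/
def StartsIn (P : G.V → Prop) (p : List G.E) : Prop :=
  ∃ e ∈ p.head?, P (G.src e)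

/-- The last vertex of `p` has the property `P`. -/
def EndsIn (P : G.V → Prop) (p : List G.E) : Prop :=
  ∃ e ∈ p.getLast?, P (G.tgt e)

def IsSymmetricPath (p : List G.E) : Prop :=
  G.IsPath p ∧ G.StartsIn G.Collecting p ∧ G.EndsIn G.Distributing p

/-- A supporting edge leads from a collecting vertex to a distributing one. -/
def Supporting (e : G.E) : Prop :=
  G.Collecting (G.src e) ∧ G.Distributing (G.tgt e)

/-- `p` is the natural extension of the edge `e` to the right: the minimal path that begins with
`e` and ends in a distributing vertex. -/
def IsRightExtension (e : G.E) (p : List G.E) : Prop :=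
  G.IsPath p ∧ [e] <+: p ∧ G.EndsIn G.Distributing p ∧
    ∀ q, q <+: p → G.EndsIn G.Distributing q → q = p

/-- `p` is the natural extension of the edge `e` to the left: the minimal path that ends with
`e` and begins in a collecting vertex. -/
def IsLeftExtension (e : G.E) (p : List G.E) : Prop :=
  G.IsPath p ∧ [e] <:+ p ∧ G.StartsIn G.Collecting p ∧
    ∀ q, q <:+ p → G.StartsIn G.Collecting q → q = p

end MGraph

/-! ### Graphs with words and Rauzy schemes -/

/-- A directed graph with a front word and a back word on every edge. The condition on the
degrees is `WordGraph.DegreeCondition`. -/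
structure WordGraph (B : Type*) extends MGraph where
  front : E → List B
  back : E → List B

namespace WordGraph

variable {B : Type*} (S : WordGraph B)

/-- Every vertex is distributing or collecting. -/
def DegreeCondition : Prop :=
  ∀ u, S.Distributing u ∨ S.Collecting u

open Classical in
/-- The front generating edges of a path: its first edge and all its edges that leave
distributing vertices. -/
noncomputable def frontGenerators : List S.E → List S.E
  | [] => []
  | e :: p => e :: p.filter fun f => decide (S.Distributing (S.src f))

open Classical in
/-- The back generating edges of a path: all its edges that enter collecting vertices and its
last edge. -/
noncomputable def backGenerators (p : List S.E) : List S.E :=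
  (p.dropLast.filter fun f => decide (S.Collecting (S.tgt f))) ++ p.getLast?.toList

/-- The front word `F(p)` of a path. -/
noncomputable def F (p : List S.E) : List B :=
  (S.frontGenerators p).flatMap S.front

/-- The back word `B(p)` of a path. -/
noncomputable def Bk (p : List S.E) : List B :=
  (S.backGenerators p).flatMap S.back

/-- `S` is a Rauzy scheme for `W`: a finite graph with words that has the seven properties of
Rauzy schemes. -/
structure IsRauzyScheme (S : WordGraph B) (W : ℕ → B) : Prop where
  finite_vertices : Finite S.V
  finite_edges : Finite S.E
  degrees : S.DegreeCondition
  strongly_connected : S.StronglyConnected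
  more_than_one_edge : Nontrivial S.E
  front_ne_nil : ∀ e, S.Distributing (S.src e) → S.front e ≠ []
  front_heads : ∀ e f, S.Distributing (S.src e) → S.src e = S.src f → e ≠ f →
    (S.front e).head? ≠ (S.front f).head?
  back_ne_nil : ∀ e, S.Collecting (S.tgt e) → S.back e ≠ []
  back_lasts : ∀ e f, S.Collecting (S.tgt e) → S.tgt e = S.tgt f → e ≠ f →
    (S.back e).getLast? ≠ (S.back f).getLast?
  symmetric_words : ∀ p, S.IsSymmetricPath p → S.F p = S.Bk p
  occurrences : ∀ p q, S.IsSymmetricPath p → S.IsSymmetricPath q →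
    ∀ k, OccursAtLeast k (S.F p) (S.F q) → OccursAtLeast k p q
  factors : ∀ e, FactorOf (S.front e) W ∧ FactorOf (S.back e) W
  covering : ∀ u, FactorOf u W → ∃ p, S.IsSymmetricPath p ∧ u <:+: S.F p
  edge_words : ∀ e, ∃ u, FactorOf u W ∧ ∀ p, S.IsSymmetricPath p → u <:+: S.F p → e ∈ p

end WordGraph

/-! ### Elementary evolution -/

namespace WordGraph

variable {B : Type*} (S : WordGraph B) (v : S.E)

/-- The vertices of `S'`: old vertices, the vertices `A x` that replace the beginning of `v`
(for the edges `x` that enter it) and the vertices `B y` that replace the end of `v` (for the edges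
`y` that leave it). The two old ends of `v`, and the points `A x`, `B y` for the other edges `x`,
`y`, are incident to no edge of `S'` when `S` is a Rauzy scheme and `v` is supporting, and play no
role. -/
inductive SplitVertex
  | old (u : S.V)
  | A (x : S.E)
  | B (y : S.E)

/-- The edges of `S'`: those of `S` other than `v`, and the new edges `v_{xy}` for `x` entering
the beginning of `v` and `y` leaving its end. -/
inductive SplitEdge
  | old (e : S.E) (h : e ≠ v)
  | new (x y : S.E) (hx : S.tgt x = S.src v) (hy : S.src y = S.tgt v)

open Classical in
/-- The graph with words `S'`: the edge `v` is replaced by a complete bipartite graph. -/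
noncomputable def split : WordGraph B where
  V := S.SplitVertex
  E := S.SplitEdge v
  src
    | .old e _ => if S.src e = S.tgt v then .B e else .old (S.src e)
    | .new x _ _ _ => .A x
  tgt
    | .old e _ => if S.tgt e = S.src v then .A e else .old (S.tgt e)
    | .new _ y _ _ => .B y
  front
    | .old e _ => if S.src e = S.tgt v then S.front v ++ S.front e else S.front e
    | .new _ y _ _ => S.front y
  back
    | .old e _ => if S.tgt e = S.src v then S.back e ++ S.front v else S.back e
    | .new x _ _ _ => S.back x

variable (W : ℕ → B)

/-- The good edges of `S'`: all but the `v_{xy}` for which `B(x) F(v) F(y)` is not a subword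
of `W`. -/
def GoodEdge : SplitEdge S v → Prop
  | .old _ _ => True
  | .new x y _ _ => FactorOf (S.back x ++ S.front v ++ S.front y) W

/-- Vertices of `S'` that are left, or entered, by more than one good edge. -/
def NonVanishing (u : (S.split v).V) : Prop :=
  (∃ e f, e ≠ f ∧ S.GoodEdge v W e ∧ S.GoodEdge v W f ∧
    (S.split v).src e = u ∧ (S.split v).src f = u) ∨
  (∃ e f, e ≠ f ∧ S.GoodEdge v W e ∧ S.GoodEdge v W f ∧
    (S.split v).tgt e = u ∧ (S.split v).tgt f = u)

/-- The paths of `S'` that become edges of `S''`: they use only good edges, begin and end in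
non-vanishing vertices, and have no other non-vanishing vertices. -/
structure IsEvolvedEdge (p : List (S.split v).E) : Prop where
  path : (S.split v).IsPath p
  good : ∀ e ∈ p, S.GoodEdge v W e
  starts : S.NonVanishing v W ((S.split v).src (p.head path.1))
  ends : S.NonVanishing v W ((S.split v).tgt (p.getLast path.1))
  inner : ∀ e ∈ p.dropLast, ¬ S.NonVanishing v W ((S.split v).tgt e)

/-- The graph `S''` without its words. -/
noncomputable def evolvedGraph : MGraph where
  V := {u : (S.split v).V // S.NonVanishing v W u}
  E := {p : List (S.split v).E // S.IsEvolvedEdge v W p}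
  src p := ⟨(S.split v).src (p.1.head p.2.path.1), p.2.starts⟩
  tgt p := ⟨(S.split v).tgt (p.1.getLast p.2.path.1), p.2.ends⟩

/-- The path of `S'` that corresponds to a path of `S''`. -/
noncomputable def unfold (q : List (S.evolvedGraph v W).E) : List (S.split v).E :=
  q.flatMap Subtype.val

open Classical in
/-- The elementary evolution of `(W, S, v)`: the graph `S''`, in which the front word of an edge
is the front word of the path of `S'` that corresponds to the natural extension of the edge to the
right, and the back word is found in the same way on the left. (If there were no natural extension,
the word would be empty.) -/
noncomputable def evolve : WordGraph B where
  toMGraph := S.evolvedGraph v W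
  front e := if h : ∃ q, (S.evolvedGraph v W).IsRightExtension e q then
    (S.split v).F (S.unfold v W h.choose) else []
  back e := if h : ∃ q, (S.evolvedGraph v W).IsLeftExtension e q then
    (S.split v).Bk (S.unfold v W h.choose) else []

end WordGraph

/-! ### Numbered schemes and deterministic evolution -/

/-- A directed graph with a mark from `L` on every edge. The lightened numbered schemes are the
graphs of this kind that arise from numbered schemes by erasing the words. -/
structure NumberedGraph (L : Type) extends MGraph where
  num : E → L

/-- An isomorphism of graphs that preserves the marks. -/
structure NumberedGraph.Iso {L : Type} (G H : NumberedGraph L) where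
  vertex : G.V ≃ H.V
  edge : G.E ≃ H.E
  src_edge : ∀ e, H.src (edge e) = vertex (G.src e)
  tgt_edge : ∀ e, H.tgt (edge e) = vertex (G.tgt e)
  num_edge : ∀ e, H.num (edge e) = G.num e

/-- A numbered graph with words. -/
structure NumberedWordGraph (B : Type*) extends WordGraph B where
  num : E → ℕ

/-- `S` is a numbered Rauzy scheme for `W`: distinct edges carry distinct numbers. -/
def NumberedWordGraph.IsNumberedScheme {B : Type*} (S : NumberedWordGraph B) (W : ℕ → B) : Prop :=
  S.toWordGraph.IsRauzyScheme W ∧ Function.Injective S.num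

/-- The lightened graph: the words are erased. -/
def NumberedWordGraph.lighten {B : Type*} (S : NumberedWordGraph B) : NumberedGraph ℕ where
  toMGraph := S.toMGraph
  num := S.num

/-- A method of evolution: to every finite graph whose edges are marked with distinct numbers or
pairs of numbers it gives a new numbering, in which each of `1, …, n` is used exactly once. It is a
function of the abstract marked graph, so it respects isomorphisms. -/
structure EvolutionMethod where
  renum : (G : NumberedGraph (ℕ ⊕ ℕ × ℕ)) → G.E → ℕ
  bijOn : ∀ G : NumberedGraph (ℕ ⊕ ℕ × ℕ), Finite G.E → Function.Injective G.num →
    Set.BijOn (renum G) Set.univ (Set.Icc 1 (Nat.card G.E))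
  iso_invariant : ∀ (G H : NumberedGraph (ℕ ⊕ ℕ × ℕ)) (f : G.Iso H) (e : G.E),
    renum H (f.edge e) = renum G e

namespace NumberedWordGraph

variable {B : Type*} (S : NumberedWordGraph B) (W : ℕ → B)

/-- The numbering of `S'`: old edges keep their numbers, `v_{xy}` gets the pair of the numbers of
`x` and `y`. -/
def splitNum (v : S.E) : S.SplitEdge v → ℕ ⊕ ℕ × ℕ
  | .old e _ => .inl (S.num e)
  | .new x y _ _ => .inr (S.num x, S.num y)

/-- The lightened graph of `S''`, every edge marked with the mark of the first edge of the
corresponding path of `S'`. -/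
noncomputable def evolvedNumberedGraph (v : S.E) : NumberedGraph (ℕ ⊕ ℕ × ℕ) where
  toMGraph := S.toWordGraph.evolvedGraph v W
  num p := S.splitNum v (p.1.head p.2.path.1)

open Classical in
/-- Deterministic evolution: the elementary evolution by the supporting edge that has the least
number, renumbered by the method of evolution. (A graph without supporting edges, which cannot be a
Rauzy scheme, is left as it is.) -/
noncomputable def evol (M : EvolutionMethod) (S : NumberedWordGraph B) : NumberedWordGraph B :=
  if h : ∃ v, S.Supporting v ∧ ∀ w, S.Supporting w → S.num v ≤ S.num w then
    { toWordGraph := S.toWordGraph.evolve h.choose W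
      num := M.renum (S.evolvedNumberedGraph W h.choose) }
  else S

end NumberedWordGraph

/-! ### Occurrences and factors -/

section Words

/-! Everything rests on one property of `W`: linear recurrence with a constant `R`, meaning that a
factor `u` occurs in every factor of length at least `R * (|u| + 1)`. Primitivity gives it
(`exists_linearlyRecurrent`), since the blocks `ψ(φ^k(c))` of one level `k` have comparable lengths.
Together with non-periodicity it bounds `|z| / s` for every factor `z` of period `s`
(`exists_period_bound`).

The vertex bound counts distributing vertices through right special words. To such a vertex belongs
the word of the left extension of its incoming edge, and this word has two different continuations
in `W`. By the occurrence property of a scheme no such word is a suffix of another, and all their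
lengths are comparable with the length `m` of the shortest word of a supporting edge. Mark, in a
prefix of `W` of length proportional to `m`, one end of each continuation. Two such pairs of places
that are close to each other must coincide, for otherwise `W` would have a long factor of small
period (`eq_of_close_special_pairs`). So the pairs fall into boundedly many cells
(`card_rightSpecial_le`, `card_distributing_le`). Counting edge ends and first letters then bounds
all vertices and edges.

For the evolution it has to be shown that an elementary evolution of a Rauzy scheme is again one
(`IsRauzyScheme.evolve`). Paths of the split graph project to paths of `S`. A path from a collecting
to a distributing place, after restoring at most one `v` at each end, becomes a symmetric path of
`S` with the same words (`exists_restore`). Conversely, a path of `S` inside a path whose word is a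
factor of `W` lifts to good edges (`exists_lift`). Hence good edges are connected to each other
(`exists_goodPath_through`), and each axiom is carried from `S` to the evolved graph.
Non-periodicity enters again: if every vertex vanished, the good edges would form one cycle and `W`
would contain high powers (`exists_nonVanishing`).

After each evolution step the scheme is again a Rauzy scheme, so its size is at most a bound `N`
depending on `W` alone, and its numbers do not exceed the number of its edges. There are finitely
many such numbered graphs up to isomorphism. -/

theorem finite_occurrences {α : Type*} (u w : List α) :
    {l : List α | ∃ r, w = l ++ u ++ r}.Finite := by
  refine (List.finite_toSet w.inits).subset ?_
  rintro l ⟨r, rfl⟩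
  simp [List.mem_inits]

theorem occursAtLeast_one_iff {α : Type*} {u w : List α} : OccursAtLeast 1 u w ↔ u <:+: w := by
  unfold OccursAtLeast
  rw [Nat.succ_le_iff, Set.ncard_pos (finite_occurrences u w)]
  constructor
  · rintro ⟨l, r, h⟩
    exact ⟨l, r, h.symm⟩
  · rintro ⟨l, r, h⟩
    exact ⟨l, r, h.symm⟩

theorem occursAtLeast_two_iff {α : Type*} {u w : List α} : OccursAtLeast 2 u w ↔
    ∃ l₁ r₁ l₂ r₂, w = l₁ ++ u ++ r₁ ∧ w = l₂ ++ u ++ r₂ ∧ l₁ ≠ l₂ := by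
  unfold OccursAtLeast
  rw [show 2 = 1 + 1 from rfl, Nat.succ_le_iff, Set.one_lt_ncard (finite_occurrences u w)]
  constructor
  · rintro ⟨l, ⟨r, h⟩, l', ⟨r', h'⟩, hne⟩
    exact ⟨l, r, l', r', h, h', hne⟩
  · rintro ⟨l, r, l', r', h, h', hne⟩
    exact ⟨l, ⟨r, h⟩, l', ⟨r', h'⟩, hne⟩

variable {B : Type*} {W : ℕ → B}

@[simp] theorem length_window (W : ℕ → B) (i n : ℕ) : (window W i n).length = n := by
  simp [window]

theorem window_add (W : ℕ → B) (i m n : ℕ) :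
    window W i (m + n) = window W i m ++ window W (i + m) n := by
  simp [window, List.range_add, add_assoc]

theorem getElem?_window {i n j : ℕ} (h : j < n) : (window W i n)[j]? = some (W (i + j)) := by
  simp [window, h]

theorem factorOf_window (W : ℕ → B) (i n : ℕ) : FactorOf (window W i n) W :=
  ⟨i, by simp⟩

theorem FactorOf.of_infix {u w : List B} (hw : FactorOf w W) (h : u <:+: w) : FactorOf u W := by
  obtain ⟨l, r, rfl⟩ := h
  obtain ⟨i, hi⟩ := hw
  refine ⟨i + l.length, ?_⟩
  rw [List.length_append, window_add, List.length_append, window_add] at hi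
  have h1 := (List.append_inj hi (by simp)).1
  exact (List.append_inj h1 (by simp)).2

theorem FactorOf.nil : FactorOf [] W := ⟨0, rfl⟩

/-- Every factor of `W` occurs in every factor of proportional length. -/
def LinearlyRecurrent (W : ℕ → B) (R : ℕ) : Prop :=
  ∀ u z, FactorOf u W → FactorOf z W → R * (u.length + 1) ≤ z.length → u <:+: z

/-- A prefix of `W` is cut into five windows: three of length `N`, and between them two that
recurrence makes long enough to contain `u₁` and `u₂`. The paddings leave room for cutting a path at
vertices of a prescribed kind. -/
theorem LinearlyRecurrent.exists_padded {R : ℕ} (hR : LinearlyRecurrent W R) {u₁ u₂ : List B}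
    (h₁ : FactorOf u₁ W) (h₂ : FactorOf u₂ W) (N : ℕ) :
    ∃ a z b : List B, N ≤ a.length ∧ N ≤ z.length ∧ N ≤ b.length ∧
      FactorOf (a ++ u₁ ++ z ++ u₂ ++ b) W := by
  obtain ⟨l₁, r₁, e₁⟩ := hR u₁ (window W N (R * (u₁.length + 1))) h₁ (factorOf_window _ _ _) (by simp)
  obtain ⟨l₂, r₂, e₂⟩ := hR u₂ (window W (N + R * (u₁.length + 1) + N) (R * (u₂.length + 1))) h₂
    (factorOf_window _ _ _) (by simp)
  refine ⟨window W 0 N ++ l₁, r₁ ++ window W (N + R * (u₁.length + 1)) N ++ l₂,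
    r₂ ++ window W (N + R * (u₁.length + 1) + N + R * (u₂.length + 1)) N, by simp, ?_, by simp, ?_⟩
  · simp only [List.length_append, length_window]; omega
  · have := factorOf_window W 0 (N + R * (u₁.length + 1) + N + R * (u₂.length + 1) + N)
    simp only [window_add, zero_add, ← e₁, ← e₂] at this
    simpa using this

/-- A linearly recurrent word that is not periodic has no long factors of small period. -/
theorem LinearlyRecurrent.exists_period_bound {R : ℕ} (hR : LinearlyRecurrent W R)
    (hper : ¬ EventuallyPeriodic W) : ∃ Q, 0 < Q ∧ ∀ (z : List B) (s : ℕ), 0 < s → FactorOf z W →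
      (∀ i, i + s < z.length → z[i + s]? = z[i]?) → z.length < Q * s := by
  -- If `|z| ≥ (3 * R + 1) * s`, then `|z| ≥ R * (s + 2)`, so `z` contains every factor of length `s
  -- + 1`. The period of `z` then gives `W (i + s) = W i` for all `i`.
  refine ⟨3 * R + 1, by omega, fun z s hs hz h => ?_⟩
  by_contra! hlen
  refine hper ⟨0, s, hs, fun i _ => ?_⟩
  obtain ⟨l, r, e⟩ := hR (window W i (s + 1)) z (factorOf_window _ _ _) hz (by
    simp only [length_window]; nlinarith)
  have hl : l.length + (s + 1) + r.length = z.length := by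
    rw [← e]; simp only [List.length_append, length_window]
  have key : ∀ j, j ≤ s → z[l.length + j]? = some (W (i + j)) := by
    intro j hj
    rw [← e, List.append_assoc, List.getElem?_append_right (by omega),
      List.getElem?_append_left (by simp only [length_window]; omega)]
    simpa using getElem?_window (W := W) (i := i) (n := s + 1) (j := j) (by omega)
  have h0 := key 0 (by omega)
  have h1 := key s le_rfl
  have h2 := h l.length (by omega)
  rw [h1] at h2
  simp only [add_zero] at h0
  rw [h0] at h2
  exact Option.some.inj h2

/-- The power `c^Q` has period `|c|` and length `Q * |c|`, which the period bound forbids unless `c`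
is empty. -/
theorem LinearlyRecurrent.exists_power_bound {R : ℕ} (hR : LinearlyRecurrent W R)
    (hper : ¬ EventuallyPeriodic W) :
    ∃ Q, ∀ c : List B, FactorOf (List.replicate Q c).flatten W → c = [] := by
  obtain ⟨Q, hQ, h⟩ := hR.exists_period_bound hper
  refine ⟨Q, fun c hc => ?_⟩
  by_contra hne
  have hpos : 0 < c.length := List.length_pos_of_ne_nil hne
  have := h _ c.length hpos hc ?_
  · simp at this
  · obtain ⟨k, rfl⟩ : ∃ k, Q = k + 1 := ⟨Q - 1, by omega⟩
    intro i hi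
    have e1 : (List.replicate (k + 1) c).flatten = c ++ (List.replicate k c).flatten := by
      simp [List.replicate_succ]
    have e2 : (List.replicate (k + 1) c).flatten = (List.replicate k c).flatten ++ c := by
      simp [List.replicate_succ']
    have hi' : i < (List.replicate k c).flatten.length := by
      rw [e1, List.length_append] at hi; omega
    conv_rhs => rw [e2, List.getElem?_append_left hi']
    rw [e1, List.getElem?_append_right (by omega)]
    simp

end Words

/-! ### Linear recurrence of morphic words -/

section Blocks

variable {α β : Type*}

theorem infix_flatMap_of_infix {y t : List α} (g : α → List β) (h : t <:+: y) :
    t.flatMap g <:+: y.flatMap g := by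
  obtain ⟨l, r, rfl⟩ := h
  exact ⟨l.flatMap g, r.flatMap g, by simp⟩

/-- As no block is shorter than `u`, an occurrence of `u` that starts in one block ends at the
latest in the next. The induction discards blocks that end before the occurrence starts. -/
theorem exists_pair_of_infix_flatMap (g : α → List β) (u : List β)
    (hg : ∀ c, u.length ≤ (g c).length) (y : List α) (h : u <:+: y.flatMap g) :
    ∃ t, t <:+: y ∧ t.length ≤ 2 ∧ u <:+: t.flatMap g := by
  induction y with
  | nil => exact ⟨[], List.infix_rfl, by simp, h⟩
  | cons c y ih =>
    obtain ⟨l, r, e⟩ := h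
    rw [List.flatMap_cons] at e
    by_cases hl : (g c).length ≤ l.length
    · have hp : g c <+: l := by
        refine List.prefix_of_prefix_length_le (l₃ := g c ++ y.flatMap g) (by simp) ?_ hl
        exact ⟨u ++ r, by rw [← e]; simp⟩
      obtain ⟨l', rfl⟩ := hp
      simp only [List.append_assoc, List.append_cancel_left_eq] at e
      obtain ⟨t, ht, h2, hu⟩ := ih ⟨l', r, by simpa using e⟩
      exact ⟨t, ht.trans (List.suffix_cons c y).isInfix, h2, hu⟩
    · push Not at hl
      cases y with
      | nil => exact ⟨[c], List.infix_rfl, by simp, l, r, by simpa using e⟩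
      | cons d y =>
        refine ⟨[c, d], ⟨[], y, by simp⟩, by simp, ?_⟩
        have hp : l ++ u <+: g c ++ g d := by
          refine List.prefix_of_prefix_length_le (l₃ := l ++ u ++ r) (by simp) ?_ ?_
          · rw [e]; exact ⟨y.flatMap g, by simp⟩
          · have := hg d
            simp only [List.length_append]; omega
        obtain ⟨r', hr'⟩ := hp
        exact ⟨l, r', by simpa using hr'⟩

/-- The block in which `z` starts uses up at most `M` letters of `z`. More than `M` letters remain,
so the next block lies entirely in `z`. -/
theorem exists_block_infix (g : α → List β) (M : ℕ) (hg : ∀ c, (g c).length ≤ M) (z : List β)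
    (hz : 2 * M < z.length) (y : List α) (h : z <:+: y.flatMap g) : ∃ c, g c <:+: z := by
  induction y with
  | nil =>
    have := h.length_le
    simp only [List.flatMap_nil, List.length_nil] at this
    omega
  | cons c y ih =>
    obtain ⟨l, r, e⟩ := h
    rw [List.flatMap_cons] at e
    by_cases hl : (g c).length ≤ l.length
    · have hp : g c <+: l := by
        refine List.prefix_of_prefix_length_le (l₃ := g c ++ y.flatMap g) (by simp) ?_ hl
        exact ⟨z ++ r, by rw [← e]; simp⟩
      obtain ⟨l', rfl⟩ := hp
      simp only [List.append_assoc, List.append_cancel_left_eq] at e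
      exact ih ⟨l', r, by simpa using e⟩
    · push Not at hl
      have hc := hg c
      cases y with
      | nil =>
        have := congrArg List.length e
        simp only [List.flatMap_nil, List.append_nil, List.length_append] at this
        omega
      | cons d y =>
        have hd := hg d
        obtain ⟨s, hs⟩ : l <+: g c :=
          List.prefix_of_prefix_length_le (l₃ := l ++ z ++ r) (by simp) (by rw [e]; simp) hl.le
        have hs' := congrArg List.length hs
        rw [List.length_append] at hs'
        rw [← hs, List.flatMap_cons] at e
        simp only [List.append_assoc, List.append_cancel_left_eq] at e
        obtain ⟨q, hq⟩ : s ++ g d <+: z := by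
          refine List.prefix_of_prefix_length_le (l₃ := z ++ r) ?_ (by simp) ?_
          · rw [e]; exact ⟨y.flatMap g, by simp⟩
          · simp only [List.length_append]; omega
        exact ⟨d, s, q, hq⟩

end Blocks

section Morphic

variable {A B : Type*}

theorem FreeMonoid.toList_hom_eq_flatMap (f : FreeMonoid A →* FreeMonoid B) (w : FreeMonoid A) :
    (f w).toList = w.toList.flatMap fun a => (f (FreeMonoid.of a)).toList := by
  induction w using FreeMonoid.inductionOn' with
  | one => simp
  | of_mul a w ih => simp [ih]

/-- The image of the letter `a` under `ψ ∘ φ^k`. -/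
def morphicBlock (φ : FreeMonoid A →* FreeMonoid A) (ψ : FreeMonoid A →* FreeMonoid B) (k : ℕ)
    (a : A) : List B :=
  (ψ (φ^[k] (FreeMonoid.of a))).toList

variable (φ : FreeMonoid A →* FreeMonoid A) (ψ : FreeMonoid A →* FreeMonoid B)

theorem toList_iterate_eq_flatMap (k : ℕ) (w : FreeMonoid A) :
    (ψ (φ^[k] w)).toList = w.toList.flatMap (morphicBlock φ ψ k) := by
  exact FreeMonoid.toList_hom_eq_flatMap
    { toFun := fun x => ψ (φ^[k] x)
      map_one' := by rw [iterate_map_one, map_one]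
      map_mul' := fun x y => by rw [iterate_map_mul, map_mul] } w

theorem morphicBlock_add (j k : ℕ) (a : A) : morphicBlock φ ψ (j + k) a =
    (φ^[j] (FreeMonoid.of a)).toList.flatMap (morphicBlock φ ψ k) := by
  rw [← toList_iterate_eq_flatMap, morphicBlock, ← Function.iterate_add_apply, add_comm]

variable {φ ψ}

theorem iterate_prefix {a : A} {u : FreeMonoid A} (hu : φ (FreeMonoid.of a) = FreeMonoid.of a * u)
    (n : ℕ) : φ^[n] (FreeMonoid.of a) =
      FreeMonoid.of a * ((List.range n).map fun k => φ^[k] u).prod := by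
  induction n with
  | zero => simp
  | succ n ih =>
    rw [List.range_succ, List.map_append, List.prod_append, ← mul_assoc, ← ih,
      Function.iterate_succ_apply, hu, iterate_map_mul]
    simp

theorem iterate_prefix_succ {a : A} {u : FreeMonoid A}
    (hu : φ (FreeMonoid.of a) = FreeMonoid.of a * u) (n : ℕ) :
    (φ^[n] (FreeMonoid.of a)).toList <+: (φ^[n + 1] (FreeMonoid.of a)).toList := by
  rw [Function.iterate_succ_apply, hu, iterate_map_mul, FreeMonoid.toList_mul]
  simp

theorem iterate_prefix_of_le {a : A} {u : FreeMonoid A}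
    (hu : φ (FreeMonoid.of a) = FreeMonoid.of a * u) {m n : ℕ} (h : m ≤ n) :
    (φ^[m] (FreeMonoid.of a)).toList <+: (φ^[n] (FreeMonoid.of a)).toList := by
  induction n, h using Nat.le_induction with
  | base => exact List.prefix_rfl
  | succ n _ ih => exact ih.trans (iterate_prefix_succ hu n)

theorem lt_length_iterate {a : A} {u : FreeMonoid A}
    (hu : φ (FreeMonoid.of a) = FreeMonoid.of a * u) (hne : ∀ k, φ^[k] u ≠ 1) (n : ℕ) :
    n < (φ^[n] (FreeMonoid.of a)).toList.length := by
  induction n with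
  | zero => simp
  | succ n ih =>
    rw [Function.iterate_succ_apply, hu, iterate_map_mul, FreeMonoid.toList_mul,
      List.length_append]
    have : 0 < (φ^[n] u).toList.length := by
      rw [List.length_pos_iff]
      exact fun h => hne n (FreeMonoid.toList.injective h)
    omega

/-- The factors of a morphic word are the factors of the words `ψ(φ^n(a))`. -/
theorem exists_forall_infix_morphicBlock {a : A} {X : ℕ → A} {W : ℕ → B}
    (hX : IsPurelyMorphic φ a X) (hW : IsMorphicImage ψ X W) {u : List B} (hu : FactorOf u W) :
    ∃ N, ∀ n, N ≤ n → u <:+: morphicBlock φ ψ n a := by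
  obtain ⟨w, hw, hne, hbeg⟩ := hX
  obtain ⟨i, hi⟩ := hu
  obtain ⟨N, hN⟩ := hW.2 (i + u.length)
  refine ⟨N, fun n hn => ?_⟩
  have e1 : window X 0 (φ^[n] (FreeMonoid.of a)).toList.length =
      (φ^[n] (FreeMonoid.of a)).toList := by
    have := hbeg n
    rwa [← iterate_prefix hw] at this
  have e2 : window W 0 (morphicBlock φ ψ n a).length = morphicBlock φ ψ n a := by
    have := hW.1 (φ^[n] (FreeMonoid.of a)).toList.length
    rw [e1] at this
    exact this
  -- The word `φ^n(a)` has more than `n ≥ N` letters, so its image extends the image of the first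
  -- `N` letters of `X`, which already reaches the end of the occurrence of `u`.
  have hlen : i + u.length ≤ (morphicBlock φ ψ n a).length := by
    refine hN.trans ?_
    have hlt := lt_length_iterate hw hne n
    obtain ⟨m, hm⟩ : ∃ m, (φ^[n] (FreeMonoid.of a)).toList.length = N + m :=
      ⟨_, (Nat.add_sub_cancel' (by omega)).symm⟩
    rw [hm, window_add] at e1
    have : morphicBlock φ ψ n a = (ψ (FreeMonoid.ofList (window X 0 N))).toList ++
        (ψ (FreeMonoid.ofList (window X (0 + N) m))).toList := by
      rw [morphicBlock, ← FreeMonoid.toList_mul, ← map_mul, ← FreeMonoid.ofList_append, e1]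
      simp
    rw [this, List.length_append]
    omega
  obtain ⟨m, hm⟩ : ∃ m, (morphicBlock φ ψ n a).length = i + (u.length + m) :=
    ⟨(morphicBlock φ ψ n a).length - (i + u.length), by omega⟩
  rw [hm, window_add, window_add, zero_add, hi] at e2
  exact ⟨_, _, by rw [← e2, List.append_assoc]⟩

/-- Choose a level `k` at which block lengths are of the order of `|u|`. Then `u` is covered by two
neighbouring blocks of level `K + k`. There are finitely many pairs of neighbouring letters, and all
of them occur in every block of a level higher by a constant; a factor proportional to `|u|`
contains a whole block of that level. -/
theorem exists_linearlyRecurrent [Finite A] {a : A} {X : ℕ → A} {W : ℕ → B}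
    (hφ : IsPrimitiveMorphism φ) (hX : IsPurelyMorphic φ a X) (hW : IsMorphicImage ψ X W) :
    ∃ R, LinearlyRecurrent W R := by
  classical
  have := Fintype.ofFinite A
  have hfac := fun {u} => exists_forall_infix_morphicBlock (u := u) hX hW
  obtain ⟨w, hw, hne, -⟩ := hX
  obtain ⟨K, -, hK⟩ := hφ
  set M : ℕ → ℕ := fun k => Finset.univ.sup fun c => (morphicBlock φ ψ k c).length with hM
  have hle : ∀ k c, (morphicBlock φ ψ k c).length ≤ M k := fun k c =>
    Finset.le_sup (f := fun c => (morphicBlock φ ψ k c).length) (Finset.mem_univ c)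
  -- Since `φ^K(c)` contains every letter, each block of level `K + k` contains the longest block of
  -- level `k`.
  have hlow : ∀ k c, M k ≤ (morphicBlock φ ψ (K + k) c).length := by
    intro k c
    refine Finset.sup_le fun b _ => ?_
    rw [morphicBlock_add]
    obtain ⟨l, r, h⟩ := List.append_of_mem (hK c b)
    rw [h]
    simp only [List.flatMap_append, List.flatMap_cons, List.length_append]
    omega
  have hup : ∀ j, ∃ D, ∀ k, M (j + k) ≤ D * M k := by
    intro j
    refine ⟨Finset.univ.sup fun c => (φ^[j] (FreeMonoid.of c)).toList.length, fun k => ?_⟩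
    refine Finset.sup_le fun c _ => ?_
    rw [morphicBlock_add, List.length_flatMap]
    refine (List.sum_le_card_nsmul _ (M k) ?_).trans ?_
    · simp only [List.mem_map]
      rintro _ ⟨b, -, rfl⟩
      exact hle k b
    · rw [List.length_map, smul_eq_mul]
      exact Nat.mul_le_mul_right _
        (Finset.le_sup (f := fun c => (φ^[j] (FreeMonoid.of c)).toList.length) (Finset.mem_univ c))
  have hunb : ∀ n, ∃ k, n ≤ M k := by
    intro n
    obtain ⟨N, hN⟩ := hfac (factorOf_window W 0 n)
    refine ⟨N, ?_⟩
    have := (hN N le_rfl).length_le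
    rw [length_window] at this
    exact this.trans (hle N a)
  obtain ⟨D₁, hD₁⟩ := hup 1
  -- The least level with `n ≤ M k` is taken. Unless it is `0`, the preceding level has `M (k - 1) <
  -- n`, and one level multiplies `M` by at most `D₁`.
  have hscale : ∀ n, ∃ k, n ≤ M k ∧ M k ≤ (D₁ + M 0) * (n + 1) := by
    intro n
    refine ⟨Nat.find (hunb n), Nat.find_spec (hunb n), ?_⟩
    rcases h : Nat.find (hunb n) with _ | k
    · nlinarith
    · have h1 : ¬ n ≤ M k := Nat.find_min (hunb n) (by omega)
      have h2 := hD₁ k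
      rw [add_comm] at h2
      push Not at h1
      nlinarith
  -- The words `φ^n(a)` are prefixes of one another, so one exponent serves for all the finitely
  -- many words of length at most two.
  have hJ : ∃ J, ∀ t : List A, t.length ≤ 2 → (∃ n, t <:+: (φ^[n] (FreeMonoid.of a)).toList) →
      t <:+: (φ^[J] (FreeMonoid.of a)).toList := by
    have hfin : {t : List A | t.length ≤ 2}.Finite := List.finite_length_le A 2
    have hch : ∀ t : List A, ∃ n, (∃ n, t <:+: (φ^[n] (FreeMonoid.of a)).toList) →
        t <:+: (φ^[n] (FreeMonoid.of a)).toList := by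
      intro t
      by_cases h : ∃ n, t <:+: (φ^[n] (FreeMonoid.of a)).toList
      · exact ⟨h.choose, fun _ => h.choose_spec⟩
      · exact ⟨0, fun h' => absurd h' h⟩
    choose ν hν using hch
    refine ⟨hfin.toFinset.sup ν, fun t ht h => (hν t h).trans ?_⟩
    exact (iterate_prefix_of_le hw (Finset.le_sup (by simpa using ht))).isInfix
  obtain ⟨J, hJ⟩ := hJ
  obtain ⟨D₂, hD₂⟩ := hup (K + J + K)
  -- `(D₁ + M 0) * (|u| + 1)` bounds the blocks of level `k`, `D₂` passes to level `K + J + K + k`,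
  -- and finding a whole block in `z` needs strictly more than twice that length.
  refine ⟨2 * (D₂ * (D₁ + M 0)) + 1, fun u z hu hz hlen => ?_⟩
  obtain ⟨k, hk1, hk2⟩ := hscale u.length
  have hu1 : ∀ c, u.length ≤ (morphicBlock φ ψ (K + k) c).length := fun c => hk1.trans (hlow k c)
  obtain ⟨N, hN⟩ := hfac hu
  have hN1 := hN (N + (K + k)) (by omega)
  rw [morphicBlock_add] at hN1
  obtain ⟨t, ht1, ht2, ht3⟩ := exists_pair_of_infix_flatMap _ u hu1 _ hN1
  -- `φ^K(c)` contains `a`, hence `φ^(J + K)(c)` contains `φ^J(a)` and with it the pair `t`.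
  have hut : ∀ c, u <:+: morphicBlock φ ψ (K + J + K + k) c := by
    intro c
    rw [show K + J + K + k = (K + J) + (K + k) by ring, morphicBlock_add]
    refine ht3.trans (infix_flatMap_of_infix _ ((hJ t ht2 ⟨N, ht1⟩).trans ?_))
    rw [add_comm K J, Function.iterate_add_apply]
    obtain ⟨l, r, h⟩ := List.append_of_mem (hK c a)
    have : φ^[K] (FreeMonoid.of c) =
        FreeMonoid.ofList l * FreeMonoid.of a * FreeMonoid.ofList r := by
      apply FreeMonoid.toList.injective
      rw [h]; simp
    rw [this, iterate_map_mul, iterate_map_mul]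
    rw [FreeMonoid.toList_mul, FreeMonoid.toList_mul]
    exact ⟨_, _, rfl⟩
  obtain ⟨N', hN'⟩ := hfac hz
  have hN2 := hN' (N' + (K + J + K + k)) (by omega)
  rw [morphicBlock_add] at hN2
  obtain ⟨c, hc⟩ := exists_block_infix _ (M (K + J + K + k)) (fun c => hle _ c) z (by
    have h1 := hD₂ k
    have h2 : D₂ * M k ≤ D₂ * ((D₁ + M 0) * (u.length + 1)) := Nat.mul_le_mul_left _ hk2
    have h3 : (2 * (D₂ * (D₁ + M 0)) + 1) * (u.length + 1) =
      2 * (D₂ * ((D₁ + M 0) * (u.length + 1))) + (u.length + 1) := by ring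
    omega) _ hN2
  exact (hut c).trans hc

end Morphic

/-! ### Paths in directed graphs -/

namespace MGraph

variable (G : MGraph)

/-- The graph with all edges reversed. -/
abbrev rev : MGraph where
  V := G.V
  E := G.E
  src := G.tgt
  tgt := G.src

variable {G}

theorem rev_distributing {u : G.V} : G.rev.Distributing u ↔ G.Collecting u := and_comm

theorem rev_collecting {u : G.V} : G.rev.Collecting u ↔ G.Distributing u := and_comm

theorem Distributing.not_collecting {u : G.V} (h : G.Distributing u) : ¬ G.Collecting u := by
  rintro ⟨⟨e, f, hne, he, hf⟩, -⟩
  exact hne (h.1.unique he hf)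

theorem Distributing.eq_of_tgt {u : G.V} (h : G.Distributing u) {e f : G.E} (he : G.tgt e = u)
    (hf : G.tgt f = u) : e = f :=
  h.1.unique he hf

theorem Collecting.eq_of_src {u : G.V} (h : G.Collecting u) {e f : G.E} (he : G.src e = u)
    (hf : G.src f = u) : e = f :=
  h.2.unique he hf

theorem isPath_singleton (e : G.E) : G.IsPath [e] := ⟨by simp, by simp⟩

theorem isPath_cons_cons {e f : G.E} {t : List G.E} :
    G.IsPath (e :: f :: t) ↔ G.tgt e = G.src f ∧ G.IsPath (f :: t) := by
  simp [IsPath]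

theorem isPath_append {p q : List G.E} (hp : p ≠ []) (hq : q ≠ []) :
    G.IsPath (p ++ q) ↔ G.IsPath p ∧ G.IsPath q ∧
      ∀ x ∈ p.getLast?, ∀ y ∈ q.head?, G.tgt x = G.src y := by
  simp [IsPath, List.isChain_append, hp, hq]

theorem IsPath.of_infix {p q : List G.E} (hq : G.IsPath q) (h : p <:+: q) (hp : p ≠ []) :
    G.IsPath p :=
  ⟨hp, hq.2.infix h⟩

theorem isPath_rev {p : List G.E} : G.rev.IsPath p.reverse ↔ G.IsPath p := by
  simp only [IsPath, ne_eq, List.reverse_eq_nil_iff, List.isChain_reverse]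
  simp only [eq_comm]

theorem startsIn_cons {P : G.V → Prop} {e : G.E} {t : List G.E} :
    G.StartsIn P (e :: t) ↔ P (G.src e) := by
  simp [StartsIn]

theorem startsIn_append {P : G.V → Prop} {p q : List G.E} (hp : p ≠ []) :
    G.StartsIn P (p ++ q) ↔ G.StartsIn P p := by
  obtain ⟨e, t, rfl⟩ := List.exists_cons_of_ne_nil hp
  simp [StartsIn]

theorem endsIn_concat {P : G.V → Prop} {e : G.E} {t : List G.E} :
    G.EndsIn P (t ++ [e]) ↔ P (G.tgt e) := by
  simp [EndsIn]

theorem endsIn_singleton {P : G.V → Prop} {e : G.E} :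
    G.EndsIn P [e] ↔ P (G.tgt e) := by
  simp [EndsIn]

theorem endsIn_append {P : G.V → Prop} {p q : List G.E} (hq : q ≠ []) :
    G.EndsIn P (p ++ q) ↔ G.EndsIn P q := by
  obtain ⟨t, e, rfl⟩ := (List.eq_nil_or_concat' q).resolve_left hq
  rw [← List.append_assoc, endsIn_concat, endsIn_concat]

theorem endsIn_cons_cons {P : G.V → Prop} {e f : G.E} {t : List G.E} :
    G.EndsIn P (e :: f :: t) ↔ G.EndsIn P (f :: t) :=
  endsIn_append (p := [e]) (by simp)

theorem startsIn_rev {P : G.V → Prop} {p : List G.E} :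
    G.rev.StartsIn P p.reverse ↔ G.EndsIn P p := by
  unfold StartsIn EndsIn
  rw [List.head?_reverse]

theorem endsIn_rev {P : G.V → Prop} {p : List G.E} :
    G.rev.EndsIn P p.reverse ↔ G.StartsIn P p := by
  unfold StartsIn EndsIn
  rw [List.getLast?_reverse]

theorem isSymmetricPath_rev {p : List G.E} :
    G.rev.IsSymmetricPath p.reverse ↔ G.IsSymmetricPath p := by
  unfold IsSymmetricPath
  rw [isPath_rev, startsIn_rev, endsIn_rev, and_congr_right_iff, and_comm]
  intro _
  have h1 : G.rev.Distributing = G.Collecting := funext fun _ => propext rev_distributing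
  have h2 : G.rev.Collecting = G.Distributing := funext fun _ => propext rev_collecting
  rw [h1, h2]

theorem isRightExtension_rev {e : G.E} {p : List G.E} :
    G.rev.IsRightExtension e p.reverse ↔ G.IsLeftExtension e p := by
  have h1 : G.rev.Distributing = G.Collecting := funext fun _ => propext rev_distributing
  unfold IsRightExtension IsLeftExtension
  rw [isPath_rev, endsIn_rev, h1]
  refine and_congr_right fun _ => and_congr ?_ (and_congr_right fun _ => ?_)
  · rw [← List.reverse_singleton]
    exact List.reverse_prefix
  · constructor
    · intro h q hq hs
      exact List.reverse_injective (h q.reverse (List.reverse_prefix.mpr hq) (endsIn_rev.mpr hs))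
    · intro h q hq hs
      rw [← h q.reverse (by rw [← List.reverse_prefix]; simpa using hq)
        (by rw [← endsIn_rev]; simpa using hs)]
      simp

/-- Minimality among prefixes amounts to the absence of inner distributing vertices. This local form
is the one suited to induction along the path. -/
theorem isRightExtension_iff {e : G.E} {p : List G.E} : G.IsRightExtension e p ↔
    G.IsPath p ∧ [e] <+: p ∧ G.EndsIn G.Distributing p ∧
      ∀ f ∈ p.dropLast, ¬ G.Distributing (G.tgt f) := by
  refine and_congr_right fun hp => and_congr_right fun _ => and_congr_right fun he => ?_
  obtain ⟨t, g, rfl⟩ := (List.eq_nil_or_concat' p).resolve_left hp.1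
  rw [List.dropLast_concat]
  constructor
  · intro h f hf hd
    obtain ⟨a, b, rfl⟩ := List.append_of_mem hf
    have := congrArg List.length (h (a ++ [f]) ⟨b ++ [g], by simp⟩ (endsIn_concat.mpr hd))
    simp at this
  · rintro h q ⟨r, hr⟩ hq
    rcases List.eq_nil_or_concat' r with rfl | ⟨r', x, rfl⟩
    · simpa using hr
    · exfalso
      rw [← List.append_assoc] at hr
      have hr' := (List.append_inj' hr rfl).1
      obtain ⟨x, hx, hd⟩ := hq
      exact h x (by rw [← hr']; exact List.mem_append_left _ (List.mem_of_getLast? hx)) hd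

theorem IsRightExtension.eq_cons {e : G.E} {p : List G.E} (h : G.IsRightExtension e p) :
    ∃ t, p = e :: t := by
  obtain ⟨t, ht⟩ := h.2.1
  exact ⟨t, ht.symm⟩

theorem isRightExtension_singleton {e : G.E} (h : G.Distributing (G.tgt e)) :
    G.IsRightExtension e [e] := by
  rw [isRightExtension_iff]
  exact ⟨isPath_singleton e, List.prefix_rfl, endsIn_singleton.mpr h, by simp⟩

theorem isRightExtension_cons {e f : G.E} {t : List G.E} (hef : G.tgt e = G.src f)
    (h : ¬ G.Distributing (G.tgt e)) (ht : G.IsRightExtension f (f :: t)) :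
    G.IsRightExtension e (e :: f :: t) := by
  rw [isRightExtension_iff] at ht ⊢
  refine ⟨isPath_cons_cons.mpr ⟨hef, ht.1⟩, ⟨f :: t, rfl⟩, endsIn_cons_cons.mpr ht.2.2.1, ?_⟩
  intro x hx
  rw [List.dropLast_cons_cons, List.mem_cons] at hx
  rcases hx with rfl | hx
  · exact h
  · exact ht.2.2.2 x hx

/-- A path that ends in a distributing vertex begins with the right extension of its first edge. -/
theorem exists_rightExtension_prefix {e : G.E} {t : List G.E} (hp : G.IsPath (e :: t))
    (he : G.EndsIn G.Distributing (e :: t)) :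
    ∃ r s, e :: t = r ++ s ∧ G.IsRightExtension e r := by
  induction t generalizing e with
  | nil => exact ⟨[e], [], rfl, isRightExtension_singleton (endsIn_singleton.mp he)⟩
  | cons f t ih =>
    by_cases h : G.Distributing (G.tgt e)
    · exact ⟨[e], f :: t, rfl, isRightExtension_singleton h⟩
    · rw [isPath_cons_cons] at hp
      obtain ⟨r, s, hrs, hr⟩ := ih hp.2 (endsIn_cons_cons.mp he)
      obtain ⟨r', rfl⟩ := hr.eq_cons
      exact ⟨e :: f :: r', s, by simpa using hrs, isRightExtension_cons hp.1 h hr⟩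

theorem exists_leftExtension_suffix {e : G.E} {t : List G.E} (hp : G.IsPath (t ++ [e]))
    (he : G.StartsIn G.Collecting (t ++ [e])) :
    ∃ s r, t ++ [e] = s ++ r ∧ G.IsLeftExtension e r := by
  have h1 : G.rev.Distributing = G.Collecting := funext fun _ => propext rev_distributing
  rw [← isPath_rev, List.reverse_append] at hp
  rw [← endsIn_rev, List.reverse_append] at he
  obtain ⟨r, s, hrs, hr⟩ := exists_rightExtension_prefix (G := G.rev) hp (h1 ▸ he)
  refine ⟨s.reverse, r.reverse, ?_, ?_⟩
  · have := congrArg List.reverse hrs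
    simpa using this
  · rw [← isRightExtension_rev]; simpa using hr

/-- Two paths without distributing inner vertices that begin with the same edge and end in
distributing vertices are equal. -/
theorem IsRightExtension.unique (hdeg : ∀ u, G.Distributing u ∨ G.Collecting u) {e : G.E}
    {p q : List G.E} (hp : G.IsRightExtension e p) (hq : G.IsRightExtension e q) : p = q := by
  obtain ⟨t, rfl⟩ := hp.eq_cons
  induction t generalizing e q with
  | nil => exact hq.2.2.2 [e] hq.2.1 hp.2.2.1
  | cons f t ih =>
    obtain ⟨s, rfl⟩ := hq.eq_cons
    have hp' := isRightExtension_iff.mp hp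
    have hq' := isRightExtension_iff.mp hq
    have hd : ¬ G.Distributing (G.tgt e) := hp'.2.2.2 e (by simp)
    cases s with
    | nil => exact absurd (endsIn_singleton.mp hq.2.2.1) hd
    | cons g s =>
      have h1 := isPath_cons_cons.mp hp.1
      have h2 := isPath_cons_cons.mp hq.1
      obtain rfl : f = g := ((hdeg _).resolve_left hd).eq_of_src h1.1.symm h2.1.symm
      have key : ∀ {t'}, G.IsRightExtension e (e :: f :: t') → G.IsRightExtension f (f :: t') := by
        intro t' h
        rw [isRightExtension_iff] at h ⊢
        refine ⟨(isPath_cons_cons.mp h.1).2, ⟨t', rfl⟩, endsIn_cons_cons.mp h.2.2.1, ?_⟩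
        intro x hx
        exact h.2.2.2 x (by rw [List.dropLast_cons_cons]; exact List.mem_cons_of_mem _ hx)
      rw [ih (hp := key hp) (hq := key hq)]

theorem IsLeftExtension.unique (hdeg : ∀ u, G.Distributing u ∨ G.Collecting u) {e : G.E}
    {p q : List G.E} (hp : G.IsLeftExtension e p) (hq : G.IsLeftExtension e q) : p = q :=
  List.reverse_injective <| IsRightExtension.unique (G := G.rev)
    (fun u => (hdeg u).symm.imp rev_distributing.mpr rev_collecting.mpr)
    (isRightExtension_rev.mpr hp) (isRightExtension_rev.mpr hq)

/-- Prefixing an edge that enters `u` keeps the path non-empty even when `u = w`. -/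
theorem exists_path_of_reflTransGen {u w : G.V}
    (h : Relation.ReflTransGen (fun x y => ∃ e, G.src e = x ∧ G.tgt e = y) u w) :
    ∀ e, G.tgt e = u → ∃ t, G.IsPath (e :: t) ∧ G.EndsIn (· = w) (e :: t) := by
  induction h using Relation.ReflTransGen.head_induction_on with
  | refl => exact fun e he => ⟨[], isPath_singleton e, endsIn_singleton.mpr he⟩
  | head h _ ih =>
    intro e he
    obtain ⟨f, hf, hf'⟩ := h
    obtain ⟨t, ht, ht'⟩ := ih f hf'
    exact ⟨f :: t, isPath_cons_cons.mpr ⟨he.trans hf.symm, ht⟩, endsIn_cons_cons.mpr ht'⟩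

theorem StronglyConnected.exists_path (h : G.StronglyConnected) (e : G.E) (w : G.V) :
    ∃ t, G.IsPath (e :: t) ∧ G.EndsIn (· = w) (e :: t) :=
  exists_path_of_reflTransGen (h _ w) e rfl

theorem StronglyConnected.rev (h : G.StronglyConnected) : G.rev.StronglyConnected := by
  intro u w
  refine Relation.ReflTransGen.mono ?_ _ _ (Relation.reflTransGen_swap.mpr (h w u))
  rintro x y ⟨e, he, he'⟩
  exact ⟨e, he', he⟩

theorem EndsIn.mono {P Q : G.V → Prop} {p : List G.E} (h : G.EndsIn P p) (hPQ : ∀ u, P u → Q u) :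
    G.EndsIn Q p := by
  obtain ⟨e, he, hP⟩ := h
  exact ⟨e, he, hPQ _ hP⟩

theorem StronglyConnected.exists_rightExtension (h : G.StronglyConnected)
    (hd : ∃ u, G.Distributing u) (e : G.E) : ∃ r, G.IsRightExtension e r := by
  obtain ⟨u, hu⟩ := hd
  obtain ⟨t, ht, ht'⟩ := h.exists_path e u
  obtain ⟨r, -, -, hr⟩ := exists_rightExtension_prefix ht (ht'.mono fun _ h => h ▸ hu)
  exact ⟨r, hr⟩

theorem StronglyConnected.exists_leftExtension (h : G.StronglyConnected)
    (hc : ∃ u, G.Collecting u) (e : G.E) : ∃ r, G.IsLeftExtension e r := by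
  obtain ⟨u, hu⟩ := hc
  obtain ⟨r, hr⟩ := h.rev.exists_rightExtension ⟨u, rev_distributing.mpr hu⟩ e
  exact ⟨r.reverse, by rw [← isRightExtension_rev]; simpa using hr⟩

/-- In a finite graph in which every edge has a successor, if all in-degrees are at most one, then
all out-degrees are at most one. -/
theorem injective_src_of_injective_tgt [Finite G.E] (hs : ∀ e, ∃ f, G.src f = G.tgt e)
    (ht : Function.Injective G.tgt) : Function.Injective G.src := by
  choose g hg using hs
  have hinj : Function.Injective g := fun e f h => ht (by rw [← hg, ← hg, h])
  have hsurj := Finite.surjective_of_injective hinj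
  intro e f h
  obtain ⟨e', rfl⟩ := hsurj e
  obtain ⟨f', rfl⟩ := hsurj f
  rw [hg, hg] at h
  rw [ht h]

/-- If all vertices were collecting, all out-degrees would be one. By counting edges the in-degrees
would then be at most one, contrary to the definition of a collecting vertex. -/
theorem exists_distributing [Finite G.E] [Nonempty G.V]
    (hdeg : ∀ u, G.Distributing u ∨ G.Collecting u) : ∃ u, G.Distributing u := by
  by_contra! hno
  have hc : ∀ u, G.Collecting u := fun u => (hdeg u).resolve_left (hno u)
  have hsrc : Function.Injective G.src := fun e f h => (hc _).eq_of_src h rfl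
  have htgt := injective_src_of_injective_tgt (G := G.rev)
    (fun e => by obtain ⟨f, -, -, hf, -⟩ := (hc (G.src e)).1; exact ⟨f, hf⟩) hsrc
  obtain ⟨e, f, hne, he, hf⟩ := (hc (Classical.arbitrary _)).1
  exact hne (htgt (he.trans hf.symm))

theorem exists_collecting [Finite G.E] [Nonempty G.V]
    (hdeg : ∀ u, G.Distributing u ∨ G.Collecting u) : ∃ u, G.Collecting u := by
  have : Nonempty G.rev.V := ‹Nonempty G.V›
  have : Finite G.rev.E := ‹Finite G.E›
  obtain ⟨u, hu⟩ := exists_distributing (G := G.rev)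
    (fun u => (hdeg u).symm.imp rev_distributing.mpr rev_collecting.mpr)
  exact ⟨u, rev_distributing.mp hu⟩

/-- Follow the edge that leaves a collecting vertex up to the first distributing vertex. The last
edge on this way starts in a vertex that is not distributing, hence collecting. -/
theorem StronglyConnected.exists_supporting [Finite G.E] [Nonempty G.V] (h : G.StronglyConnected)
    (hdeg : ∀ u, G.Distributing u ∨ G.Collecting u) : ∃ v, G.Supporting v := by
  obtain ⟨c, hc⟩ := exists_collecting hdeg
  obtain ⟨e, he, -⟩ := hc.2
  obtain ⟨r, hr⟩ := h.exists_rightExtension (exists_distributing hdeg) e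
  obtain ⟨t, rfl⟩ := hr.eq_cons
  obtain ⟨hp, -, hend, hin⟩ := isRightExtension_iff.mp hr
  rcases List.eq_nil_or_concat' t with rfl | ⟨t, f, rfl⟩
  · exact ⟨e, he ▸ hc, endsIn_singleton.mp hend⟩
  · rw [← List.cons_append] at hp hend hin
    refine ⟨f, ?_, endsIn_concat.mp hend⟩
    rw [List.dropLast_concat] at hin
    obtain ⟨t', g, ht'⟩ := (List.eq_nil_or_concat' (e :: t)).resolve_left (by simp)
    rw [ht'] at hp hin
    have := ((isPath_append (by simp) (by simp)).mp hp).2.2 g (by simp) f (by simp)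
    rw [← this]
    exact (hdeg _).resolve_left (hin g (by simp))

end MGraph

/-! ### Words of paths -/

namespace WordGraph

section

variable {B : Type*} (S : WordGraph B)

open Classical in
/-- The word that a path contributes to the front word of a path in which it is preceded by some
edge. -/
noncomputable def frontTail (q : List S.E) : List B :=
  (q.filter fun f => decide (S.Distributing (S.src f))).flatMap S.front

open Classical in
/-- The word that a path contributes to the back word of a path in which it is followed by some
edge. -/
noncomputable def backInit (q : List S.E) : List B :=
  (q.filter fun f => decide (S.Collecting (S.tgt f))).flatMap S.back

/-- The graph with words in which all edges and all words are reversed. -/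
abbrev rev : WordGraph B where
  toMGraph := S.toMGraph.rev
  front e := (S.back e).reverse
  back e := (S.front e).reverse

/-- The front word of a symmetric path is its back word. -/
def Balanced : Prop := ∀ p, S.IsSymmetricPath p → S.F p = S.Bk p

variable {S}

theorem F_cons (e : S.E) (p : List S.E) : S.F (e :: p) = S.front e ++ S.frontTail p := by
  simp [F, frontGenerators, frontTail]

theorem F_singleton (e : S.E) : S.F [e] = S.front e := by
  simp [F_cons, frontTail]

theorem frontTail_nil : S.frontTail [] = [] := by simp [frontTail]

theorem backInit_nil : S.backInit [] = [] := by simp [backInit]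

theorem frontTail_append (p q : List S.E) :
    S.frontTail (p ++ q) = S.frontTail p ++ S.frontTail q := by
  simp [frontTail]

theorem backInit_append (p q : List S.E) :
    S.backInit (p ++ q) = S.backInit p ++ S.backInit q := by
  simp [backInit]

theorem frontTail_cons_of_distributing {e : S.E} (h : S.Distributing (S.src e)) (p : List S.E) :
    S.frontTail (e :: p) = S.front e ++ S.frontTail p := by
  simp [frontTail, h]

theorem frontTail_cons_of_not_distributing {e : S.E} (h : ¬ S.Distributing (S.src e))
    (p : List S.E) : S.frontTail (e :: p) = S.frontTail p := by
  simp [frontTail, h]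

theorem backInit_cons_of_collecting {e : S.E} (h : S.Collecting (S.tgt e)) (p : List S.E) :
    S.backInit (e :: p) = S.back e ++ S.backInit p := by
  simp [backInit, h]

theorem backInit_cons_of_not_collecting {e : S.E} (h : ¬ S.Collecting (S.tgt e))
    (p : List S.E) : S.backInit (e :: p) = S.backInit p := by
  simp [backInit, h]

theorem frontTail_eq_F {e : S.E} (h : S.Distributing (S.src e)) (p : List S.E) :
    S.frontTail (e :: p) = S.F (e :: p) := by
  rw [frontTail_cons_of_distributing h, F_cons]

theorem frontTail_eq_nil {p : List S.E} (h : ∀ e ∈ p, ¬ S.Distributing (S.src e)) :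
    S.frontTail p = [] := by
  simp [frontTail]
  intro e he hd
  exact absurd hd (h e he)

theorem F_append {p : List S.E} (hp : p ≠ []) (q : List S.E) :
    S.F (p ++ q) = S.F p ++ S.frontTail q := by
  obtain ⟨e, t, rfl⟩ := List.exists_cons_of_ne_nil hp
  rw [List.cons_append, F_cons, F_cons, frontTail_append, List.append_assoc]

theorem Bk_concat (p : List S.E) (e : S.E) : S.Bk (p ++ [e]) = S.backInit p ++ S.back e := by
  simp [Bk, backGenerators, backInit]

theorem Bk_singleton (e : S.E) : S.Bk [e] = S.back e := by
  simpa [backInit_nil] using S.Bk_concat [] e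

theorem Bk_append (p : List S.E) {q : List S.E} (hq : q ≠ []) :
    S.Bk (p ++ q) = S.backInit p ++ S.Bk q := by
  obtain ⟨t, e, rfl⟩ := (List.eq_nil_or_concat' q).resolve_left hq
  rw [← List.append_assoc, Bk_concat, Bk_concat, backInit_append, List.append_assoc]

/-- Reversal exchanges distributing with collecting vertices and front with back words. This allows
every statement on prefixes to be transferred to suffixes. -/
theorem frontTail_rev (p : List S.E) : S.rev.frontTail p.reverse = (S.backInit p).reverse := by
  classical
  unfold frontTail backInit
  rw [List.reverse_flatMap, List.filter_reverse]
  have h : (fun f : S.E => decide (S.rev.Distributing (S.rev.src f))) =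
      fun f => decide (S.Collecting (S.tgt f)) :=
    funext fun f => decide_eq_decide.mpr MGraph.rev_distributing
  convert congrArg (fun P => List.flatMap S.rev.front (List.filter P p).reverse) h using 1
  rfl

theorem F_rev (p : List S.E) : S.rev.F p.reverse = (S.Bk p).reverse := by
  rcases List.eq_nil_or_concat' p with rfl | ⟨t, e, rfl⟩
  · simp [F, frontGenerators, Bk, backGenerators]
  · rw [Bk_concat, List.reverse_append, List.reverse_append, ← frontTail_rev, List.reverse_singleton,
      List.singleton_append, F_cons]

theorem Bk_rev (p : List S.E) : S.rev.Bk p.reverse = (S.F p).reverse := by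
  have h := F_rev (S := S.rev) p.reverse
  rw [List.reverse_reverse] at h
  rw [← List.reverse_reverse (S.rev.Bk p.reverse), ← h]
  have hf : S.rev.rev.front = S.front := funext fun e => List.reverse_reverse (S.front e)
  unfold F
  rw [hf]
  cases p <;> rfl

theorem Balanced.rev (h : S.Balanced) : S.rev.Balanced := by
  intro p hp
  obtain ⟨q, rfl⟩ : ∃ q : List S.E, q.reverse = p := ⟨List.reverse (α := S.E) p, List.reverse_reverse p⟩
  rw [F_rev, Bk_rev, h q (MGraph.isSymmetricPath_rev.mp hp)]

theorem _root_.MGraph.IsSymmetricPath.exists_cons {G : MGraph} {p : List G.E} (hp : G.IsSymmetricPath p) :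
    ∃ e t, p = e :: t ∧ G.Collecting (G.src e) := by
  obtain ⟨e, t, rfl⟩ := List.exists_cons_of_ne_nil hp.1.1
  exact ⟨e, t, rfl, MGraph.startsIn_cons.mp hp.2.1⟩

theorem _root_.MGraph.IsSymmetricPath.exists_concat {G : MGraph} {p : List G.E} (hp : G.IsSymmetricPath p) :
    ∃ t e, p = t ++ [e] ∧ G.Distributing (G.tgt e) := by
  obtain ⟨t, e, rfl⟩ := (List.eq_nil_or_concat' p).resolve_left hp.1.1
  exact ⟨t, e, rfl, MGraph.endsIn_concat.mp hp.2.2⟩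

theorem _root_.MGraph.IsSymmetricPath.prefix {G : MGraph} {p q : List G.E}
    (h : G.IsSymmetricPath (p ++ q)) (hp : p ≠ []) (he : G.EndsIn G.Distributing p) :
    G.IsSymmetricPath p :=
  ⟨h.1.of_infix (List.prefix_append p q).isInfix hp, (MGraph.startsIn_append hp).mp h.2.1, he⟩

theorem _root_.MGraph.IsSymmetricPath.suffix {G : MGraph} {p q : List G.E}
    (h : G.IsSymmetricPath (p ++ q)) (hq : q ≠ []) (he : G.StartsIn G.Collecting q) :
    G.IsSymmetricPath q :=
  ⟨h.1.of_infix (List.suffix_append p q).isInfix hq, he, (MGraph.endsIn_append hq).mp h.2.2⟩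

/-- Front words are additive when a path is continued to the right, back words when it is continued
to the left. Balance permits switching between the two readings. -/
theorem Balanced.F_suffix (hS : S.Balanced) {p q : List S.E} (h : S.IsSymmetricPath (p ++ q))
    (hq : S.IsSymmetricPath q) : S.F (p ++ q) = S.backInit p ++ S.F q := by
  rw [hS _ h, hS _ hq, Bk_append _ hq.1.1]

theorem Balanced.F_infix (hS : S.Balanced) {p q : List S.E} (hp : S.IsSymmetricPath p)
    (hq : S.IsSymmetricPath q) (h : q <:+: p) : S.F q <:+: S.F p := by
  obtain ⟨a, b, rfl⟩ := h
  have hne : a ++ q ≠ [] := by simp [hq.1.1]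
  rw [F_append hne, hS.F_suffix (hp.prefix hne ((MGraph.endsIn_append hq.1.1).mpr hq.2.2)) hq]
  exact ⟨_, _, rfl⟩

theorem exists_first_of_filter_ne_nil {α : Type*} (P : α → Prop) [DecidablePred P] (l : List α)
    (h : ∃ x ∈ l, P x) : ∃ a x b, l = a ++ x :: b ∧ P x ∧ ∀ y ∈ a, ¬ P y := by
  induction l with
  | nil => simp at h
  | cons y l ih =>
    by_cases hy : P y
    · exact ⟨[], y, l, rfl, hy, by simp⟩
    · obtain ⟨x, hx, hPx⟩ := h
      rcases List.mem_cons.mp hx with rfl | hx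
      · exact absurd hPx hy
      · obtain ⟨a, z, b, rfl, hz, ha⟩ := ih ⟨x, hx, hPx⟩
        refine ⟨y :: a, z, b, rfl, hz, ?_⟩
        intro w hw
        rcases List.mem_cons.mp hw with rfl | hw
        · exact hy
        · exact ha w hw

theorem backInit_eq_nil {p : List S.E} (h : ∀ e ∈ p, ¬ S.Collecting (S.tgt e)) :
    S.backInit p = [] := by
  simp [backInit]
  intro e he hd
  exact absurd hd (h e he)

/-- A symmetric path has symmetric suffixes whose words have approximately a given length. -/
theorem Balanced.exists_suffix (hS : S.Balanced) {L n : ℕ} (hL : ∀ e, (S.back e).length ≤ L)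
    (hn : L ≤ n) (p : List S.E) (hp : S.IsSymmetricPath p) (hpn : n ≤ (S.F p).length + L) :
    ∃ l q, p = l ++ q ∧ S.IsSymmetricPath q ∧ (S.F q).length ≤ n ∧ n ≤ (S.F q).length + L := by
  classical
  induction hk : p.length using Nat.strong_induction_on generalizing p with
  | _ k ih =>
    by_cases hle : (S.F p).length ≤ n
    · exact ⟨[], p, rfl, hp, hle, hpn⟩
    · push Not at hle
      obtain ⟨t, g, rfl, -⟩ := hp.exists_concat
      have hB := hS _ hp
      -- Without an inner collecting vertex the word of `p` would be the back word of its last edge,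
      -- of length at most `L ≤ n`.
      have hex : ∃ e ∈ t, S.Collecting (S.tgt e) := by
        by_contra! hno
        rw [hB, Bk_concat, backInit_eq_nil hno, List.nil_append] at hle
        have := hL g
        omega
      obtain ⟨a, e, b, rfl, he, ha⟩ := exists_first_of_filter_ne_nil _ t hex
      have hsplit : a ++ e :: b ++ [g] = (a ++ [e]) ++ (b ++ [g]) := by simp
      rw [hsplit] at hp hB hle hpn hk ⊢
      have hne : b ++ [g] ≠ [] := by simp
      have hq : S.IsSymmetricPath (b ++ [g]) := by
        refine hp.suffix hne ?_
        obtain ⟨f, s, hf⟩ := List.exists_cons_of_ne_nil hne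
        rw [hf] at hp ⊢
        rw [MGraph.startsIn_cons]
        rw [← ((MGraph.isPath_append (by simp) (by simp)).mp hp.1).2.2 e (by simp) f (by simp)]
        exact he
      -- Cutting at the first inner collecting vertex removes exactly the back word of `e`, so at
      -- most `L` letters, and the lower bound on the length survives.
      have hF := hS.F_suffix hp hq
      rw [backInit_append, backInit_eq_nil ha, backInit_cons_of_collecting he, backInit_nil] at hF
      have hF' := congrArg List.length hF
      simp only [List.nil_append, List.append_nil, List.length_append] at hF' hk
      have := hL e
      obtain ⟨l, q, hlq, h⟩ := ih (b ++ [g]).length (by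
        simp only [List.length_append, List.length_singleton] at hk ⊢; omega) _ hq (by omega) rfl
      exact ⟨a ++ [e] ++ l, q, by rw [hlq, List.append_assoc (a ++ [e])], h⟩

theorem Balanced.exists_prefix (hS : S.Balanced) {L n : ℕ} (hL : ∀ e, (S.front e).length ≤ L)
    (hn : L ≤ n) (p : List S.E) (hp : S.IsSymmetricPath p) (hpn : n ≤ (S.F p).length + L) :
    ∃ q r, p = q ++ r ∧ S.IsSymmetricPath q ∧ (S.F q).length ≤ n ∧ n ≤ (S.F q).length + L := by
  have hlen : ∀ q, S.IsSymmetricPath q → (S.rev.F q.reverse).length = (S.F q).length := by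
    intro q hq
    rw [F_rev, hS q hq, List.length_reverse]
  obtain ⟨l, q, hlq, hq, h⟩ := hS.rev.exists_suffix (L := L) (n := n) (fun e => by simpa using hL e) hn
    p.reverse (MGraph.isSymmetricPath_rev.mpr hp) (by rw [hlen p hp]; exact hpn)
  obtain ⟨q, rfl⟩ : ∃ q' : List S.E, q'.reverse = q :=
    ⟨List.reverse (α := S.E) q, List.reverse_reverse q⟩
  have hq' := MGraph.isSymmetricPath_rev.mp hq
  rw [hlen q hq'] at h
  refine ⟨q, List.reverse (α := S.E) l, ?_, hq', h⟩
  rw [← List.reverse_reverse p, hlq, List.reverse_append, List.reverse_reverse]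

theorem exists_word_bound (S : WordGraph B) [Finite S.E] :
    ∃ L, (∀ e, (S.front e).length ≤ L) ∧ ∀ e, (S.back e).length ≤ L := by
  obtain ⟨M, hM⟩ := (Set.finite_range fun e => (S.front e).length).bddAbove
  obtain ⟨N, hN⟩ := (Set.finite_range fun e => (S.back e).length).bddAbove
  exact ⟨max M N, fun e => (hM ⟨e, rfl⟩).trans (le_max_left _ _),
    fun e => (hN ⟨e, rfl⟩).trans (le_max_right _ _)⟩

/-- For any two factors there is a symmetric path whose word is a factor and which contains two
disjoint symmetric paths, the words of which contain the given factors, in the given order. -/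
theorem Balanced.exists_admissible_pair [Finite S.E] (hS : S.Balanced) {W : ℕ → B} {R : ℕ}
    (hR : LinearlyRecurrent W R)
    (hcov : ∀ u, FactorOf u W → ∃ p, S.IsSymmetricPath p ∧ u <:+: S.F p) {u₁ u₂ : List B}
    (h₁ : FactorOf u₁ W) (h₂ : FactorOf u₂ W) :
    ∃ p₁ m p₂, S.IsSymmetricPath (p₁ ++ m ++ p₂) ∧ FactorOf (S.F (p₁ ++ m ++ p₂)) W ∧
      S.IsSymmetricPath p₁ ∧ S.IsSymmetricPath p₂ ∧ u₁ <:+: S.F p₁ ∧ u₂ <:+: S.F p₂ := by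
  obtain ⟨L, hLf, hLb⟩ := S.exists_word_bound
  -- Every cut at a symmetric subpath misses its aim by at most `L` letters. Paddings longer than `2
  -- * L` keep the outer cuts inside `a` and `b` and the two inner paths apart.
  obtain ⟨a, z, b, ha, hz, hb, hw⟩ := hR.exists_padded h₁ h₂ (2 * L + 1)
  obtain ⟨q, hq, c, d, hcd⟩ := hcov _ hw
  set w := a ++ u₁ ++ z ++ u₂ ++ b with hwdef
  have hcd' := congrArg List.length hcd
  have hwl := congrArg List.length hwdef
  simp only [List.length_append] at hcd' hwl
  obtain ⟨l, q₂, rfl, hq₂, hlen1, hlen2⟩ := hS.exists_suffix (n := w.length + d.length) hLb (by omega)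
    q hq (by omega)
  have hs := hS.F_suffix hq hq₂
  -- the word of `q₂` begins inside `a`
  obtain ⟨a', ha'⟩ : ∃ a', S.F q₂ = a' ++ (u₁ ++ z ++ u₂ ++ b ++ d) ∧ a' <:+ a := by
    have h1 : S.F q₂ <:+ a ++ (u₁ ++ z ++ u₂ ++ b ++ d) := by
      refine List.suffix_of_suffix_length_le (l₃ := S.F (l ++ q₂)) ⟨_, hs.symm⟩ ⟨c, ?_⟩ ?_
      · rw [← hcd]; simp [hwdef]
      · simp only [List.length_append]; omega
    have h2 : u₁ ++ z ++ u₂ ++ b ++ d <:+ S.F q₂ := by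
      refine List.suffix_of_suffix_length_le (List.suffix_append a _) h1 ?_
      simp only [List.length_append]; omega
    obtain ⟨a', ha'⟩ := h2
    refine ⟨a', ha'.symm, ?_⟩
    rw [← ha'] at h1
    obtain ⟨x, hx⟩ := h1
    rw [← List.append_assoc] at hx
    exact ⟨x, (List.append_inj' hx rfl).1⟩
  obtain ⟨hF₂, ha'⟩ := ha'
  have hF₂' := congrArg List.length hF₂
  simp only [List.length_append] at hF₂'
  -- The second cut is placed inside `b`. As `q₃` then has a word between `u₁ ++ z ++ u₂` and `w`,
  -- this word is a factor of `W`.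
  obtain ⟨q₃, r, rfl, hq₃, hlen3, hlen4⟩ := hS.exists_prefix
    (n := a'.length + u₁.length + z.length + u₂.length + b.length) hLf (by omega)
    q₂ hq₂ (by omega)
  have hs' := F_append hq₃.1.1 r
  obtain ⟨b', hb'⟩ : ∃ b', S.F q₃ = a' ++ u₁ ++ z ++ u₂ ++ b' ∧ b' <+: b := by
    have h1 : S.F q₃ <+: (a' ++ u₁ ++ z ++ u₂) ++ b := by
      refine List.prefix_of_prefix_length_le (l₃ := S.F (q₃ ++ r)) ⟨_, hs'.symm⟩ ⟨d, ?_⟩ ?_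
      · rw [hF₂]; simp
      · simp only [List.length_append]; omega
    have h2 : a' ++ u₁ ++ z ++ u₂ <+: S.F q₃ := by
      refine List.prefix_of_prefix_length_le (List.prefix_append _ b) h1 ?_
      simp only [List.length_append]; omega
    obtain ⟨b', hb'⟩ := h2
    refine ⟨b', hb'.symm, ?_⟩
    rw [← hb'] at h1
    exact (List.prefix_append_right_inj _).mp h1
  obtain ⟨hF₃, hb'⟩ := hb'
  have hadm : FactorOf (S.F q₃) W := by
    refine hw.of_infix ?_
    obtain ⟨x, rfl⟩ := ha'
    obtain ⟨y, rfl⟩ := hb'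
    exact ⟨x, y, by rw [hF₃, hwdef]; simp⟩
  have hF₃' := congrArg List.length hF₃
  simp only [List.length_append] at hF₃'
  have hal := ha'.length_le
  -- The extra `L` in both target lengths guarantees that the shortened words still contain `u₁` and
  -- `u₂` completely.
  obtain ⟨p₁, r₁, e₁, hp₁, hlen5, hlen6⟩ := hS.exists_prefix (n := a'.length + u₁.length + L) hLf
    (by omega) q₃ hq₃ (by omega)
  obtain ⟨l₂, p₂, e₂, hp₂, hlen7, hlen8⟩ := hS.exists_suffix (n := b'.length + u₂.length + L) hLb
    (by omega) q₃ hq₃ (by omega)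
  have hu₁ : u₁ <:+: S.F p₁ := by
    have h1 : a' ++ u₁ <+: S.F p₁ := by
      refine List.prefix_of_prefix_length_le (l₃ := S.F q₃) ⟨z ++ u₂ ++ b', ?_⟩ ?_ ?_
      · rw [hF₃]; simp
      · rw [e₁, F_append hp₁.1.1]; exact List.prefix_append _ _
      · simp only [List.length_append]; omega
    exact (List.suffix_append a' u₁).isInfix.trans h1.isInfix
  have hs₂ : S.F p₂ <:+ S.F q₃ := by
    rw [e₂] at hq₃ ⊢; exact ⟨_, (hS.F_suffix hq₃ hp₂).symm⟩
  have hu₂ : u₂ <:+: S.F p₂ := by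
    have h1 : u₂ ++ b' <:+ S.F p₂ := by
      refine List.suffix_of_suffix_length_le (l₃ := S.F q₃) ⟨a' ++ u₁ ++ z, ?_⟩ hs₂ ?_
      · rw [hF₃]; simp
      · simp only [List.length_append]; omega
    exact (List.prefix_append u₂ b').isInfix.trans h1.isInfix
  by_cases hcmp : p₁.length ≤ l₂.length
  · obtain ⟨m, rfl⟩ : p₁ <+: l₂ :=
      List.prefix_of_prefix_length_le ⟨r₁, e₁.symm⟩ ⟨p₂, e₂.symm⟩ hcmp
    exact ⟨p₁, m, p₂, e₂ ▸ hq₃, e₂ ▸ hadm, hp₁, hp₂, hu₁, hu₂⟩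
  -- An overlap of `p₁` and `p₂` would give `|F q₃| ≤ |F p₁| + |F p₂|`, which leaves at most `2 * L`
  -- letters for `z`.
  · exfalso
    push Not at hcmp
    obtain ⟨m, rfl⟩ : l₂ <+: p₁ :=
      List.prefix_of_prefix_length_le ⟨p₂, e₂.symm⟩ ⟨r₁, e₁.symm⟩ hcmp.le
    have hm : m ≠ [] := by rintro rfl; simp at hcmp
    rw [e₁, List.append_assoc] at e₂
    have e₃ := List.append_cancel_left e₂
    have hlp : (S.F q₃).length = (S.F (l₂ ++ m)).length + (S.frontTail r₁).length := by
      rw [e₁, F_append hp₁.1.1, List.length_append]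
    have hlq : (S.F p₂).length = (S.F m).length + (S.frontTail r₁).length := by
      rw [← e₃, F_append hm, List.length_append]
    omega

end

end WordGraph

/-! ### The number of vertices of a Rauzy scheme -/

section SpecialWords

variable {B : Type*} {W : ℕ → B}

/-- An occurrence is recorded by the place of its last letter, because right special words of
different lengths are going to be compared with their right ends aligned. -/
theorem FactorOf.exists_end {w : List B} {a : B} {R n : ℕ} (hR : LinearlyRecurrent W R)
    (h : FactorOf (w ++ [a]) W) (hn : R * (w.length + 2) ≤ n) :
    ∃ p, p < n ∧ w.length ≤ p ∧ W p = a ∧ window W (p - w.length) w.length = w := by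
  obtain ⟨l, r, e⟩ := hR _ _ h (factorOf_window W 0 n) (by simpa [add_assoc] using hn)
  have hlen := congrArg List.length e
  simp only [List.length_append, length_window, List.length_singleton] at hlen
  refine ⟨l.length + w.length, by omega, by omega, ?_, ?_⟩
  · have h1 := getElem?_window (W := W) (i := 0) (n := n) (j := l.length + w.length) (by omega)
    rw [← e] at h1
    simp at h1
    exact h1.symm
  · obtain ⟨k, hk⟩ : ∃ k, n = l.length + (w.length + k) := ⟨1 + r.length, by omega⟩
    rw [hk, window_add, window_add, List.append_assoc] at e
    have h1 := (List.append_inj e (by simp)).2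
    rw [List.append_assoc] at h1
    have h2 := (List.append_inj h1 (by simp)).1
    rw [zero_add] at h2
    rw [Nat.add_sub_cancel, ← h2]

/-- Two pairs of places, such that the letters at the two places of each pair differ while
the preceding letters agree, cannot be close to each other. -/
theorem eq_of_close_special_pairs {Q : ℕ} (hQ : 0 < Q)
    (hper : ∀ (z : List B) (s : ℕ), 0 < s → FactorOf z W →
      (∀ i, i + s < z.length → z[i + s]? = z[i]?) → z.length < Q * s)
    {m s p q p' q' : ℕ} (hs : 4 * Q * s ≤ m) (hmq : m ≤ q) (hmp' : m ≤ p')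
    (hmq' : m ≤ q') (hne : W p ≠ W q)
    (hag : ∀ t, 1 ≤ t → t ≤ m → W (p - t) = W (q - t))
    (hag' : ∀ t, 1 ≤ t → t ≤ m → W (p' - t) = W (q' - t))
    (hp : p ≤ p') (hp' : p' ≤ p + s) (hq : q ≤ q' + s) (hq' : q' ≤ q + s) : p = p' ∧ q = q' := by
  have hsm : s ≤ m := by nlinarith
  obtain ⟨k, rfl⟩ : ∃ k, p' = p + k := ⟨p' - p, by omega⟩
  have hQs : s ≤ Q * s := Nat.le_mul_of_pos_left s hQ
  have hsh : 4 * Q * s = 4 * (Q * s) := by ring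
  -- shifted agreement
  have hsft : ∀ t, 1 ≤ t → t + k ≤ m → W (q - t) = W (q' - k - t) := by
    intro t h1 h2
    rw [← hag t h1 (by omega), Nat.sub_sub, add_comm k t, ← hag' (t + k) (by omega) h2]
    congr 1; omega
  -- Such an agreement gives a window of length `m - k + σ` with period `σ ≤ 2 * s`. Since `m ≥ 4 *
  -- Q * s` and `k ≤ s`, this is longer than the period bound allows.
  have key : ∀ lo σ, 0 < σ → σ ≤ 2 * s → m ≤ lo + k →
      (∀ t, 1 ≤ t → t + k ≤ m → W (lo - t) = W (lo + σ - t)) → False := by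
    intro lo σ hσ hσs hlo hlag
    have h1 := hper (window W (lo - (m - k)) (m - k + σ)) σ hσ (factorOf_window _ _ _) (by
      intro i hi
      rw [length_window] at hi
      rw [getElem?_window hi, getElem?_window (by omega)]
      have := hlag (m - k - i) (by omega) (by omega)
      rw [show lo - (m - k) + (i + σ) = lo + σ - (m - k - i) by omega,
        show lo - (m - k) + i = lo - (m - k - i) by omega, this])
    rw [length_window] at h1
    have h2 : Q * σ ≤ Q * (2 * s) := Nat.mul_le_mul_left Q hσs
    have h3 : Q * (2 * s) = 2 * (Q * s) := by ring
    omega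
  rcases lt_trichotomy q (q' - k) with h | h | h
  · refine (key q (q' - k - q) (by omega) (by omega) (by omega) fun t h1 h2 => ?_).elim
    rw [hsft t h1 h2]; congr 1; omega
  · rcases Nat.eq_zero_or_pos k with rfl | hk
    · exact ⟨rfl, by omega⟩
    · exfalso
      -- Here the shifts of both places are equal to `k > 0`. The agreement before the second pair,
      -- taken at distance `k`, compares the letters at `p` and `q`, which differ.
      have := hag' k hk (by omega)
      rw [← h, Nat.add_sub_cancel] at this
      exact hne this
  · refine (key (q' - k) (q - (q' - k)) (by omega) (by omega) (by omega) fun t h1 h2 => ?_).elim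
    rw [← hsft t h1 h2]; congr 1; omega

/-- A bound for the number of right special factors of comparable lengths, none of which is a
suffix of another. -/
theorem card_rightSpecial_le {R Q C : ℕ} (hR : LinearlyRecurrent W R) (hQ : 0 < Q)
    (hper : ∀ (z : List B) (s : ℕ), 0 < s → FactorOf z W →
      (∀ i, i + s < z.length → z[i + s]? = z[i]?) → z.length < Q * s)
    {ι : Type*} (m : ℕ) (w : ι → List B) (a b : ι → B) (hab : ∀ i, a i ≠ b i)
    (ha : ∀ i, FactorOf (w i ++ [a i]) W) (hb : ∀ i, FactorOf (w i ++ [b i]) W)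
    (hm : ∀ i, m ≤ (w i).length) (hC : ∀ i, (w i).length ≤ C * (m + 1))
    (hsuf : ∀ i j, w i <:+ w j → i = j) :
    Nat.card ι ≤ (R * (C * (4 * Q) + 2) + 1) * (R * (C * (4 * Q) + 2) + 1) := by
  set n := R * (C * (m + 1) + 2) with hn
  have hlen : ∀ i, R * ((w i).length + 2) ≤ n := fun i =>
    Nat.mul_le_mul_left R (Nat.add_le_add_right (hC i) 2)
  choose p hpn hpl hpa hpw using fun i => (ha i).exists_end hR (hlen i)
  choose q hqn hql hqb hqw using fun i => (hb i).exists_end hR (hlen i)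
  have hne : ∀ i, W (p i) ≠ W (q i) := fun i => by rw [hpa, hqb]; exact hab i
  have hag : ∀ i t, 1 ≤ t → t ≤ m → W (p i - t) = W (q i - t) := by
    intro i t h1 h2
    have h3 := hm i
    have e := (hpw i).trans (hqw i).symm
    have e1 := congrArg (fun l => l[(w i).length - t]?) e
    rw [getElem?_window (by omega), getElem?_window (by omega)] at e1
    have := Option.some.inj e1
    have hp1 := hpl i
    have hq1 := hql i
    rwa [show p i - (w i).length + ((w i).length - t) = p i - t by omega,
      show q i - (w i).length + ((w i).length - t) = q i - t by omega] at this
  -- Two words that end at the same place are suffixes one of the other.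
  have hinj : ∀ i j, p i = p j → i = j := by
    have h1 : ∀ i j, (w i).length ≤ (w j).length → p i = p j → i = j := by
      intro i j hij hpp
      refine hsuf i j ?_
      obtain ⟨k, hk⟩ := Nat.exists_eq_add_of_le' hij
      have := hpw j
      rw [hk, window_add] at this
      rw [← this]
      conv_lhs => rw [← hpw i]
      have hj := hpl j
      rw [show p j - (k + (w i).length) + k = p i - (w i).length by omega]
      simp
    intro i j hpp
    rcases le_total (w i).length (w j).length with h | h
    · exact h1 i j h hpp
    · exact (h1 j i h hpp.symm).symm
  -- Places below `n` are sorted into cells of `s + 1` consecutive places, with the largest `s` to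
  -- which `eq_of_close_special_pairs` applies. Both `n` and `s + 1` are of the order of `m`, so the
  -- number of cells does not depend on `m`.
  set s := m / (4 * Q) with hs
  have hsm : 4 * Q * s ≤ m := Nat.mul_div_le m (4 * Q)
  have hms : m + 1 ≤ 4 * Q * (s + 1) := Nat.lt_mul_div_succ m (by omega)
  clear_value s
  have hbox : n ≤ R * (C * (4 * Q) + 2) * (s + 1) := by
    rw [hn, mul_assoc]
    refine Nat.mul_le_mul_left R ?_
    have := Nat.mul_le_mul_left C hms
    nlinarith
  have hlt : ∀ x, x < n → x / (s + 1) < R * (C * (4 * Q) + 2) + 1 := by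
    intro x hx
    rw [Nat.div_lt_iff_lt_mul (by omega)]
    nlinarith
  have key : ∀ i j, p i ≤ p j → p i / (s + 1) = p j / (s + 1) → q i / (s + 1) = q j / (s + 1) →
      i = j := by
    intro i j hij hbp hbq
    have near : ∀ x y, x / (s + 1) = y / (s + 1) → x ≤ y + s := by
      intro x y hxy
      have h1 := Nat.div_add_mod x (s + 1)
      have h2 := Nat.div_add_mod y (s + 1)
      have h3 := Nat.mod_lt x (show 0 < s + 1 by omega)
      rw [hxy] at h1
      omega
    exact hinj i j (eq_of_close_special_pairs hQ hper hsm
      ((hm i).trans (hql i)) ((hm j).trans (hpl j)) ((hm j).trans (hql j)) (hne i) (hag i) (hag j)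
      hij (near _ _ hbp.symm) (near _ _ hbq) (near _ _ hbq.symm)).1
  have hcard := Nat.card_le_card_of_injective
    (fun i => ((⟨_, hlt _ (hpn i)⟩, ⟨_, hlt _ (hqn i)⟩) :
      Fin (R * (C * (4 * Q) + 2) + 1) × Fin (R * (C * (4 * Q) + 2) + 1))) (by
    intro i j hij
    simp only [Prod.mk.injEq, Fin.mk.injEq] at hij
    rcases le_total (p i) (p j) with h | h
    · exact key i j h hij.1 hij.2
    · exact (key j i h hij.1.symm hij.2.symm).symm)
  simpa using hcard

end SpecialWords

theorem MGraph.isLeftExtension_iff {G : MGraph} {e : G.E} {p : List G.E} :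
    G.IsLeftExtension e p ↔ G.IsPath p ∧ [e] <:+ p ∧ G.StartsIn G.Collecting p ∧
      ∀ f ∈ p.tail, ¬ G.Collecting (G.src f) := by
  have h1 : G.rev.Distributing = G.Collecting := funext fun _ => propext rev_distributing
  rw [← isRightExtension_rev, isRightExtension_iff, isPath_rev, h1, endsIn_rev,
    List.dropLast_reverse]
  simp only [List.mem_reverse]
  rw [show [e] <+: p.reverse ↔ [e] <:+ p from List.reverse_prefix (l₁ := [e])]

namespace WordGraph

variable {B : Type*} {S : WordGraph B} {W : ℕ → B}

namespace IsRauzyScheme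

theorem balanced (h : S.IsRauzyScheme W) : S.Balanced := h.symmetric_words

theorem nonempty_vertices (h : S.IsRauzyScheme W) : Nonempty S.V := by
  obtain ⟨e, -⟩ := h.more_than_one_edge
  exact ⟨S.src e⟩

theorem exists_distributing (h : S.IsRauzyScheme W) : ∃ u, S.Distributing u :=
  have := h.nonempty_vertices
  have := h.finite_edges
  MGraph.exists_distributing h.degrees

theorem exists_collecting (h : S.IsRauzyScheme W) : ∃ u, S.Collecting u :=
  have := h.nonempty_vertices
  have := h.finite_edges
  MGraph.exists_collecting h.degrees

theorem exists_supporting (h : S.IsRauzyScheme W) : ∃ v, S.Supporting v :=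
  have := h.nonempty_vertices
  have := h.finite_edges
  h.strongly_connected.exists_supporting h.degrees

theorem infix_of_F_infix (h : S.IsRauzyScheme W) {p q : List S.E} (hp : S.IsSymmetricPath p)
    (hq : S.IsSymmetricPath q) (hpq : S.F p <:+: S.F q) : p <:+: q :=
  occursAtLeast_one_iff.mp (h.occurrences p q hp hq 1 (occursAtLeast_one_iff.mpr hpq))

theorem exists_admissible_pair (h : S.IsRauzyScheme W) {R : ℕ} (hR : LinearlyRecurrent W R)
    {u₁ u₂ : List B} (h₁ : FactorOf u₁ W) (h₂ : FactorOf u₂ W) :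
    ∃ p₁ m p₂, S.IsSymmetricPath (p₁ ++ m ++ p₂) ∧ FactorOf (S.F (p₁ ++ m ++ p₂)) W ∧
      S.IsSymmetricPath p₁ ∧ S.IsSymmetricPath p₂ ∧ u₁ <:+: S.F p₁ ∧ u₂ <:+: S.F p₂ :=
  have := h.finite_edges
  h.balanced.exists_admissible_pair hR h.covering h₁ h₂

theorem exists_admissible_mem (h : S.IsRauzyScheme W) {R : ℕ} (hR : LinearlyRecurrent W R)
    (e : S.E) : ∃ p, S.IsSymmetricPath p ∧ FactorOf (S.F p) W ∧ e ∈ p := by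
  obtain ⟨u, hu, he⟩ := h.edge_words e
  obtain ⟨p₁, m, p₂, hp, hF, hp₁, -, hu₁, -⟩ := h.exists_admissible_pair hR hu hu
  exact ⟨_, hp, hF, by simp [he p₁ hp₁ hu₁]⟩

end IsRauzyScheme

theorem _root_.MGraph.IsLeftExtension.isSymmetricPath {G : MGraph} {e : G.E} {t : List G.E}
    (ht : G.IsLeftExtension e t) (he : G.Distributing (G.tgt e)) : G.IsSymmetricPath t := by
  obtain ⟨s, rfl⟩ := ht.2.1
  exact ⟨ht.1, ht.2.2.1, MGraph.endsIn_concat.mpr he⟩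

/-- Only the first edge of a left extension leaves a collecting vertex. Therefore a symmetric path
can occur in it only at its beginning, in particular at most once. -/
theorem _root_.MGraph.IsLeftExtension.eq_nil_of_append {G : MGraph} {e f : G.E} {t l r : List G.E}
    (ht : G.IsLeftExtension e t) (h : t = l ++ f :: r) (hf : G.Collecting (G.src f)) : l = [] := by
  cases l with
  | nil => rfl
  | cons g l =>
    exact absurd hf ((MGraph.isLeftExtension_iff.mp ht).2.2.2 f (by simp [h]))

/-- The first edge leaves a collecting vertex, and the next vertex is not collecting if it is an
inner one, and distributing by assumption if it is the last. -/
theorem _root_.MGraph.IsLeftExtension.exists_supporting {G : MGraph}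
    (hdeg : ∀ u, G.Distributing u ∨ G.Collecting u) {e : G.E} {t : List G.E}
    (ht : G.IsLeftExtension e t) (he : G.Distributing (G.tgt e)) :
    ∃ v s, t = v :: s ∧ G.Supporting v := by
  obtain ⟨v, s, rfl, hv⟩ := (ht.isSymmetricPath he).exists_cons
  refine ⟨v, s, rfl, hv, ?_⟩
  cases s with
  | nil => exact MGraph.endsIn_singleton.mp (ht.isSymmetricPath he).2.2
  | cons f s =>
    rw [(MGraph.isPath_cons_cons.mp ht.1).1]
    exact (hdeg _).resolve_right ((MGraph.isLeftExtension_iff.mp ht).2.2.2 f (by simp))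

/-! ### Distributing vertices counted by right special words. -/

namespace IsRauzyScheme

/-- The word of the left extension of an edge that enters a distributing vertex can be continued
in `W` along each edge that leaves the vertex. -/
theorem factorOf_leftExtension_append (h : S.IsRauzyScheme W) {R : ℕ}
    (hR : LinearlyRecurrent W R) {e y : S.E} {t : List S.E} (ht : S.IsLeftExtension e t)
    (he : S.Distributing (S.tgt e)) (hy : S.src y = S.tgt e) :
    FactorOf (S.F t ++ S.front y) W := by
  obtain ⟨p, hp, hF, hyp⟩ := h.exists_admissible_mem hR y
  obtain ⟨l, r, rfl⟩ := List.append_of_mem hyp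
  have hl : l ≠ [] := by
    rintro rfl
    exact (hy ▸ he).not_collecting (MGraph.startsIn_cons.mp hp.2.1)
  obtain ⟨l', e', rfl⟩ := (List.eq_nil_or_concat' l).resolve_left hl
  have hch := ((MGraph.isPath_append hl (by simp)).mp hp.1).2.2 e' (by simp) y (by simp)
  obtain rfl : e' = e := he.eq_of_tgt (hch.trans hy) rfl
  have hsym := hp.prefix hl (MGraph.endsIn_concat.mpr he)
  -- The part of the path up to `e` is symmetric, so it ends with the left extension of `e`, which
  -- is `t` by uniqueness.
  obtain ⟨s, t', hst, ht'⟩ := MGraph.exists_leftExtension_suffix hsym.1 hsym.2.1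
  obtain rfl := ht'.unique h.degrees ht
  refine hF.of_infix ?_
  rw [F_append hl, hst]
  rw [hst] at hsym
  rw [h.balanced.F_suffix hsym (ht.isSymmetricPath he), frontTail_cons_of_distributing (hy ▸ he)]
  exact ⟨S.backInit s, S.frontTail r, by simp⟩

/-- The right special words are the words of the left extensions `t d`. A left extension contains
any symmetric path at most once, so the occurrence property forbids two occurrences of the word of a
symmetric path in `F (t d)`. This yields both the upper bound on the lengths and the absence of
suffix relations. -/
theorem card_distributing_le (h : S.IsRauzyScheme W) {R Q : ℕ} (hR : LinearlyRecurrent W R)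
    (hQ : 0 < Q)
    (hper : ∀ (z : List B) (s : ℕ), 0 < s → FactorOf z W →
      (∀ i, i + s < z.length → z[i + s]? = z[i]?) → z.length < Q * s) :
    Nat.card {u // S.Distributing u} ≤
      (R * (2 * R * (4 * Q) + 2) + 1) * (R * (2 * R * (4 * Q) + 2) + 1) := by
  classical
  choose ε hε using fun d : {u // S.Distributing u} => d.2.1.exists
  have hεd : ∀ d, S.Distributing (S.tgt (ε d)) := fun d => by rw [hε]; exact d.2
  choose t ht using fun d => h.strongly_connected.exists_leftExtension h.exists_collecting (ε d)
  have hts := fun d => (ht d).isSymmetricPath (hεd d)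
  choose y y' hyy hy hy' using fun d : {u // S.Distributing u} => d.2.2
  have hhead : ∀ x, S.Distributing (S.src x) → ∃ a, (S.front x).head? = some a := by
    intro x hx
    obtain ⟨a, l, hal⟩ := List.exists_cons_of_ne_nil (h.front_ne_nil x hx)
    exact ⟨a, by rw [hal]; rfl⟩
  choose a ha using fun d => hhead (y d) (by rw [hy]; exact d.2)
  choose b hb using fun d => hhead (y' d) (by rw [hy']; exact d.2)
  have hfac : ∀ (d : {u // S.Distributing u}) x c, S.src x = d.1 → (S.front x).head? = some c →
      FactorOf (S.F (t d) ++ [c]) W := by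
    intro d x c hx hc
    refine (h.factorOf_leftExtension_append hR (ht d) (hεd d) (y := x)
      (by rw [hε, hx])).of_infix ?_
    obtain ⟨l, hl⟩ : ∃ l, S.front x = c :: l := by
      cases hfx : S.front x with
      | nil => simp [hfx] at hc
      | cons c' l => simp [hfx] at hc; exact ⟨l, by rw [hc]⟩
    rw [hl]
    exact ⟨[], l, by simp⟩
  -- `Nat.find hex` is the least length of the word of a supporting edge. Every `F (t d)` begins
  -- with such a word, whence the lower bound; the recurrence of the shortest one, that of `v₀`,
  -- gives the upper bound.
  have hex : ∃ n, ∃ v, S.Supporting v ∧ (S.front v).length = n := by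
    obtain ⟨v, hv⟩ := h.exists_supporting
    exact ⟨_, v, hv, rfl⟩
  obtain ⟨v₀, hv₀, hm⟩ := Nat.find_spec hex
  have hmin : ∀ v, S.Supporting v → Nat.find hex ≤ (S.front v).length := fun v hv =>
    Nat.find_min' hex ⟨v, hv, rfl⟩
  have hv₀s : S.IsSymmetricPath [v₀] :=
    ⟨MGraph.isPath_singleton v₀, MGraph.startsIn_cons.mpr hv₀.1, MGraph.endsIn_singleton.mpr hv₀.2⟩
  -- a path without inner collecting vertices contains a symmetric path at most once
  have honce : ∀ d p, S.IsSymmetricPath p → ¬ OccursAtLeast 2 (S.F p) (S.F (t d)) := by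
    intro d p hp h2
    obtain ⟨l₁, r₁, l₂, r₂, e₁, e₂, hne⟩ :=
      occursAtLeast_two_iff.mp (h.occurrences p (t d) hp (hts d) 2 h2)
    obtain ⟨f, s, rfl, hf⟩ := hp.exists_cons
    apply hne
    rw [(ht d).eq_nil_of_append (l := l₁) (r := s ++ r₁) (by rw [e₁]; simp) hf,
      (ht d).eq_nil_of_append (l := l₂) (r := s ++ r₂) (by rw [e₂]; simp) hf]
  refine card_rightSpecial_le hR hQ hper (Nat.find hex) (fun d => S.F (t d)) a b ?_
    (fun d => hfac d _ _ (hy d) (ha d)) (fun d => hfac d _ _ (hy' d) (hb d)) ?_ ?_ ?_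
  · intro d hab
    refine h.front_heads (y d) (y' d) (by rw [hy]; exact d.2) (by rw [hy, hy']) (hyy d) ?_
    rw [ha, hb, hab]
  · intro d
    obtain ⟨v, s, hvs, hv⟩ := (ht d).exists_supporting h.degrees (hεd d)
    rw [hvs, F_cons, List.length_append]
    have := hmin v hv
    omega
  · intro d
    by_contra! hlen
    -- Any `n` consecutive letters contain the word of `v₀`. The second stretch begins after `n + 1`
    -- letters, so the two occurrences start at different places even if that word is empty.
    set n := R * (Nat.find hex + 1) with hn
    have hlen' : 2 * n < (S.F (t d)).length := by
      rw [hn]; linarith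
    have hfd : FactorOf (S.F (t d)) W :=
      (hfac d _ _ (hy d) (ha d)).of_infix (List.prefix_append _ _).isInfix
    have hV : ∀ z, z <:+: S.F (t d) → n ≤ z.length → S.F [v₀] <:+: z := by
      intro z hz hzl
      rw [F_singleton]
      exact hR _ _ (h.factors v₀).1 (hfd.of_infix hz) (by rw [hm]; exact hzl)
    obtain ⟨l₁, r₁, e₁⟩ := hV ((S.F (t d)).take n) (List.take_prefix _ _).isInfix
      (by rw [List.length_take]; omega)
    obtain ⟨l₂, r₂, e₂⟩ := hV ((S.F (t d)).drop (n + 1)) (List.drop_suffix _ _).isInfix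
      (by rw [List.length_drop]; omega)
    refine honce d [v₀] hv₀s (occursAtLeast_two_iff.mpr
      ⟨l₁, r₁ ++ (S.F (t d)).drop n, (S.F (t d)).take (n + 1) ++ l₂, r₂, ?_, ?_, ?_⟩)
    · rw [← List.append_assoc, e₁, List.take_append_drop]
    · rw [List.append_assoc, List.append_assoc, ← List.append_assoc l₂, e₂, List.take_append_drop]
    · intro hll
      have h1 := congrArg List.length hll
      have h2 := congrArg List.length e₁
      simp only [List.length_append, List.length_take] at h1 h2
      omega
  -- Since `t d` stands at the beginning of `t d'`, the word `F (t d)` is both a prefix and a suffix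
  -- of `F (t d')`. A proper suffix would be a second occurrence; hence the words, the paths and
  -- their last edges coincide.
  · intro d d' hsuf
    obtain ⟨l, r, hlr⟩ := h.infix_of_F_infix (hts d) (hts d') hsuf.isInfix
    obtain ⟨f, s, hfs, hf⟩ := (hts d).exists_cons
    obtain rfl : l = [] := (ht d').eq_nil_of_append (r := s ++ r) (by rw [← hlr, hfs]; simp) hf
    rw [List.nil_append] at hlr
    have hF : S.F (t d') = S.F (t d) ++ S.frontTail r := by
      rw [← hlr, F_append (hts d).1.1]
    obtain ⟨x, hx⟩ := hsuf
    have hx0 : x = [] := by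
      by_contra hx0
      refine honce d' (t d) (hts d) (occursAtLeast_two_iff.mpr
        ⟨[], S.frontTail r, x, [], by simpa using hF, by simpa using hx.symm, Ne.symm hx0⟩)
    rw [hx0, List.nil_append] at hx
    have hinf := h.infix_of_F_infix (hts d') (hts d) (hx ▸ List.infix_rfl)
    have hr : t d = t d' := by
      have h1 := hinf.length_le
      rw [← hlr, List.length_append] at h1
      rw [← hlr, List.length_eq_zero_iff.mp (show r.length = 0 by omega), List.append_nil]
    obtain ⟨s₁, h₁⟩ := (ht d).2.1
    obtain ⟨s₂, h₂⟩ := (ht d').2.1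
    rw [hr, ← h₂] at h₁
    have := (List.append_inj' h₁ rfl).2
    simp only [List.cons.injEq, and_true] at this
    apply Subtype.ext
    rw [← hε d, ← hε d', this]

/-- The number of edges and the number of collecting vertices are bounded in terms of the number
of distributing vertices. -/
theorem card_le_card_distributing [Finite B] (h : S.IsRauzyScheme W) :
    Nat.card S.V ≤ Nat.card {u // S.Distributing u} * (Nat.card B + 1) ∧
      Nat.card S.E ≤ Nat.card {u // S.Distributing u} * (2 * Nat.card B) := by
  classical
  have := h.finite_edges
  have := h.finite_vertices
  set D := {u // S.Distributing u}
  set C := {u // S.Collecting u}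
  have hB : ∀ e, S.Distributing (S.src e) → ∃ a, (S.front e).head? = some a := by
    intro x hx
    obtain ⟨a, l, hal⟩ := List.exists_cons_of_ne_nil (h.front_ne_nil x hx)
    exact ⟨a, by rw [hal]; rfl⟩
  have hCof : ∀ u, ¬ S.Distributing u → S.Collecting u := fun u hu => (h.degrees u).resolve_left hu
  -- An edge is determined by its initial vertex if that is collecting, and by its initial vertex
  -- and the first letter of its front word otherwise. This gives `|E| ≤ |C| + |D| * |B|`.
  let out : S.E → C ⊕ D × B := fun e =>
    if hd : S.Distributing (S.src e) then .inr (⟨S.src e, hd⟩, (hB e hd).choose)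
    else .inl ⟨S.src e, hCof _ hd⟩
  have hout : Function.Injective out := by
    intro e f hef
    by_cases hd : S.Distributing (S.src e) <;> by_cases hd' : S.Distributing (S.src f)
    · simp only [out, dif_pos hd, dif_pos hd', Sum.inr.injEq, Prod.mk.injEq] at hef
      by_contra hne
      refine h.front_heads e f hd (congrArg Subtype.val hef.1) hne ?_
      rw [(hB e hd).choose_spec, (hB f hd').choose_spec, hef.2]
    · simp [out, dif_pos hd, dif_neg hd'] at hef
    · simp [out, dif_neg hd, dif_pos hd'] at hef
    · simp only [out, dif_neg hd, dif_neg hd', Sum.inl.injEq] at hef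
      exact (hCof _ hd').eq_of_src (congrArg Subtype.val hef) rfl
  have h1 := Nat.card_le_card_of_injective out hout
  rw [Nat.card_sum, Nat.card_prod] at h1
  choose x x' hx using fun c : C => c.2.1
  choose i hi using fun d : D => d.2.1.exists
  -- Two incoming edges are chosen at each collecting vertex and one at each distributing vertex, so
  -- `2 * |C| + |D| ≤ |E|`. The two inequalities together eliminate `|C|`.
  let inn : (C ⊕ C) ⊕ D → S.E := Sum.elim (Sum.elim x x') i
  have hdc : ∀ (d : D) (c : C), d.1 ≠ c.1 := fun d c hdc => d.2.not_collecting (hdc ▸ c.2)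
  have hinn : Function.Injective inn := by
    rintro ((c | c) | d) ((c' | c') | d') hcc
    · have := congrArg S.tgt hcc
      simp only [inn, Sum.elim_inl, (hx _).2.1] at this
      rw [Subtype.ext this]
    · have h2 := congrArg S.tgt hcc
      simp only [inn, Sum.elim_inl, Sum.elim_inr, (hx _).2.1, (hx _).2.2] at h2
      obtain rfl := Subtype.ext h2
      exact absurd hcc (hx c).1
    · have := congrArg S.tgt hcc
      simp only [inn, Sum.elim_inl, Sum.elim_inr, (hx _).2.1, hi] at this
      exact absurd this.symm (hdc d' c)
    · have h2 := congrArg S.tgt hcc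
      simp only [inn, Sum.elim_inl, Sum.elim_inr, (hx _).2.1, (hx _).2.2] at h2
      obtain rfl := Subtype.ext h2
      exact absurd hcc.symm (hx c).1
    · have := congrArg S.tgt hcc
      simp only [inn, Sum.elim_inl, Sum.elim_inr, (hx _).2.2] at this
      rw [Subtype.ext this]
    · have := congrArg S.tgt hcc
      simp only [inn, Sum.elim_inl, Sum.elim_inr, (hx _).2.2, hi] at this
      exact absurd this.symm (hdc d' c)
    · have := congrArg S.tgt hcc
      simp only [inn, Sum.elim_inl, Sum.elim_inr, (hx _).2.1, hi] at this
      exact absurd this (hdc d c')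
    · have := congrArg S.tgt hcc
      simp only [inn, Sum.elim_inl, Sum.elim_inr, (hx _).2.2, hi] at this
      exact absurd this (hdc d c')
    · have := congrArg S.tgt hcc
      simp only [inn, Sum.elim_inr, hi] at this
      rw [Subtype.ext this]
  have h2 := Nat.card_le_card_of_injective inn hinn
  rw [Nat.card_sum, Nat.card_sum] at h2
  let vtx : S.V → C ⊕ D := fun u => if hd : S.Distributing u then .inr ⟨u, hd⟩ else .inl ⟨u, hCof u hd⟩
  have hvtx : Function.Injective vtx := by
    intro u w huw
    by_cases hd : S.Distributing u <;> by_cases hd' : S.Distributing w <;>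
      simp [vtx, hd, hd'] at huw <;> exact congrArg Subtype.val huw
  have h3 := Nat.card_le_card_of_injective vtx hvtx
  rw [Nat.card_sum] at h3
  constructor
  · rw [mul_add]; omega
  · rw [show Nat.card D * (2 * Nat.card B) = 2 * (Nat.card D * Nat.card B) by ring]; omega

end IsRauzyScheme

end WordGraph

/-! ### The graph with a split edge -/

theorem MGraph.IsRightExtension.not_distributing {G : MGraph} {e : G.E} {t : List G.E}
    (h : G.IsRightExtension e (e :: t)) : ∀ f ∈ t, ¬ G.Distributing (G.src f) := by
  intro f hf
  obtain ⟨a, b, rfl⟩ := List.append_of_mem hf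
  have h' := isRightExtension_iff.mp h
  obtain ⟨s, g, hs⟩ := (List.eq_nil_or_concat' (e :: a)).resolve_left (by simp)
  have e1 : e :: (a ++ f :: b) = (s ++ [g]) ++ (f :: b) := by rw [← hs]; rfl
  rw [e1] at h'
  rw [← ((isPath_append (by simp) (by simp)).mp h'.1).2.2 g (by simp) f (by simp)]
  refine h'.2.2.2 g ?_
  rw [List.dropLast_append_of_ne_nil (by simp)]
  simp

theorem MGraph.IsLeftExtension.not_collecting {G : MGraph} {e : G.E} {t : List G.E}
    (h : G.IsLeftExtension e (t ++ [e])) : ∀ f ∈ t, ¬ G.Collecting (G.tgt f) := by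
  have h1 := isRightExtension_rev.mpr h
  rw [List.reverse_append] at h1
  intro f hf hc
  exact h1.not_distributing f (List.mem_reverse.mpr hf) (rev_distributing.mpr hc)

theorem MGraph.IsLeftExtension.eq_concat {G : MGraph} {e : G.E} {p : List G.E}
    (h : G.IsLeftExtension e p) : ∃ t, p = t ++ [e] := by
  obtain ⟨t, ht⟩ := h.2.1
  exact ⟨t, ht.symm⟩

theorem MGraph.IsPath.append {G : MGraph} {p q : List G.E} (hp : G.IsPath p) (hq : G.IsPath q)
    {u : G.V} (hpu : G.EndsIn (· = u) p) (hqu : G.StartsIn (· = u) q) : G.IsPath (p ++ q) := by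
  rw [isPath_append hp.1 hq.1]
  refine ⟨hp, hq, fun x hx y hy => ?_⟩
  obtain ⟨x', hx', rfl⟩ := hpu
  obtain ⟨y', hy', h⟩ := hqu
  rw [Option.mem_unique hx hx', Option.mem_unique hy hy']
  exact h.symm

namespace WordGraph

variable {B : Type*} {S : WordGraph B} {W : ℕ → B} {v : S.E}

theorem F_rightExtension {e : S.E} {r : List S.E} (h : S.IsRightExtension e r) :
    S.F r = S.front e := by
  obtain ⟨t, rfl⟩ := h.eq_cons
  rw [F_cons, frontTail_eq_nil h.not_distributing, List.append_nil]

theorem backInit_leftExtension {e : S.E} {r : List S.E} (h : S.IsLeftExtension e r)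
    (he : S.Collecting (S.tgt e)) : S.backInit r = S.back e := by
  obtain ⟨t, rfl⟩ := h.eq_concat
  rw [backInit_append, backInit_eq_nil h.not_collecting, List.nil_append,
    backInit_cons_of_collecting he, backInit_nil, List.append_nil]

theorem _root_.MGraph.Supporting.isSymmetricPath {G : MGraph} {v : G.E} (hv : G.Supporting v) :
    G.IsSymmetricPath [v] :=
  ⟨MGraph.isPath_singleton v, MGraph.startsIn_cons.mpr hv.1, MGraph.endsIn_singleton.mpr hv.2⟩

theorem Balanced.front_eq_back (hS : S.Balanced) (hv : S.Supporting v) : S.front v = S.back v := by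
  rw [← F_singleton, ← Bk_singleton]
  exact hS _ hv.isSymmetricPath

/-- This is why a path whose word is a factor of `W` passes through `v` only along good edges. -/
theorem Balanced.infix_F_of_triple (hS : S.Balanced) (hv : S.Supporting v) {x y : S.E}
    {p : List S.E} (hp : S.IsSymmetricPath p) (h : [x, v, y] <:+: p) :
    S.back x ++ S.front v ++ S.front y <:+: S.F p := by
  obtain ⟨a, b, rfl⟩ := h
  have e1 : a ++ [x, v, y] ++ b = (a ++ [x] ++ [v]) ++ (y :: b) := by simp
  rw [e1] at hp ⊢
  have hch := (MGraph.isPath_append (by simp) (by simp)).mp hp.1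
  have hvy := hch.2.2 v (by simp) y (by simp)
  have hxv := ((MGraph.isPath_append (by simp) (by simp)).mp hch.1).2.2 x (by simp) v (by simp)
  have hq := hp.prefix (by simp) (MGraph.endsIn_concat.mpr hv.2)
  rw [F_append (by simp), hS.F_suffix hq hv.isSymmetricPath, F_singleton, backInit_append,
    backInit_cons_of_collecting (hxv ▸ hv.1), backInit_nil,
    frontTail_cons_of_distributing (hvy ▸ hv.2)]
  exact ⟨S.backInit a, S.frontTail b, by simp⟩

/-- Distributing vertices of the split graph. -/
def SplitVertex.IsD : S.SplitVertex → Prop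
  | .old u => S.Distributing u
  | .A _ => True
  | .B _ => False

/-- The edge of the original graph that corresponds to an edge of the split graph. -/
def SplitEdge.toEdge : S.SplitEdge v → S.E
  | .old e _ => e
  | .new _ _ _ _ => v

/-- The part of a path of the original graph from which an edge of the split graph can be
recognized. -/
def SplitEdge.pattern : S.SplitEdge v → List S.E
  | .old e _ => [e]
  | .new x y _ _ => [x, v, y]

theorem SplitEdge.eq_old_of_toEdge_eq {e : S.SplitEdge v} {f : S.E} (hf : f ≠ v)
    (h : e.toEdge = f) : e = .old f hf := by
  cases e with
  | old e he => cases h; rfl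
  | new x y hx hy => exact absurd h.symm hf

theorem SplitEdge.eq_new_of_toEdge_eq {e : S.SplitEdge v} (h : e.toEdge = v) :
    ∃ x y hx hy, e = .new x y hx hy := by
  cases e with
  | old e he => exact absurd h he
  | new x y hx hy => exact ⟨x, y, hx, hy, rfl⟩

theorem split_src_of_eq {e : S.E} {he : e ≠ v} (h : S.src e = S.tgt v) :
    (S.split v).src (.old e he) = .B e := if_pos h

theorem split_src_of_ne {e : S.E} {he : e ≠ v} (h : S.src e ≠ S.tgt v) :
    (S.split v).src (.old e he) = .old (S.src e) := if_neg h

theorem split_tgt_of_eq {e : S.E} {he : e ≠ v} (h : S.tgt e = S.src v) :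
    (S.split v).tgt (.old e he) = .A e := if_pos h

theorem split_tgt_of_ne {e : S.E} {he : e ≠ v} (h : S.tgt e ≠ S.src v) :
    (S.split v).tgt (.old e he) = .old (S.tgt e) := if_neg h

theorem split_src_new {x y : S.E} {hx hy} :
    (S.split v).src (.new x y hx hy) = .A x := rfl

theorem split_tgt_new {x y : S.E} {hx hy} :
    (S.split v).tgt (.new x y hx hy) = .B y := rfl

theorem split_src_eq_B {e : S.SplitEdge v} {y : S.E} (h : (S.split v).src e = .B y) :
    ∃ hy, e = .old y hy ∧ S.src y = S.tgt v := by
  cases e with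
  | old e he =>
    by_cases h' : S.src e = S.tgt v
    · rw [split_src_of_eq h'] at h
      cases h
      exact ⟨he, rfl, h'⟩
    · rw [split_src_of_ne h'] at h; cases h
  | new x y hx hy => rw [split_src_new] at h; cases h

theorem split_tgt_eq_A {e : S.SplitEdge v} {x : S.E} (h : (S.split v).tgt e = .A x) :
    ∃ hx, e = .old x hx ∧ S.tgt x = S.src v := by
  cases e with
  | old e he =>
    by_cases h' : S.tgt e = S.src v
    · rw [split_tgt_of_eq h'] at h
      cases h
      exact ⟨he, rfl, h'⟩
    · rw [split_tgt_of_ne h'] at h; cases h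
  | new x y hx hy => rw [split_tgt_new] at h; cases h

theorem split_src_eq_old {e : S.SplitEdge v} {u : S.V} (h : (S.split v).src e = .old u) :
    ∃ f hf, e = .old f hf ∧ S.src f = u ∧ u ≠ S.tgt v := by
  cases e with
  | old e he =>
    by_cases h' : S.src e = S.tgt v
    · rw [split_src_of_eq h'] at h; cases h
    · rw [split_src_of_ne h'] at h
      cases h
      exact ⟨e, he, rfl, rfl, h'⟩
  | new x y hx hy => rw [split_src_new] at h; cases h

theorem split_tgt_eq_old {e : S.SplitEdge v} {u : S.V} (h : (S.split v).tgt e = .old u) :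
    ∃ f hf, e = .old f hf ∧ S.tgt f = u ∧ u ≠ S.src v := by
  cases e with
  | old e he =>
    by_cases h' : S.tgt e = S.src v
    · rw [split_tgt_of_eq h'] at h; cases h
    · rw [split_tgt_of_ne h'] at h
      cases h
      exact ⟨e, he, rfl, rfl, h'⟩
  | new x y hx hy => rw [split_tgt_new] at h; cases h

theorem split_src_eq_A {e : S.SplitEdge v} {x : S.E} (h : (S.split v).src e = .A x) :
    ∃ y hx hy, e = .new x y hx hy := by
  cases e with
  | old e he =>
    by_cases h' : S.src e = S.tgt v
    · rw [split_src_of_eq h'] at h; cases h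
    · rw [split_src_of_ne h'] at h; cases h
  | new x y hx hy => cases h; exact ⟨y, hx, hy, rfl⟩

theorem split_tgt_eq_B {e : S.SplitEdge v} {y : S.E} (h : (S.split v).tgt e = .B y) :
    ∃ x hx hy, e = .new x y hx hy := by
  cases e with
  | old e he =>
    by_cases h' : S.tgt e = S.src v
    · rw [split_tgt_of_eq h'] at h; cases h
    · rw [split_tgt_of_ne h'] at h; cases h
  | new x y hx hy => cases h; exact ⟨x, hx, hy, rfl⟩

/-- Distributing vertices of the split graph have in-degree at most one. -/
theorem split_eq_of_tgt {e f : S.SplitEdge v} (hd : ((S.split v).tgt e : S.SplitVertex).IsD)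
    (h : (S.split v).tgt e = (S.split v).tgt f) : e = f := by
  rcases he : (S.split v).tgt e with u | x | y
  · obtain ⟨e', h1, rfl, h2, -⟩ := split_tgt_eq_old he
    obtain ⟨f', h3, rfl, h4, -⟩ := split_tgt_eq_old (h.symm.trans he)
    rw [he] at hd
    obtain rfl := MGraph.Distributing.eq_of_tgt hd h2 h4
    rfl
  · obtain ⟨_, rfl, -⟩ := split_tgt_eq_A he
    obtain ⟨_, rfl, -⟩ := split_tgt_eq_A (h.symm.trans he)
    rfl
  · rw [he] at hd; exact hd.elim

/-- The other vertices of the split graph have out-degree at most one. -/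
theorem split_eq_of_src (hdeg : S.DegreeCondition) {e f : S.SplitEdge v}
    (hd : ¬ ((S.split v).src e : S.SplitVertex).IsD)
    (h : (S.split v).src e = (S.split v).src f) : e = f := by
  rcases he : (S.split v).src e with u | x | y
  · obtain ⟨e', h1, rfl, h2, -⟩ := split_src_eq_old he
    obtain ⟨f', h3, rfl, h4, -⟩ := split_src_eq_old (h.symm.trans he)
    rw [he] at hd
    obtain rfl := ((hdeg u).resolve_left hd).eq_of_src h2 h4
    rfl
  · rw [he] at hd; exact (hd trivial).elim
  · obtain ⟨_, rfl, -⟩ := split_src_eq_B he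
    obtain ⟨_, rfl, -⟩ := split_src_eq_B (h.symm.trans he)
    rfl

theorem split_chain_toEdge {e f : S.SplitEdge v} (h : (S.split v).tgt e = (S.split v).src f) :
    S.tgt e.toEdge = S.src f.toEdge := by
  rcases he : (S.split v).tgt e with u | x | y
  · obtain ⟨e', h1, rfl, h2, -⟩ := split_tgt_eq_old he
    obtain ⟨f', h3, rfl, h4, -⟩ := split_src_eq_old (h.symm.trans he)
    exact h2.trans h4.symm
  · obtain ⟨_, rfl, h1⟩ := split_tgt_eq_A he
    obtain ⟨y, h2, h3, rfl⟩ := split_src_eq_A (h.symm.trans he)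
    exact h1
  · obtain ⟨x, h2, h3, rfl⟩ := split_tgt_eq_B he
    obtain ⟨_, rfl, h1⟩ := split_src_eq_B (h.symm.trans he)
    exact h1.symm

theorem split_eq_old_of_tgt {e : S.SplitEdge v} {x y : S.E} {hx hy}
    (h : (S.split v).tgt e = (S.split v).src (.new x y hx hy)) : ∃ h', e = .old x h' := by
  obtain ⟨h', rfl, -⟩ := split_tgt_eq_A h
  exact ⟨h', rfl⟩

theorem split_eq_old_of_src {f : S.SplitEdge v} {x y : S.E} {hx hy}
    (h : (S.split v).tgt (.new x y hx hy) = (S.split v).src f) : ∃ h', f = .old y h' := by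
  obtain ⟨h', rfl, -⟩ := split_src_eq_B h.symm
  exact ⟨h', rfl⟩

theorem isPath_map_toEdge {p : List (S.SplitEdge v)} (hp : (S.split v).IsPath p) :
    S.IsPath (p.map SplitEdge.toEdge) := by
  refine ⟨fun h => hp.1 (List.map_eq_nil_iff.mp h), ?_⟩
  exact List.isChain_map_of_isChain _ (fun a b h => split_chain_toEdge h) hp.2

/-- An edge over `v` is some `v_{xy}`; the edge before it is `x` and the edge after it is `y`. So it
can be recovered from the projection as soon as it has a neighbour on both sides. -/
theorem split_path_unique_aux {p q : List (S.SplitEdge v)} (e : S.SplitEdge v)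
    (hp : (S.split v).IsPath (e :: p)) (hq : (S.split v).IsPath (e :: q))
    (h : p.map SplitEdge.toEdge = q.map SplitEdge.toEdge)
    (hlast : ∀ f ∈ p.getLast?, f.toEdge ≠ v) : p = q := by
  induction p generalizing e q with
  | nil => symm; simpa using h.symm
  | cons f p ih =>
    cases q with
    | nil => simp at h
    | cons g q =>
      rw [List.map_cons, List.map_cons, List.cons.injEq] at h
      have hp' := MGraph.isPath_cons_cons.mp hp
      have hq' := MGraph.isPath_cons_cons.mp hq
      have hfg : f = g := by
        by_cases hf : f.toEdge = v
        · obtain ⟨x, y, hx, hy, rfl⟩ := SplitEdge.eq_new_of_toEdge_eq hf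
          obtain ⟨x', y', hx', hy', rfl⟩ := SplitEdge.eq_new_of_toEdge_eq (h.1.symm.trans hf)
          obtain ⟨h1, rfl⟩ := split_eq_old_of_tgt hp'.1
          obtain ⟨h2, h3⟩ := split_eq_old_of_tgt hq'.1
          cases h3
          cases p with
          | nil => exact absurd hf (hlast _ (by simp))
          | cons f' p =>
            cases q with
            | nil => simp at h
            | cons g' q =>
              obtain ⟨h4, rfl⟩ := split_eq_old_of_src (MGraph.isPath_cons_cons.mp hp'.2).1
              obtain ⟨h5, rfl⟩ := split_eq_old_of_src (MGraph.isPath_cons_cons.mp hq'.2).1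
              have h6 := h.2
              rw [List.map_cons, List.map_cons, List.cons.injEq] at h6
              obtain rfl : y = y' := h6.1
              rfl
        · rw [SplitEdge.eq_old_of_toEdge_eq hf rfl, SplitEdge.eq_old_of_toEdge_eq hf h.1.symm]
      subst hfg
      rw [ih f hp'.2 hq'.2 h.2 ?_]
      intro g hg
      cases p with
      | nil => simp at hg
      | cons f' p => exact hlast g (by rw [List.getLast?_cons_cons]; exact hg)

/-- A path of the split graph is determined by its image in the original graph, provided that it
begins and ends with old edges. -/
theorem split_path_unique {p q : List (S.SplitEdge v)} (hp : (S.split v).IsPath p)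
    (hq : (S.split v).IsPath q) (h : p.map SplitEdge.toEdge = q.map SplitEdge.toEdge)
    (hhead : ∀ f ∈ p.head?, f.toEdge ≠ v) (hlast : ∀ f ∈ p.getLast?, f.toEdge ≠ v) : p = q := by
  obtain ⟨e, p, rfl⟩ := List.exists_cons_of_ne_nil hp.1
  obtain ⟨f, q, rfl⟩ := List.exists_cons_of_ne_nil hq.1
  rw [List.map_cons, List.map_cons, List.cons.injEq] at h
  have he := hhead e (by simp)
  obtain rfl : e = f := by
    rw [SplitEdge.eq_old_of_toEdge_eq he rfl, SplitEdge.eq_old_of_toEdge_eq he h.1.symm]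
  rw [split_path_unique_aux e hp hq h.2 ?_]
  intro g hg
  cases p with
  | nil => simp at hg
  | cons f' p => exact hlast g (by rw [List.getLast?_cons_cons]; exact hg)

/-- For a new edge, the middle of the pattern lifts to some `v_{x'y'}`, and its neighbours force `x'
= x` and `y' = y`. -/
theorem SplitEdge.mem_of_pattern_infix {e : S.SplitEdge v} {p : List (S.SplitEdge v)}
    (hp : (S.split v).IsPath p) (h : e.pattern <:+: p.map SplitEdge.toEdge) :
    e ∈ p := by
  cases e with
  | old e he =>
    have : e ∈ p.map SplitEdge.toEdge := h.subset (by simp [pattern])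
    obtain ⟨f, hf, hfe⟩ := List.mem_map.mp this
    rwa [← SplitEdge.eq_old_of_toEdge_eq he hfe]
  | new x y hx hy =>
    obtain ⟨l, r, h⟩ := h
    obtain ⟨p', r', rfl, hp1, hp2⟩ := List.map_eq_append_iff.mp h.symm
    obtain ⟨l', m', rfl, hl, hm⟩ := List.map_eq_append_iff.mp hp1
    rw [pattern] at hm
    obtain ⟨a, m₁, rfl, ha, hm₁⟩ := List.map_eq_cons_iff.mp hm
    obtain ⟨b, m₂, rfl, hb, hm₂⟩ := List.map_eq_cons_iff.mp hm₁
    obtain ⟨c, m₃, rfl, hc, hm₃⟩ := List.map_eq_cons_iff.mp hm₂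
    obtain rfl : m₃ = [] := by simpa using hm₃
    have hpath := hp.of_infix (p := [a, b, c]) ⟨l', r', rfl⟩ (by simp)
    have h1 := MGraph.isPath_cons_cons.mp hpath
    have h2 := MGraph.isPath_cons_cons.mp h1.2
    obtain ⟨x', y', hx', hy', rfl⟩ := SplitEdge.eq_new_of_toEdge_eq hb
    obtain ⟨h3, rfl⟩ := split_eq_old_of_tgt h1.1
    obtain ⟨h4, rfl⟩ := split_eq_old_of_src h2.1
    obtain rfl : x' = x := ha
    obtain rfl : y' = y := hc
    simp

variable (S W v) in
/-- A path of the split graph that uses only good edges. -/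
def IsGoodPath (p : List (S.SplitEdge v)) : Prop :=
  (S.split v).IsPath p ∧ ∀ e ∈ p, S.GoodEdge v W e

theorem IsGoodPath.of_infix {p q : List (S.SplitEdge v)} (hq : S.IsGoodPath W v q)
    (h : p <:+: q) (hp : p ≠ []) : S.IsGoodPath W v p :=
  ⟨hq.1.of_infix h hp, fun e he => hq.2 e (h.subset he)⟩

theorem IsGoodPath.append {p q : List (S.SplitEdge v)} (hp : S.IsGoodPath W v p)
    (hq : S.IsGoodPath W v q) {u : S.SplitVertex} (hpu : (S.split v).EndsIn (· = u) p)
    (hqu : (S.split v).StartsIn (· = u) q) : S.IsGoodPath W v (p ++ q) :=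
  ⟨hp.1.append hq.1 hpu hqu, fun e he => (List.mem_append.mp he).elim (hp.2 e) (hq.2 e)⟩

/-- A path of the original graph can be lifted to the split graph if all passages through the split
edge are good. -/
theorem exists_lift (hv : S.Supporting v) (p : List S.E) (hp : S.IsPath p)
    (hhead : ∀ e ∈ p.head?, e ≠ v) (hlast : ∀ e ∈ p.getLast?, e ≠ v)
    (hgood : ∀ x y, [x, v, y] <:+: p → FactorOf (S.back x ++ S.front v ++ S.front y) W) :
    ∃ q, S.IsGoodPath W v q ∧ q.map SplitEdge.toEdge = p := by
  have hvv : S.src v ≠ S.tgt v := fun h => hv.2.not_collecting (h ▸ hv.1)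
  -- The induction consumes either one edge different from `v`, or `v` together with its successor.
  -- Thus the lifted part always ends in an old edge, from which the next new edge is determined.
  have key : ∀ (e : S.E) (he : e ≠ v) (p : List S.E), S.IsPath (e :: p) →
      (∀ f ∈ (e :: p).getLast?, f ≠ v) →
      (∀ x y, [x, v, y] <:+: e :: p → FactorOf (S.back x ++ S.front v ++ S.front y) W) →
      ∃ q, S.IsGoodPath W v (SplitEdge.old e he :: q) ∧ q.map SplitEdge.toEdge = p := by
    intro e he p
    induction hk : p.length using Nat.strong_induction_on generalizing e p with
    | _ k ih =>
      intro hp hlast hgood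
      cases p with
      | nil => exact ⟨[], ⟨MGraph.isPath_singleton _, by simp [GoodEdge]⟩, rfl⟩
      | cons f p =>
        have hp' := MGraph.isPath_cons_cons.mp hp
        by_cases hf : f = v
        · subst hf
          cases p with
          | nil => exact absurd rfl (hlast f (by simp))
          | cons g p =>
            have hp'' := MGraph.isPath_cons_cons.mp hp'.2
            have hg : g ≠ f := by
              rintro rfl
              exact hvv hp''.1.symm
            obtain ⟨q, hq, hqp⟩ := ih p.length (by simp at hk; omega) g hg p rfl hp''.2
              (by simpa [List.getLast?_cons_cons] using hlast)
              (fun x y h => hgood x y (h.trans ⟨[e, f], [], by simp⟩))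
            refine ⟨.new e g hp'.1 hp''.1.symm :: .old g hg :: q, ⟨?_, ?_⟩, by simp [hqp, SplitEdge.toEdge]⟩
            · refine MGraph.isPath_cons_cons.mpr ⟨?_, MGraph.isPath_cons_cons.mpr ⟨?_, hq.1⟩⟩
              · rw [split_tgt_of_eq hp'.1, split_src_new]
              · rw [split_src_of_eq hp''.1.symm, split_tgt_new]
            · intro x hx
              rcases List.mem_cons.mp hx with rfl | hx
              · trivial
              · rcases List.mem_cons.mp hx with rfl | hx
                · exact hgood e g ⟨[], p, by simp⟩
                · exact hq.2 x hx
        · obtain ⟨q, hq, hqp⟩ := ih p.length (by simp at hk; omega) f hf p rfl hp'.2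
              (by simpa [List.getLast?_cons_cons] using hlast)
              (fun x y h => hgood x y (h.trans ⟨[e], [], by simp⟩))
          refine ⟨.old f hf :: q, ⟨?_, ?_⟩, by simp [hqp, SplitEdge.toEdge]⟩
          · refine MGraph.isPath_cons_cons.mpr ⟨?_, hq.1⟩
            rw [split_tgt_of_ne, split_src_of_ne, hp'.1]
            · intro h
              exact he (hv.2.eq_of_tgt (hp'.1.trans h) rfl)
            · intro h
              exact hf (hv.1.eq_of_src (hp'.1.symm.trans h) rfl)
          · intro x hx
            rcases List.mem_cons.mp hx with rfl | hx
            · trivial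
            · exact hq.2 x hx
  obtain ⟨e, p, rfl⟩ := List.exists_cons_of_ne_nil hp.1
  have he : e ≠ v := hhead e (by simp)
  obtain ⟨q, hq, hqp⟩ := key e he p hp hlast hgood
  exact ⟨_, hq, by simp [hqp, SplitEdge.toEdge]⟩

/-! ### Recognizing good edges by factors of `W`, and joining them. -/

namespace IsRauzyScheme

/-- For an old edge the word comes from the scheme axiom. For `v_{xy}` the word `X V Y` itself
works: it is the word of the symmetric path made of the left extension of `x`, the edge `v` and the
right extension of `y`, so the occurrence property applies. -/
theorem exists_pattern_word (h : S.IsRauzyScheme W) (hv : S.Supporting v) {e : S.SplitEdge v}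
    (he : S.GoodEdge v W e) :
    ∃ u, FactorOf u W ∧ ∀ p, S.IsSymmetricPath p → u <:+: S.F p → e.pattern <:+: p := by
  cases e with
  | old e hne =>
    obtain ⟨u, hu, hup⟩ := h.edge_words e
    refine ⟨u, hu, fun p hp hF => ?_⟩
    obtain ⟨l, r, rfl⟩ := List.append_of_mem (hup p hp hF)
    exact ⟨l, r, by simp [SplitEdge.pattern]⟩
  | new x y hx hy =>
    refine ⟨_, he, fun p hp hF => ?_⟩
    obtain ⟨l, hl⟩ := h.strongly_connected.exists_leftExtension h.exists_collecting x
    obtain ⟨r, hr⟩ := h.strongly_connected.exists_rightExtension h.exists_distributing y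
    have hxc : S.Collecting (S.tgt x) := hx ▸ hv.1
    have hyd : S.Distributing (S.src y) := hy ▸ hv.2
    obtain ⟨l', rfl⟩ := hl.eq_concat
    obtain ⟨r', rfl⟩ := hr.eq_cons
    have hp1 : S.IsPath (l' ++ [x] ++ [v]) := hl.1.append (MGraph.isPath_singleton v)
      (MGraph.endsIn_concat.mpr hx) (MGraph.startsIn_cons.mpr rfl)
    have hp2 : S.IsPath (l' ++ [x] ++ [v] ++ (y :: r')) := hp1.append hr.1
      (MGraph.endsIn_concat.mpr rfl) (MGraph.startsIn_cons.mpr hy)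
    have hsym2 : S.IsSymmetricPath (l' ++ [x] ++ [v] ++ (y :: r')) := by
      refine ⟨hp2, ?_, (MGraph.endsIn_append (by simp)).mpr hr.2.2.1⟩
      rw [List.append_assoc, MGraph.startsIn_append (by simp)]
      exact hl.2.2.1
    have hsym1 := hsym2.prefix (by simp) (MGraph.endsIn_concat.mpr hv.2)
    have hF2 : S.F (l' ++ [x] ++ [v] ++ (y :: r')) = S.back x ++ S.front v ++ S.front y := by
      rw [F_append (by simp), h.balanced.F_suffix hsym1 hv.isSymmetricPath, F_singleton,
        backInit_leftExtension hl hxc, frontTail_eq_F hyd, F_rightExtension hr]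
    rw [← hF2] at hF
    refine List.IsInfix.trans ?_ (h.infix_of_F_infix hsym2 hp hF)
    exact ⟨l', r', by simp [SplitEdge.pattern]⟩

theorem pattern_head_ne (hv : S.Supporting v) (e : S.SplitEdge v) :
    ∀ x ∈ e.pattern.head?, x ≠ v := by
  cases e with
  | old e he => simpa [SplitEdge.pattern] using he
  | new x y hx hy =>
    simp only [SplitEdge.pattern, List.head?_cons, Option.mem_def, Option.some.injEq, forall_eq']
    rintro rfl
    exact hv.2.not_collecting (hx ▸ hv.1)

theorem pattern_last_ne (hv : S.Supporting v) (e : S.SplitEdge v) :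
    ∀ x ∈ e.pattern.getLast?, x ≠ v := by
  cases e with
  | old e he => simpa [SplitEdge.pattern] using he
  | new x y hx hy =>
    simp only [SplitEdge.pattern, List.getLast?_cons_cons, List.getLast?_singleton, Option.mem_def,
      Option.some.injEq, forall_eq']
    rintro rfl
    exact hv.2.not_collecting (hy ▸ hv.1)

theorem pattern_ne_nil (e : S.SplitEdge v) : e.pattern ≠ [] := by
  cases e <;> simp [SplitEdge.pattern]

/-- Any two good edges of the split graph are joined by a path of good edges, which may be required
to pass along a given symmetric path of the original graph. -/
theorem exists_goodPath_through (h : S.IsRauzyScheme W) (hv : S.Supporting v) {R : ℕ}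
    (hR : LinearlyRecurrent W R) {e f : S.SplitEdge v} (he : S.GoodEdge v W e)
    (hf : S.GoodEdge v W f) {p : List S.E} (hp : S.IsSymmetricPath p) (hpW : FactorOf (S.F p) W) :
    ∃ t, S.IsGoodPath W v (e :: t ++ [f]) ∧ p <:+: t.map SplitEdge.toEdge := by
  obtain ⟨u, hu, hue⟩ := h.exists_pattern_word hv he
  obtain ⟨w, hw, hwf⟩ := h.exists_pattern_word hv hf
  -- The order `e`, then `p`, then `f` is obtained by two applications: the first places `p` after
  -- the pattern of `e`, the second places the pattern of `f` after the resulting path.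
  obtain ⟨p₁, m, p₂, hq, hqW, hp₁, hp₂, hup₁, hFp₂⟩ := h.exists_admissible_pair hR hu hpW
  obtain ⟨q₁, n, q₂, hs, hsW, hq₁, hq₂, hFq₁, hwq₂⟩ := h.exists_admissible_pair hR hqW hw
  obtain ⟨a₁, b₁, h1⟩ := hue p₁ hp₁ hup₁
  obtain ⟨a₂, b₂, h2⟩ := h.infix_of_F_infix hp hp₂ hFp₂
  obtain ⟨a₃, b₃, h3⟩ := h.infix_of_F_infix hq hq₁ hFq₁
  obtain ⟨a₄, b₄, h4⟩ := hwf q₂ hq₂ hwq₂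
  set s := e.pattern ++ (b₁ ++ m ++ a₂ ++ p ++ b₂ ++ b₃ ++ n ++ a₄) ++ f.pattern with hsdef
  have hsinf : s <:+: q₁ ++ n ++ q₂ := by
    refine ⟨a₃ ++ a₁, b₄, ?_⟩
    rw [← h3, ← h2, ← h1, ← h4, hsdef]
    simp
  have hsne : s ≠ [] := by simp [hsdef, pattern_ne_nil]
  have hhead : ∀ x ∈ s.head?, x ≠ v := by
    intro x hx
    rw [hsdef, List.append_assoc, List.head?_append_of_ne_nil _ (pattern_ne_nil e)] at hx
    exact pattern_head_ne hv e x hx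
  have hlast : ∀ x ∈ s.getLast?, x ≠ v := by
    intro x hx
    rw [hsdef, List.getLast?_append_of_ne_nil _ (pattern_ne_nil f)] at hx
    exact pattern_last_ne hv f x hx
  -- The path `s` lies inside a path whose word is a factor of `W`, so all its passages through `v`
  -- are good and it can be lifted.
  obtain ⟨s', hs', hmap⟩ := exists_lift (W := W) hv s (hs.1.of_infix hsinf hsne) hhead hlast
    (fun x y hxy => hsW.of_infix (h.balanced.infix_F_of_triple hv hs (hxy.trans hsinf)))
  obtain ⟨s₁₂, s₃, rfl, h12, h3'⟩ := List.map_eq_append_iff.mp hmap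
  obtain ⟨s₁, s₂, rfl, h1', h2'⟩ := List.map_eq_append_iff.mp h12
  have ne1 : s₁ ≠ [] := by
    rintro rfl
    exact pattern_ne_nil e (by simpa using h1'.symm)
  have ne3 : s₃ ≠ [] := by
    rintro rfl
    exact pattern_ne_nil f (by simpa using h3'.symm)
  have hes : e ∈ s₁ := SplitEdge.mem_of_pattern_infix
    (hs'.1.of_infix ((List.prefix_append s₁ s₂).trans (List.prefix_append _ s₃)).isInfix ne1) (by rw [h1'])
  have hfs : f ∈ s₃ := SplitEdge.mem_of_pattern_infix
    (hs'.1.of_infix (List.suffix_append _ s₃).isInfix ne3) (by rw [h3'])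
  obtain ⟨x₁, y₁, rfl⟩ := List.append_of_mem hes
  obtain ⟨x₃, y₃, rfl⟩ := List.append_of_mem hfs
  refine ⟨y₁ ++ s₂ ++ x₃, hs'.of_infix ⟨x₁, y₃, by simp⟩ (by simp), ?_⟩
  rw [List.map_append, List.map_append, h2']
  exact ⟨y₁.map SplitEdge.toEdge ++ (b₁ ++ m ++ a₂), b₂ ++ b₃ ++ n ++ a₄ ++ x₃.map SplitEdge.toEdge,
    by simp⟩

end IsRauzyScheme

end WordGraph

/-! ### The graph of the elementary evolution -/

theorem window_succ {B : Type*} (x : ℕ → B) (i n : ℕ) :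
    window x i (n + 1) = x i :: window x (i + 1) n := by
  rw [add_comm n 1, window_add]
  simp [window]

theorem window_map {B C : Type*} (f : B → C) (x : ℕ → B) (i n : ℕ) :
    (window x i n).map f = window (f ∘ x) i n := by
  simp [window]

namespace MGraph

variable {G : MGraph}

theorem IsPath.link {p q : List G.E} {e f : G.E} (h : G.IsPath ((p ++ [e]) ++ (f :: q))) :
    G.tgt e = G.src f :=
  ((isPath_append (by simp) (by simp)).mp h).2.2 e (by simp) f (by simp)

theorem IsPath.forall_tail_src {P : G.V → Prop} {p : List G.E} (hp : G.IsPath p)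
    (h : ∀ e ∈ p.dropLast, P (G.tgt e)) : ∀ f ∈ p.tail, P (G.src f) := by
  obtain ⟨e, t, rfl⟩ := List.exists_cons_of_ne_nil hp.1
  induction t generalizing e with
  | nil => simp
  | cons g t ih =>
    have hp' := isPath_cons_cons.mp hp
    intro f hf
    rw [List.tail_cons] at hf
    rw [List.dropLast_cons_cons] at h
    rcases List.mem_cons.mp hf with rfl | hf
    · rw [← hp'.1]; exact h e (by simp)
    · exact ih g hp'.2 (fun x hx => h x (List.mem_cons_of_mem _ hx)) f hf

theorem eq_of_first_edge {P : G.E → Prop} {N : G.V → Prop}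
    (hout : ∀ e f, P e → P f → ¬ N (G.src e) → G.src e = G.src f → e = f) {e : G.E}
    {s t : List G.E} (hs : G.IsPath (e :: s)) (ht : G.IsPath (e :: t))
    (hPs : ∀ f ∈ e :: s, P f) (hPt : ∀ f ∈ e :: t, P f) (hNs : G.EndsIn N (e :: s))
    (hNt : G.EndsIn N (e :: t)) (his : ∀ f ∈ (e :: s).dropLast, ¬ N (G.tgt f))
    (hit : ∀ f ∈ (e :: t).dropLast, ¬ N (G.tgt f)) : s = t := by
  induction s generalizing e t with
  | nil =>
    cases t with
    | nil => rfl
    | cons g t =>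
      exact absurd (endsIn_singleton.mp hNs) (hit e (by rw [List.dropLast_cons_cons]; simp))
  | cons f s ih =>
    have hN : ¬ N (G.tgt e) := his e (by rw [List.dropLast_cons_cons]; simp)
    cases t with
    | nil => exact absurd (endsIn_singleton.mp hNt) hN
    | cons g t =>
      have hs' := isPath_cons_cons.mp hs
      have ht' := isPath_cons_cons.mp ht
      obtain rfl : f = g := hout f g (hPs f (by simp)) (hPt g (by simp)) (hs'.1 ▸ hN)
        (hs'.1.symm.trans ht'.1)
      rw [List.dropLast_cons_cons] at his hit
      rw [ih hs'.2 ht'.2 (fun x hx => hPs x (List.mem_cons_of_mem _ hx))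
        (fun x hx => hPt x (List.mem_cons_of_mem _ hx)) (endsIn_cons_cons.mp hNs)
        (endsIn_cons_cons.mp hNt) (fun x hx => his x (List.mem_cons_of_mem _ hx))
        (fun x hx => hit x (List.mem_cons_of_mem _ hx))]

theorem eq_of_last_edge {P : G.E → Prop} {N : G.V → Prop}
    (hin : ∀ e f, P e → P f → ¬ N (G.tgt e) → G.tgt e = G.tgt f → e = f) {e : G.E}
    {s t : List G.E} (hs : G.IsPath (s ++ [e])) (ht : G.IsPath (t ++ [e]))
    (hPs : ∀ f ∈ s ++ [e], P f) (hPt : ∀ f ∈ t ++ [e], P f) (hNs : G.StartsIn N (s ++ [e]))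
    (hNt : G.StartsIn N (t ++ [e])) (his : ∀ f ∈ (s ++ [e]).dropLast, ¬ N (G.tgt f))
    (hit : ∀ f ∈ (t ++ [e]).dropLast, ¬ N (G.tgt f)) : s = t := by
  have aux : ∀ s : List G.E, (s ++ [e]).reverse = e :: s.reverse := fun s => by simp
  have aux' : ∀ s : List G.E, (∀ f ∈ (s ++ [e]).tail, ¬ N (G.src f)) →
      ∀ f ∈ (e :: s.reverse).dropLast, ¬ N (G.rev.tgt f) := by
    intro s h f hf
    rw [← aux, List.dropLast_reverse, List.mem_reverse] at hf
    exact h f hf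
  refine List.reverse_injective (eq_of_first_edge (G := G.rev) (P := P) (N := N) hin (e := e)
    ?_ ?_ ?_ ?_ ?_ ?_ ?_ ?_)
  · rw [← aux]; exact isPath_rev.mpr hs
  · rw [← aux]; exact isPath_rev.mpr ht
  · intro f hf; rw [← aux, List.mem_reverse] at hf; exact hPs f hf
  · intro f hf; rw [← aux, List.mem_reverse] at hf; exact hPt f hf
  · rw [← aux]; exact endsIn_rev.mpr hNs
  · rw [← aux]; exact endsIn_rev.mpr hNt
  · exact aux' s (hs.forall_tail_src (P := fun u => ¬ N u) his)
  · exact aux' t (ht.forall_tail_src (P := fun u => ¬ N u) hit)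

theorem IsPath.reflTransGen {p : List G.E} (hp : G.IsPath p) {u w : G.V}
    (hu : G.StartsIn (· = u) p) (hw : G.EndsIn (· = w) p) :
    Relation.ReflTransGen (fun x y => ∃ e, G.src e = x ∧ G.tgt e = y) u w := by
  obtain ⟨e, t, rfl⟩ := List.exists_cons_of_ne_nil hp.1
  induction t generalizing e u with
  | nil =>
    exact Relation.ReflTransGen.single ⟨e, startsIn_cons.mp hu, endsIn_singleton.mp hw⟩
  | cons f t ih =>
    have hp' := isPath_cons_cons.mp hp
    exact Relation.ReflTransGen.head ⟨e, startsIn_cons.mp hu, hp'.1⟩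
      (ih f hp'.2 (startsIn_cons.mpr rfl) (endsIn_cons_cons.mp hw))

end MGraph

namespace WordGraph

variable {B : Type*} {S : WordGraph B} {W : ℕ → B} {v : S.E}

instance finite_splitEdge [Finite S.E] : Finite (S.SplitEdge v) :=
  Finite.of_injective (β := S.E ⊕ S.E × S.E)
    (fun e => match e with
      | .old e _ => .inl e
      | .new x y _ _ => .inr (x, y)) (by
    intro e f hef
    cases e <;> cases f <;> simp_all)

instance finite_splitVertex [Finite S.E] [Finite S.V] : Finite S.SplitVertex :=
  Finite.of_injective (β := S.V ⊕ S.E ⊕ S.E)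
    (fun e => match e with
      | .old e => .inl e
      | .A x => .inr (.inl x)
      | .B y => .inr (.inr y)) (by
    intro e f hef
    cases e <;> cases f <;> simp_all)

theorem length_frontTail_le {L : ℕ} (hL : ∀ e, (S.front e).length ≤ L) (p : List S.E) :
    (S.frontTail p).length ≤ L * p.length := by
  induction p with
  | nil => simp [frontTail_nil]
  | cons e p ih =>
    by_cases he : S.Distributing (S.src e)
    · rw [frontTail_cons_of_distributing he, List.length_append, List.length_cons, mul_add]
      have := hL e
      omega
    · rw [frontTail_cons_of_not_distributing he, List.length_cons, mul_add]
      omega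

theorem F_eq_append_frontTail {L : ℕ} (hL : ∀ e, (S.front e).length ≤ L) {p : List S.E}
    (hp : p ≠ []) : ∃ x, x.length ≤ L ∧ S.F p = x ++ S.frontTail p := by
  obtain ⟨e, t, rfl⟩ := List.exists_cons_of_ne_nil hp
  by_cases he : S.Distributing (S.src e)
  · exact ⟨[], by simp, by rw [frontTail_eq_F he]; rfl⟩
  · exact ⟨S.front e, hL e, by rw [F_cons, frontTail_cons_of_not_distributing he]⟩

theorem frontTail_window_periodic (y : ℕ → S.E) {m : ℕ} (hy : ∀ i, y (i + m) = y i) (i k r : ℕ) :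
    S.frontTail (window y i (m * k + r)) =
      (List.replicate k (S.frontTail (window y i m))).flatten ++ S.frontTail (window y i r) := by
  have hw : ∀ n, window y (i + m) n = window y i n := by
    intro n
    simp only [window]
    refine List.map_congr_left fun j _ => ?_
    rw [add_right_comm]; exact hy _
  induction k with
  | zero => simp
  | succ k ih =>
    rw [show m * (k + 1) + r = m + (m * k + r) by ring, window_add, hw, frontTail_append, ih,
      List.replicate_succ, List.flatten_cons, List.append_assoc]

/-! ### Existence of non-vanishing vertices. -/

namespace IsRauzyScheme

theorem exists_goodEdge (h : S.IsRauzyScheme W) : ∃ e, S.GoodEdge v W e := by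
  obtain ⟨e, he⟩ := @exists_ne _ h.more_than_one_edge v
  exact ⟨.old e he, trivial⟩

theorem exists_goodPath (h : S.IsRauzyScheme W) (hv : S.Supporting v) {R : ℕ}
    (hR : LinearlyRecurrent W R) {e f : S.SplitEdge v} (he : S.GoodEdge v W e)
    (hf : S.GoodEdge v W f) : ∃ t, S.IsGoodPath W v (e :: t ++ [f]) := by
  obtain ⟨p, hp, hF, -⟩ := h.exists_admissible_mem hR v
  obtain ⟨t, ht, -⟩ := h.exists_goodPath_through hv hR he hf hp hF
  exact ⟨t, ht⟩

theorem exists_good_succ (h : S.IsRauzyScheme W) (hv : S.Supporting v) {R : ℕ}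
    (hR : LinearlyRecurrent W R) {e : S.SplitEdge v} (he : S.GoodEdge v W e) :
    ∃ f, S.GoodEdge v W f ∧ (S.split v).src f = (S.split v).tgt e := by
  obtain ⟨t, ht⟩ := h.exists_goodPath hv hR he he
  rw [List.cons_append] at ht
  obtain ⟨f, s, hfs⟩ := List.exists_cons_of_ne_nil (show t ++ [e] ≠ [] by simp)
  rw [hfs] at ht
  exact ⟨f, ht.2 f (by simp), (MGraph.isPath_cons_cons.mp ht.1).1.symm⟩

theorem exists_good_pred (h : S.IsRauzyScheme W) (hv : S.Supporting v) {R : ℕ}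
    (hR : LinearlyRecurrent W R) {e : S.SplitEdge v} (he : S.GoodEdge v W e) :
    ∃ f, S.GoodEdge v W f ∧ (S.split v).tgt f = (S.split v).src e := by
  obtain ⟨t, ht⟩ := h.exists_goodPath hv hR he he
  obtain ⟨s, f, hfs⟩ := (List.eq_nil_or_concat' (e :: t)).resolve_left (by simp)
  rw [hfs] at ht
  exact ⟨f, ht.2 f (by simp), ht.1.link⟩

/-- Since `W` is not periodic, the split graph has vertices that do not vanish. -/
theorem exists_nonVanishing (h : S.IsRauzyScheme W) (hv : S.Supporting v) {R : ℕ}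
    (hR : LinearlyRecurrent W R) (hper : ¬ EventuallyPeriodic W) :
    ∃ u, S.NonVanishing v W u := by
  by_contra! hno
  have := h.finite_edges
  have hsrc : ∀ e f, S.GoodEdge v W e → S.GoodEdge v W f →
      (S.split v).src e = (S.split v).src f → e = f := by
    intro e f he hf hef
    by_contra hne
    exact hno _ (Or.inl ⟨e, f, hne, he, hf, rfl, hef.symm⟩)
  have htgt : ∀ e f, S.GoodEdge v W e → S.GoodEdge v W f →
      (S.split v).tgt e = (S.split v).tgt f → e = f := by
    intro e f he hf hef
    by_contra hne
    exact hno _ (Or.inr ⟨e, f, hne, he, hf, rfl, hef.symm⟩)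
  have hsucc : ∀ e : {e : S.SplitEdge v // S.GoodEdge v W e},
      ∃ f : {e : S.SplitEdge v // S.GoodEdge v W e},
        (S.split v).src f.1 = (S.split v).tgt e.1 := by
    intro e
    obtain ⟨f, hf, hfe⟩ := h.exists_good_succ hv hR e.2
    exact ⟨⟨f, hf⟩, hfe⟩
  -- If all vertices vanish, the successor map on the finite set of good edges is injective, hence a
  -- permutation of finite order `m`. Its orbit is a periodic sequence that every good path starting
  -- in it must follow.
  choose σ hσ using hsucc
  have hσinj : Function.Injective σ := by
    intro e f hef
    refine Subtype.ext (htgt _ _ e.2 f.2 ?_)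
    rw [← hσ, ← hσ, hef]
  set τ : Equiv.Perm {e : S.SplitEdge v // S.GoodEdge v W e} :=
    Equiv.ofBijective σ ((Finite.injective_iff_bijective).mp hσinj) with hτ
  obtain ⟨m, hm, hτm⟩ := isOfFinOrder_iff_pow_eq_one.mp (isOfFinOrder_of_finite τ)
  obtain ⟨e₀, he₀⟩ := h.exists_goodEdge (v := v)
  set x : ℕ → S.SplitEdge v := fun i => ((τ ^ i) ⟨e₀, he₀⟩).1 with hx
  have hxg : ∀ i, S.GoodEdge v W (x i) := fun i => ((τ ^ i) ⟨e₀, he₀⟩).2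
  have hxs : ∀ i, (S.split v).src (x (i + 1)) = (S.split v).tgt (x i) := by
    intro i
    simp only [hx, pow_succ', Equiv.Perm.mul_apply]
    exact hσ _
  have hxm : ∀ i, x (i + m) = x i := by
    intro i
    simp only [hx, pow_add, hτm, mul_one]
  have hpath : ∀ t i, S.IsGoodPath W v (x i :: t) → x i :: t = window x i (t.length + 1) := by
    intro t
    induction t with
    | nil => intro i _; simp [window]
    | cons f t ih =>
      intro i ht
      have hp := MGraph.isPath_cons_cons.mp ht.1
      obtain rfl : f = x (i + 1) :=
        hsrc _ _ (ht.2 f (by simp)) (hxg _) (hp.1.symm.trans (hxs i).symm)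
      rw [window_succ, List.length_cons,
        ih (i + 1) (ht.of_infix (List.suffix_cons _ _).isInfix (by simp))]
  obtain ⟨L, hL, -⟩ := S.exists_word_bound
  obtain ⟨Q, hQ⟩ := hR.exists_power_bound hper
  -- The length is large enough for two purposes: `p` must have at least `m * Q` edges, and its word
  -- must be longer than what remains once the periodic part is found to contribute nothing.
  obtain ⟨p₁, m₁, p₂, -, hp₁W, hp₁, -, hlong, -⟩ := h.exists_admissible_pair hR
    (factorOf_window W 0 (L * (m * Q + 1) + L * m + L + 1)) FactorOf.nil
  obtain ⟨p, hp, hpW, hlen⟩ : ∃ p, S.IsSymmetricPath p ∧ FactorOf (S.F p) W ∧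
      L * (m * Q + 1) + L * m + L + 1 ≤ (S.F p).length := by
    refine ⟨p₁, hp₁, hp₁W.of_infix ?_, by simpa using hlong.length_le⟩
    rw [List.append_assoc, F_append hp₁.1.1]
    exact (List.prefix_append _ _).isInfix
  -- A good path through `p` runs along the orbit, so `p` is a window of the periodic sequence `y`,
  -- and its word contains a `Q`-th power.
  obtain ⟨t, ht, hpt⟩ := h.exists_goodPath_through hv hR (hxg 0) (hxg 0) hp hpW
  set y : ℕ → S.E := SplitEdge.toEdge ∘ x with hy
  have hym : ∀ i, y (i + m) = y i := fun i => by simp only [hy, Function.comp_apply, hxm]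
  have hpy : FactorOf p y := by
    refine (factorOf_window y 0 ((t ++ [x 0]).length + 1)).of_infix (hpt.trans ?_)
    rw [← window_map, ← hpath (t ++ [x 0]) 0 ht]
    exact ⟨[(x 0).toEdge], [(x 0).toEdge], by simp⟩
  obtain ⟨i, hi⟩ := hpy
  obtain ⟨z, hz, hFz⟩ := F_eq_append_frontTail hL hp.1.1
  have hcalc := frontTail_window_periodic y hym i (p.length / m) (p.length % m)
  rw [Nat.div_add_mod, hi] at hcalc
  have hQm : Q ≤ p.length / m := by
    rw [Nat.le_div_iff_mul_le hm]
    by_contra! hlt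
    have h1 := length_frontTail_le hL p
    have h2 : L * p.length ≤ L * (m * Q) := Nat.mul_le_mul_left L (by rw [mul_comm m]; exact hlt.le)
    rw [hFz, List.length_append] at hlen
    nlinarith
  have hc := hQ (S.frontTail (window y i m)) (by
    refine hpW.of_infix ?_
    rw [hFz, hcalc]
    obtain ⟨k, hk⟩ := Nat.exists_eq_add_of_le hQm
    rw [hk, List.replicate_add, List.flatten_append]
    exact ⟨z, (List.replicate k (S.frontTail (window y i m))).flatten ++
      S.frontTail (window y i (p.length % m)), by simp⟩)
  rw [hc] at hcalc
  have h1 := length_frontTail_le hL (window y i (p.length % m))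
  rw [length_window] at h1
  have h2 : L * (p.length % m) ≤ L * m := Nat.mul_le_mul_left L (Nat.mod_lt _ hm).le
  have h3 : (S.frontTail p).length ≤ L * m := by
    rw [hcalc]
    simpa using h1.trans h2
  rw [hFz, List.length_append] at hlen
  nlinarith

/-- In the finite graph of good edges every edge has a successor and a predecessor, so its source
map is injective exactly when its target map is. A non-vanishing vertex excludes that both are,
hence neither is. A branching at a source is of distributing kind, a merging at a target of
collecting kind. -/
theorem exists_nonVanishing_both (h : S.IsRauzyScheme W) (hv : S.Supporting v) {R : ℕ}
    (hR : LinearlyRecurrent W R) (hper : ¬ EventuallyPeriodic W) :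
    (∃ u : S.SplitVertex, u.IsD ∧ S.NonVanishing v W u) ∧
      ∃ u : S.SplitVertex, ¬ u.IsD ∧ S.NonVanishing v W u := by
  have := h.finite_edges
  let G : MGraph :=
    { V := S.SplitVertex
      E := {e : S.SplitEdge v // S.GoodEdge v W e}
      src := fun e => (S.split v).src e.1
      tgt := fun e => (S.split v).tgt e.1 }
  have hfin : Finite G.E := inferInstanceAs (Finite {e : S.SplitEdge v // S.GoodEdge v W e})
  have hfin' : Finite G.rev.E := hfin
  have hsucc : ∀ e : G.E, ∃ f, G.src f = G.tgt e := by
    intro e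
    obtain ⟨f, hf, hfe⟩ := h.exists_good_succ hv hR e.2
    exact ⟨⟨f, hf⟩, hfe⟩
  have hpred : ∀ e : G.E, ∃ f, G.tgt f = G.src e := by
    intro e
    obtain ⟨f, hf, hfe⟩ := h.exists_good_pred hv hR e.2
    exact ⟨⟨f, hf⟩, hfe⟩
  have hnot : ¬ (Function.Injective G.src ∧ Function.Injective G.tgt) := by
    rintro ⟨hs, ht⟩
    obtain ⟨u, hu⟩ := h.exists_nonVanishing hv hR hper
    rcases hu with ⟨e, f, hne, he, hf, heu, hfu⟩ | ⟨e, f, hne, he, hf, heu, hfu⟩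
    · exact hne (congrArg Subtype.val (hs (a₁ := ⟨e, he⟩) (a₂ := ⟨f, hf⟩) (heu.trans hfu.symm)))
    · exact hne (congrArg Subtype.val (ht (a₁ := ⟨e, he⟩) (a₂ := ⟨f, hf⟩) (heu.trans hfu.symm)))
  have hs : ¬ Function.Injective G.src := fun hs =>
    hnot ⟨hs, MGraph.injective_src_of_injective_tgt (G := G.rev) hpred hs⟩
  have ht : ¬ Function.Injective G.tgt := fun ht =>
    hnot ⟨MGraph.injective_src_of_injective_tgt hsucc ht, ht⟩
  simp only [Function.Injective, not_forall] at hs ht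
  obtain ⟨e, f, hef, hne⟩ := hs
  obtain ⟨e', f', hef', hne'⟩ := ht
  refine ⟨⟨(S.split v).src e.1, ?_, Or.inl ⟨e.1, f.1, fun h => hne (Subtype.ext h), e.2, f.2, rfl,
    hef.symm⟩⟩, ⟨(S.split v).tgt e'.1, ?_, Or.inr ⟨e'.1, f'.1, fun h => hne' (Subtype.ext h), e'.2,
    f'.2, rfl, hef'.symm⟩⟩⟩
  · by_contra hd
    exact hne (Subtype.ext (split_eq_of_src h.degrees hd hef))
  · intro hd
    exact hne' (Subtype.ext (split_eq_of_tgt hd hef'))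

end IsRauzyScheme

/-- At most one good edge leaves a vanishing vertex, so after its first edge the path is forced
until it meets a non-vanishing vertex. -/
theorem evolvedEdge_first_unique {E F : (S.evolvedGraph v W).E}
    (h : E.1.head E.2.path.1 = F.1.head F.2.path.1) : E = F := by
  obtain ⟨p, hp⟩ := E
  obtain ⟨q, hq⟩ := F
  obtain ⟨e, s, rfl⟩ := List.exists_cons_of_ne_nil hp.path.1
  obtain ⟨f, t, rfl⟩ := List.exists_cons_of_ne_nil hq.path.1
  obtain rfl : e = f := h
  have hout : ∀ e f, S.GoodEdge v W e → S.GoodEdge v W f → ¬ S.NonVanishing v W ((S.split v).src e) →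
      (S.split v).src e = (S.split v).src f → e = f := by
    intro e f he hf hN hef
    by_contra hne
    exact hN (Or.inl ⟨e, f, hne, he, hf, rfl, hef.symm⟩)
  obtain rfl := MGraph.eq_of_first_edge (N := S.NonVanishing v W) hout hp.path hq.path hp.good hq.good
    ⟨_, List.getLast?_eq_some_getLast _, hp.ends⟩ ⟨_, List.getLast?_eq_some_getLast _, hq.ends⟩
    hp.inner hq.inner
  rfl

theorem evolvedEdge_last_unique {E F : (S.evolvedGraph v W).E}
    (h : E.1.getLast E.2.path.1 = F.1.getLast F.2.path.1) : E = F := by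
  obtain ⟨p, hp⟩ := E
  obtain ⟨q, hq⟩ := F
  obtain ⟨s, e, rfl⟩ := (List.eq_nil_or_concat' p).resolve_left hp.path.1
  obtain ⟨t, f, rfl⟩ := (List.eq_nil_or_concat' q).resolve_left hq.path.1
  simp only [List.getLast_append_singleton] at h
  subst h
  have hin : ∀ e f, S.GoodEdge v W e → S.GoodEdge v W f → ¬ S.NonVanishing v W ((S.split v).tgt e) →
      (S.split v).tgt e = (S.split v).tgt f → e = f := by
    intro e f he hf hN hef
    by_contra hne
    exact hN (Or.inr ⟨e, f, hne, he, hf, rfl, hef.symm⟩)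
  obtain rfl := MGraph.eq_of_last_edge (N := S.NonVanishing v W) hin hp.path hq.path hp.good hq.good
    ⟨_, List.head?_eq_some_head _, hp.starts⟩ ⟨_, List.head?_eq_some_head _, hq.starts⟩
    hp.inner hq.inner
  rfl

theorem unfold_cons (E : (S.evolvedGraph v W).E) (q : List (S.evolvedGraph v W).E) :
    S.unfold v W (E :: q) = E.1 ++ S.unfold v W q := rfl

theorem unfold_append (p q : List (S.evolvedGraph v W).E) :
    S.unfold v W (p ++ q) = S.unfold v W p ++ S.unfold v W q := List.flatMap_append

theorem unfold_singleton (E : (S.evolvedGraph v W).E) : S.unfold v W [E] = E.1 :=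
  List.append_nil _

theorem evolvedGraph_tgt_val (E : (S.evolvedGraph v W).E) :
    ((S.evolvedGraph v W).tgt E).1 = (S.split v).tgt (E.1.getLast E.2.path.1) := rfl

theorem startsIn_unfold {P : S.SplitVertex → Prop} {E : (S.evolvedGraph v W).E}
    {q : List (S.evolvedGraph v W).E} :
    (S.split v).StartsIn P (S.unfold v W (E :: q)) ↔ P ((S.evolvedGraph v W).src E).1 := by
  rw [unfold_cons]
  refine (MGraph.startsIn_append E.2.path.1).trans ?_
  obtain ⟨p, hp⟩ := E
  obtain ⟨e, s, rfl⟩ := List.exists_cons_of_ne_nil hp.path.1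
  exact MGraph.startsIn_cons

theorem endsIn_unfold {P : S.SplitVertex → Prop} {E : (S.evolvedGraph v W).E}
    {q : List (S.evolvedGraph v W).E} :
    (S.split v).EndsIn P (S.unfold v W (q ++ [E])) ↔ P ((S.evolvedGraph v W).tgt E).1 := by
  rw [unfold_append, unfold_singleton]
  refine (MGraph.endsIn_append E.2.path.1).trans ?_
  rw [evolvedGraph_tgt_val]
  obtain ⟨p, hp⟩ := E
  obtain ⟨s, e, rfl⟩ := (List.eq_nil_or_concat' p).resolve_left hp.path.1
  refine MGraph.endsIn_concat.trans ?_
  simp only [List.getLast_append_singleton]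

theorem isGoodPath_unfold {q : List (S.evolvedGraph v W).E} (hq : (S.evolvedGraph v W).IsPath q) :
    S.IsGoodPath W v (S.unfold v W q) := by
  obtain ⟨E, t, rfl⟩ := List.exists_cons_of_ne_nil hq.1
  induction t generalizing E with
  | nil => rw [unfold_singleton]; exact ⟨E.2.path, E.2.good⟩
  | cons F t ih =>
    have hq' := MGraph.isPath_cons_cons.mp hq
    rw [unfold_cons]
    refine IsGoodPath.append ⟨E.2.path, E.2.good⟩ (ih F hq'.2)
      (u := ((S.evolvedGraph v W).tgt E).1) ?_ (startsIn_unfold.mpr (by rw [hq'.1]))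
    have := (endsIn_unfold (S := S) (W := W) (v := v) (P := (· = ((S.evolvedGraph v W).tgt E).1))
      (E := E) (q := [])).mpr rfl
    rwa [List.nil_append, unfold_singleton] at this

/-- A path of good edges between vertices that do not vanish comes from a path of the evolved
graph. -/
theorem exists_unfold_eq (p : List (S.SplitEdge v)) (hp : S.IsGoodPath W v p)
    (hs : (S.split v).StartsIn (S.NonVanishing v W) p)
    (he : (S.split v).EndsIn (S.NonVanishing v W) p) :
    ∃ q, (S.evolvedGraph v W).IsPath q ∧ S.unfold v W q = p := by
  classical
  induction hk : p.length using Nat.strong_induction_on generalizing p with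
  | _ k ih =>
    obtain ⟨a, f, b, rfl, hf, ha⟩ := exists_first_of_filter_ne_nil
      (fun e => S.NonVanishing v W ((S.split v).tgt e)) p (by
        obtain ⟨e, he, hN⟩ := he
        exact ⟨e, List.mem_of_getLast? he, hN⟩)
    have e1 : a ++ f :: b = (a ++ [f]) ++ b := by simp
    rw [e1] at hp hs he ⊢
    have hE : S.IsEvolvedEdge v W (a ++ [f]) := by
      refine ⟨hp.1.of_infix (List.prefix_append _ _).isInfix (by simp),
        fun e he => hp.2 e (List.mem_append_left _ he), ?_, ?_, ?_⟩
      · rw [MGraph.startsIn_append (by simp)] at hs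
        obtain ⟨x, hx, hN⟩ := hs
        rw [List.head_eq_iff_head?_eq_some _ |>.mpr hx]
        exact hN
      · simpa using hf
      · rw [List.dropLast_concat]; exact ha
    let E : (S.evolvedGraph v W).E := ⟨a ++ [f], hE⟩
    by_cases hb : b = []
    · subst hb
      exact ⟨[E], MGraph.isPath_singleton _, by rw [unfold_singleton, List.append_nil]⟩
    · obtain ⟨g, t, rfl⟩ := List.exists_cons_of_ne_nil hb
      have hfg := hp.1.link
      have hlt : (g :: t).length < k := by
        have h1 : (a ++ [f] ++ g :: t).length = (a ++ [f]).length + (g :: t).length :=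
          List.length_append
        have h2 : (a ++ [f]).length = a.length + 1 := List.length_append
        have h3 : (a ++ [f] ++ g :: t).length = k := e1 ▸ hk
        omega
      obtain ⟨q, hq, hqu⟩ := ih (g :: t).length hlt (g :: t)
        (hp.of_infix (List.suffix_append _ _).isInfix hb)
        (MGraph.startsIn_cons.mpr (hfg ▸ hf)) ((MGraph.endsIn_append hb).mp he) rfl
      obtain ⟨F, q, rfl⟩ := List.exists_cons_of_ne_nil hq.1
      refine ⟨E :: F :: q, MGraph.isPath_cons_cons.mpr ⟨?_, hq⟩, ?_⟩
      · apply Subtype.ext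
        have h1 := (startsIn_unfold (S := S) (W := W) (v := v)
          (P := (· = (S.split v).src g)) (E := F) (q := q)).mp
            (by rw [hqu]; exact MGraph.startsIn_cons.mpr rfl)
        rw [h1, ← hfg, evolvedGraph_tgt_val]
        simp only [E, List.getLast_append_singleton]
      · rw [unfold_cons, hqu]
        rfl

namespace IsRauzyScheme

/-- A good path that returns to `e`, taken without its last edge, leads from the beginning of `e`
back to the same non-vanishing vertex. Its first segment between non-vanishing vertices is the edge
sought. -/
theorem exists_evolvedEdge_first (h : S.IsRauzyScheme W) (hv : S.Supporting v) {R : ℕ}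
    (hR : LinearlyRecurrent W R) {e : S.SplitEdge v} (he : S.GoodEdge v W e)
    (hN : S.NonVanishing v W ((S.split v).src e)) :
    ∃ E : (S.evolvedGraph v W).E, E.1.head E.2.path.1 = e ∧
      ((S.evolvedGraph v W).src E).1 = (S.split v).src e := by
  obtain ⟨t, ht⟩ := h.exists_goodPath hv hR he he
  have hend : (S.split v).EndsIn (S.NonVanishing v W) (e :: t) := by
    obtain ⟨s, f, hfs⟩ := (List.eq_nil_or_concat' (e :: t)).resolve_left (by simp)
    rw [hfs] at ht
    exact hfs ▸ (MGraph.endsIn_concat.mpr (ht.1.link ▸ hN) :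
      (S.split v).EndsIn (S.NonVanishing v W) (s ++ [f]))
  obtain ⟨q, hq, hqu⟩ := exists_unfold_eq (e :: t)
    (ht.of_infix (List.prefix_append _ _).isInfix (List.cons_ne_nil _ _)) (MGraph.startsIn_cons.mpr hN) hend
  obtain ⟨⟨p, hp⟩, q, rfl⟩ := List.exists_cons_of_ne_nil hq.1
  obtain ⟨f, s, rfl⟩ := List.exists_cons_of_ne_nil hp.path.1
  have hqu' : f :: (s ++ S.unfold v W q) = e :: t := hqu
  obtain rfl := (List.cons.inj hqu').1
  exact ⟨⟨f :: s, hp⟩, rfl, rfl⟩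

theorem exists_evolvedEdge_last (h : S.IsRauzyScheme W) (hv : S.Supporting v) {R : ℕ}
    (hR : LinearlyRecurrent W R) {e : S.SplitEdge v} (he : S.GoodEdge v W e)
    (hN : S.NonVanishing v W ((S.split v).tgt e)) :
    ∃ E : (S.evolvedGraph v W).E, E.1.getLast E.2.path.1 = e ∧
      ((S.evolvedGraph v W).tgt E).1 = (S.split v).tgt e := by
  obtain ⟨t, ht⟩ := h.exists_goodPath hv hR he he
  rw [List.cons_append] at ht
  have hstart : (S.split v).StartsIn (S.NonVanishing v W) (t ++ [e]) := by
    obtain ⟨f, s, hfs⟩ := List.exists_cons_of_ne_nil (show t ++ [e] ≠ [] by simp)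
    rw [hfs] at ht
    exact hfs ▸ (MGraph.startsIn_cons.mpr ((MGraph.isPath_cons_cons.mp ht.1).1 ▸ hN) :
      (S.split v).StartsIn (S.NonVanishing v W) (f :: s))
  obtain ⟨q, hq, hqu⟩ := exists_unfold_eq (t ++ [e])
    (ht.of_infix (List.suffix_cons _ _).isInfix (by simp)) hstart (MGraph.endsIn_concat.mpr hN)
  obtain ⟨q, E, rfl⟩ := (List.eq_nil_or_concat' q).resolve_left hq.1
  rw [unfold_append, unfold_singleton] at hqu
  obtain ⟨p, hp⟩ := E
  obtain ⟨s, f, rfl⟩ := (List.eq_nil_or_concat' p).resolve_left hp.path.1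
  have hqu' : (S.unfold v W q ++ s) ++ [f] = t ++ [e] := (List.append_assoc _ _ _).trans hqu
  obtain rfl : f = e := (List.cons.inj (List.append_inj' hqu' rfl).2).1
  exact ⟨⟨s ++ [f], hp⟩, by simp, by simp [evolvedGraph]⟩

/-! ### Degrees and connectedness of the evolved graph. -/

theorem exists_good_in_out (h : S.IsRauzyScheme W) (hv : S.Supporting v) {R : ℕ}
    (hR : LinearlyRecurrent W R) {u : S.SplitVertex} (hu : S.NonVanishing v W u) :
    (∃ e, S.GoodEdge v W e ∧ (S.split v).tgt e = u) ∧
      ∃ e, S.GoodEdge v W e ∧ (S.split v).src e = u := by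
  rcases hu with ⟨e, -, -, he, -, rfl, -⟩ | ⟨e, -, -, he, -, rfl, -⟩
  · exact ⟨h.exists_good_pred hv hR he, e, he, rfl⟩
  · exact ⟨⟨e, he, rfl⟩, h.exists_good_succ hv hR he⟩

/-- In the split graph the in-degree of such a vertex is at most one. It can therefore be
non-vanishing only because several good edges leave it, and these begin distinct edges of the
evolved graph. -/
theorem evolved_distributing_of_isD (h : S.IsRauzyScheme W) (hv : S.Supporting v) {R : ℕ}
    (hR : LinearlyRecurrent W R) {u : (S.evolvedGraph v W).V} (hu : SplitVertex.IsD u.1) :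
    (S.evolvedGraph v W).Distributing u := by
  constructor
  · obtain ⟨⟨e, he, heu⟩, -⟩ := h.exists_good_in_out hv hR u.2
    obtain ⟨E, hE, hEt⟩ := h.exists_evolvedEdge_last hv hR he (heu ▸ u.2)
    refine ⟨E, Subtype.ext (hEt.trans heu), fun F hF => evolvedEdge_last_unique ?_⟩
    rw [hE]
    have hF' : (S.split v).tgt (F.1.getLast F.2.path.1) = u.1 := congrArg Subtype.val hF
    exact split_eq_of_tgt (by rw [hF']; exact hu) (hF'.trans heu.symm)
  · rcases u.2 with ⟨e, f, hne, he, hf, heu, hfu⟩ | ⟨e, f, hne, he, hf, heu, hfu⟩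
    · obtain ⟨E, hE, hEs⟩ := h.exists_evolvedEdge_first hv hR he (heu ▸ u.2)
      obtain ⟨F, hF, hFs⟩ := h.exists_evolvedEdge_first hv hR hf (hfu ▸ u.2)
      refine ⟨E, F, ?_, Subtype.ext (hEs.trans heu), Subtype.ext (hFs.trans hfu)⟩
      rintro rfl
      exact hne (hE.symm.trans hF)
    · exact absurd (split_eq_of_tgt (heu ▸ hu) (heu.trans hfu.symm)) hne

theorem evolved_collecting_of_not_isD (h : S.IsRauzyScheme W) (hv : S.Supporting v) {R : ℕ}
    (hR : LinearlyRecurrent W R) {u : (S.evolvedGraph v W).V} (hu : ¬ SplitVertex.IsD u.1) :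
    (S.evolvedGraph v W).Collecting u := by
  constructor
  · rcases u.2 with ⟨e, f, hne, he, hf, heu, hfu⟩ | ⟨e, f, hne, he, hf, heu, hfu⟩
    · exact absurd (split_eq_of_src h.degrees (heu ▸ hu) (heu.trans hfu.symm)) hne
    · obtain ⟨E, hE, hEs⟩ := h.exists_evolvedEdge_last hv hR he (heu ▸ u.2)
      obtain ⟨F, hF, hFs⟩ := h.exists_evolvedEdge_last hv hR hf (hfu ▸ u.2)
      refine ⟨E, F, ?_, Subtype.ext (hEs.trans heu), Subtype.ext (hFs.trans hfu)⟩
      rintro rfl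
      exact hne (hE.symm.trans hF)
  · obtain ⟨-, ⟨e, he, heu⟩⟩ := h.exists_good_in_out hv hR u.2
    obtain ⟨E, hE, hEt⟩ := h.exists_evolvedEdge_first hv hR he (heu ▸ u.2)
    refine ⟨E, Subtype.ext (hEt.trans heu), fun F hF => evolvedEdge_first_unique ?_⟩
    rw [hE]
    have hF' : (S.split v).src (F.1.head F.2.path.1) = u.1 := congrArg Subtype.val hF
    exact split_eq_of_src h.degrees (by rw [hF']; exact hu) (hF'.trans heu.symm)

theorem evolved_distributing_iff (h : S.IsRauzyScheme W) (hv : S.Supporting v) {R : ℕ}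
    (hR : LinearlyRecurrent W R) {u : (S.evolvedGraph v W).V} :
    (S.evolvedGraph v W).Distributing u ↔ SplitVertex.IsD u.1 := by
  refine ⟨fun hd => ?_, h.evolved_distributing_of_isD hv hR⟩
  by_contra hu
  exact hd.not_collecting (h.evolved_collecting_of_not_isD hv hR hu)

theorem evolved_collecting_iff (h : S.IsRauzyScheme W) (hv : S.Supporting v) {R : ℕ}
    (hR : LinearlyRecurrent W R) {u : (S.evolvedGraph v W).V} :
    (S.evolvedGraph v W).Collecting u ↔ ¬ SplitVertex.IsD u.1 :=
  ⟨fun hc hd => (h.evolved_distributing_of_isD hv hR hd).not_collecting hc,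
    h.evolved_collecting_of_not_isD hv hR⟩

theorem evolved_degrees (h : S.IsRauzyScheme W) (hv : S.Supporting v) {R : ℕ}
    (hR : LinearlyRecurrent W R) (u : (S.evolvedGraph v W).V) :
    (S.evolvedGraph v W).Distributing u ∨ (S.evolvedGraph v W).Collecting u := by
  rw [h.evolved_distributing_iff hv hR, h.evolved_collecting_iff hv hR]
  exact em _

theorem evolved_stronglyConnected (h : S.IsRauzyScheme W) (hv : S.Supporting v) {R : ℕ}
    (hR : LinearlyRecurrent W R) : (S.evolvedGraph v W).StronglyConnected := by
  intro u w
  obtain ⟨-, e, he, heu⟩ := h.exists_good_in_out hv hR u.2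
  obtain ⟨⟨f, hf, hfw⟩, -⟩ := h.exists_good_in_out hv hR w.2
  obtain ⟨t, ht⟩ := h.exists_goodPath hv hR he hf
  obtain ⟨q, hq, hqu⟩ := exists_unfold_eq _ ht
    (by rw [List.cons_append]; exact MGraph.startsIn_cons.mpr (heu ▸ u.2))
    (MGraph.endsIn_concat.mpr (hfw ▸ w.2))
  refine hq.reflTransGen ?_ ?_
  · obtain ⟨E, s, rfl⟩ := List.exists_cons_of_ne_nil hq.1
    refine MGraph.startsIn_cons.mpr (Subtype.ext ((startsIn_unfold (P := (· = u.1)) (q := s)).mp ?_))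
    rw [hqu, List.cons_append]
    exact MGraph.startsIn_cons.mpr heu
  · obtain ⟨s, E, rfl⟩ := (List.eq_nil_or_concat' q).resolve_left hq.1
    refine MGraph.endsIn_concat.mpr (Subtype.ext ((endsIn_unfold (P := (· = w.1)) (q := s)).mp ?_))
    rw [hqu]
    exact MGraph.endsIn_concat.mpr hfw

theorem evolved_finite_vertices (h : S.IsRauzyScheme W) : Finite (S.evolvedGraph v W).V := by
  have := h.finite_edges
  have := h.finite_vertices
  exact Finite.of_injective (β := S.SplitVertex) (fun u => u.1) fun _ _ h => Subtype.ext h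

theorem evolved_finite_edges (h : S.IsRauzyScheme W) : Finite (S.evolvedGraph v W).E := by
  have := h.finite_edges
  exact Finite.of_injective (β := S.SplitEdge v) (fun E => E.1.head E.2.path.1)
    fun _ _ h => evolvedEdge_first_unique h

end IsRauzyScheme

end WordGraph

/-! ### Words of the split graph -/

namespace WordGraph

variable {B : Type*} {S : WordGraph B} {W : ℕ → B} {v : S.E}

/-- Restricting to sources of edges excludes the idle points of `SplitVertex`, which are incident to
no edge and for which the equivalence may fail. -/
theorem split_distributing_src (hdeg : S.DegreeCondition) (hv : S.Supporting v)
    (e : S.SplitEdge v) :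
    (S.split v).Distributing ((S.split v).src e) ↔ ((S.split v).src e : S.SplitVertex).IsD := by
  have hvv : S.src v ≠ S.tgt v := fun h => hv.2.not_collecting (h ▸ hv.1)
  constructor
  · rintro ⟨-, f, g, hne, hf, hg⟩
    by_contra hd
    exact hne (split_eq_of_src hdeg (hf ▸ hd) (hf.trans hg.symm))
  intro hd
  rcases he : (S.split v).src e with u | x | y
  · rw [he] at hd
    obtain ⟨e', h1, rfl, h2, h3⟩ := split_src_eq_old he
    have hd' : S.Distributing u := hd
    have huv : u ≠ S.src v := fun h => hd'.not_collecting (h ▸ hv.1)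
    obtain ⟨⟨i, hi, -⟩, f, g, hne, hf, hg⟩ := hd'
    have hiv : i ≠ v := fun h => h3 (by rw [← hi, h])
    have hfv : f ≠ v := fun h => huv (by rw [← hf, h])
    have hgv : g ≠ v := fun h => huv (by rw [← hg, h])
    have hi' : (S.split v).tgt (.old i hiv) = .old u := by rw [split_tgt_of_ne (hi ▸ huv), hi]
    refine ⟨⟨.old i hiv, hi', fun j hj => split_eq_of_tgt (by rw [hj]; exact hd)
      (hj.trans hi'.symm)⟩, .old f hfv, .old g hgv, fun h => hne ?_, ?_, ?_⟩
    · exact (SplitEdge.old.inj h)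
    · rw [split_src_of_ne (hf ▸ h3), hf]
    · rw [split_src_of_ne (hg ▸ h3), hg]
  · obtain ⟨y, hx, hy, rfl⟩ := split_src_eq_A he
    have hxv : x ≠ v := fun h => hvv (by rw [← hx, h])
    have hi' : (S.split v).tgt (.old x hxv) = .A x := split_tgt_of_eq hx
    obtain ⟨-, f, g, hne, hf, hg⟩ := hv.2
    refine ⟨⟨.old x hxv, hi', fun j hj => split_eq_of_tgt (by rw [hj]; trivial)
      (hj.trans hi'.symm)⟩, .new x f hx hf, .new x g hx hg, fun h => hne ?_, rfl, rfl⟩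
    exact (SplitEdge.new.inj h).2
  · rw [he] at hd
    exact hd.elim

theorem split_collecting_tgt (hdeg : S.DegreeCondition) (hv : S.Supporting v)
    (e : S.SplitEdge v) :
    (S.split v).Collecting ((S.split v).tgt e) ↔ ¬ ((S.split v).tgt e : S.SplitVertex).IsD := by
  have hvv : S.src v ≠ S.tgt v := fun h => hv.2.not_collecting (h ▸ hv.1)
  constructor
  · rintro ⟨⟨f, g, hne, hf, hg⟩, -⟩ hd
    exact hne (split_eq_of_tgt (hf ▸ hd) (hf.trans hg.symm))
  intro hd
  rcases he : (S.split v).tgt e with u | x | y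
  · rw [he] at hd
    obtain ⟨e', h1, rfl, h2, h3⟩ := split_tgt_eq_old he
    have hd' : S.Collecting u := (hdeg u).resolve_left hd
    have huv : u ≠ S.tgt v := fun h => hd (h ▸ hv.2)
    obtain ⟨⟨f, g, hne, hf, hg⟩, ⟨i, hi, -⟩⟩ := hd'
    have hiv : i ≠ v := fun h => h3 (by rw [← hi, h])
    have hfv : f ≠ v := fun h => huv (by rw [← hf, h])
    have hgv : g ≠ v := fun h => huv (by rw [← hg, h])
    have hi' : (S.split v).src (.old i hiv) = .old u := by rw [split_src_of_ne (hi ▸ huv), hi]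
    refine ⟨⟨.old f hfv, .old g hgv, fun h => hne ?_, ?_, ?_⟩,
      ⟨.old i hiv, hi', fun j hj => split_eq_of_src hdeg (by rw [hj]; exact hd)
      (hj.trans hi'.symm)⟩⟩
    · exact (SplitEdge.old.inj h)
    · rw [split_tgt_of_ne (hf ▸ h3), hf]
    · rw [split_tgt_of_ne (hg ▸ h3), hg]
  · rw [he] at hd
    exact absurd trivial hd
  · obtain ⟨x, hx, hy, rfl⟩ := split_tgt_eq_B he
    have hyv : y ≠ v := fun h => hvv (by rw [← hy, h])
    have hi' : (S.split v).src (.old y hyv) = .B y := split_src_of_eq hy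
    obtain ⟨⟨f, g, hne, hf, hg⟩, -⟩ := hv.1
    refine ⟨⟨.new f y hf hy, .new g y hg hy, fun h => hne ?_, rfl, rfl⟩,
      ⟨.old y hyv, hi', fun j hj => split_eq_of_src hdeg (by rw [hj]; exact id)
      (hj.trans hi'.symm)⟩⟩
    exact (SplitEdge.new.inj h).1

open Classical in
/-- The front word of an edge that leaves the end of the split edge. -/
noncomputable def SplitEdge.lead : S.SplitEdge v → List B
  | .old e _ => if S.src e = S.tgt v then S.front e else []
  | .new _ _ _ _ => []

open Classical in
/-- The back word of an edge that enters the beginning of the split edge. -/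
noncomputable def SplitEdge.trail : S.SplitEdge v → List B
  | .old e _ => if S.tgt e = S.src v then S.back e else []
  | .new _ _ _ _ => []

/-- `frontTail` in the split graph. -/
noncomputable def splitTail (p : List (S.SplitEdge v)) : List B := (S.split v).frontTail p

/-- `backInit` in the split graph. -/
noncomputable def splitInit (p : List (S.SplitEdge v)) : List B := (S.split v).backInit p

theorem splitTail_nil : splitTail ([] : List (S.SplitEdge v)) = [] := frontTail_nil

theorem splitInit_nil : splitInit ([] : List (S.SplitEdge v)) = [] := backInit_nil

theorem splitTail_cons_of_isD (hdeg : S.DegreeCondition) (hv : S.Supporting v)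
    {e : S.SplitEdge v} (he : ((S.split v).src e : S.SplitVertex).IsD) (p : List (S.SplitEdge v)) :
    splitTail (e :: p) = (S.split v).front e ++ splitTail p :=
  frontTail_cons_of_distributing ((split_distributing_src hdeg hv e).mpr he) p

theorem splitTail_cons_of_not_isD (hdeg : S.DegreeCondition) (hv : S.Supporting v)
    {e : S.SplitEdge v} (he : ¬ ((S.split v).src e : S.SplitVertex).IsD)
    (p : List (S.SplitEdge v)) : splitTail (e :: p) = splitTail p :=
  frontTail_cons_of_not_distributing (fun h => he ((split_distributing_src hdeg hv e).mp h)) p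

theorem splitInit_concat_of_isD (hdeg : S.DegreeCondition) (hv : S.Supporting v)
    {e : S.SplitEdge v} (he : ((S.split v).tgt e : S.SplitVertex).IsD) (p : List (S.SplitEdge v)) :
    splitInit (p ++ [e]) = splitInit p := by
  have h : (S.split v).backInit [e] = [] := (backInit_cons_of_not_collecting
    (fun h => (split_collecting_tgt hdeg hv e).mp h he) []).trans backInit_nil
  refine (backInit_append (S := S.split v) p [e]).trans ?_
  exact (congrArg (fun l => splitInit p ++ l) h).trans (List.append_nil _)

theorem splitInit_concat_of_not_isD (hdeg : S.DegreeCondition) (hv : S.Supporting v)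
    {e : S.SplitEdge v} (he : ¬ ((S.split v).tgt e : S.SplitVertex).IsD)
    (p : List (S.SplitEdge v)) :
    splitInit (p ++ [e]) = splitInit p ++ (S.split v).back e := by
  have h : (S.split v).backInit [e] = (S.split v).back e := (backInit_cons_of_collecting
    ((split_collecting_tgt hdeg hv e).mpr he) []).trans
      ((congrArg (fun l => (S.split v).back e ++ l) backInit_nil).trans (List.append_nil _))
  refine (backInit_append (S := S.split v) p [e]).trans ?_
  exact congrArg (fun l => splitInit p ++ l) h

theorem backInit_concat_of_collecting {e : S.E} (h : S.Collecting (S.tgt e)) (p : List S.E) :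
    S.backInit (p ++ [e]) = S.backInit p ++ S.back e := by
  rw [backInit_append, backInit_cons_of_collecting h, backInit_nil, List.append_nil]

theorem backInit_concat_of_not_collecting {e : S.E} (h : ¬ S.Collecting (S.tgt e))
    (p : List S.E) : S.backInit (p ++ [e]) = S.backInit p := by
  rw [backInit_append, backInit_cons_of_not_collecting h, backInit_nil, List.append_nil]

theorem lead_frontTail_cons_old (hdeg : S.DegreeCondition) (hv : S.Supporting v) {e : S.E}
    (he : e ≠ v) (p : List (S.SplitEdge v)) (l : List S.E) (h : S.frontTail l = splitTail p) :
    S.frontTail (e :: l) = (SplitEdge.old e he).lead ++ splitTail (.old e he :: p) := by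
  by_cases hev : S.src e = S.tgt v
  · rw [frontTail_cons_of_distributing (hev ▸ hv.2), h, splitTail_cons_of_not_isD hdeg hv
      (by rw [split_src_of_eq hev]; exact id), SplitEdge.lead, if_pos hev]
  · rw [SplitEdge.lead, if_neg hev, List.nil_append]
    by_cases hde : S.Distributing (S.src e)
    · rw [frontTail_cons_of_distributing hde, h, splitTail_cons_of_isD hdeg hv
        (by rw [split_src_of_ne hev]; exact hde)]
      exact congrArg (· ++ _) (if_neg hev).symm
    · rw [frontTail_cons_of_not_distributing hde, h, splitTail_cons_of_not_isD hdeg hv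
        (by rw [split_src_of_ne hev]; exact hde)]

/-- In `S` the word `Y` is contributed by `y`, which leaves a distributing vertex; in the split
graph it is contributed by the preceding `v_{xy}`, and `y` leaves a vertex of out-degree one. The
two counts differ only if the path starts with `y`, and `lead` is this difference. -/
theorem frontTail_map_toEdge (hdeg : S.DegreeCondition) (hv : S.Supporting v) {e : S.SplitEdge v}
    {t : List (S.SplitEdge v)} (hp : (S.split v).IsPath (e :: t))
    (he : (S.split v).EndsIn SplitVertex.IsD (e :: t)) :
    S.frontTail (e.toEdge :: t.map SplitEdge.toEdge) = e.lead ++ splitTail (e :: t) := by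
  induction t generalizing e with
  | nil =>
    cases e with
    | old f hf => exact lead_frontTail_cons_old hdeg hv hf [] [] (frontTail_nil.trans splitTail_nil.symm)
    | new x y hx hy => exact (MGraph.endsIn_singleton.mp he).elim
  | cons g t ih =>
    have hp' := MGraph.isPath_cons_cons.mp hp
    have ih' := ih hp'.2 (MGraph.endsIn_cons_cons.mp he)
    rw [List.map_cons]
    cases e with
    | old f hf =>
      refine lead_frontTail_cons_old hdeg hv hf (g :: t) _ ?_
      have hg : g.lead = [] := by
        cases g with
        | new => rfl
        | old y hy =>
          refine if_neg fun hyv => ?_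
          obtain ⟨x, hx, hy, h⟩ := split_tgt_eq_B (hp'.1.trans (split_src_of_eq hyv))
          cases h
      rw [ih', hg, List.nil_append]
    | new x y hx hy =>
      obtain ⟨h', rfl⟩ := split_eq_old_of_src hp'.1
      have h2 : (SplitEdge.old y h').lead = S.front y := if_pos hy
      have h3 : ¬ S.Distributing (S.src (SplitEdge.new x y hx hy).toEdge) :=
        fun h => h.not_collecting hv.1
      rw [frontTail_cons_of_not_distributing h3, ih', h2,
        splitTail_cons_of_isD hdeg hv (e := .new x y hx hy) trivial]
      rfl

theorem backInit_concat_trail_old (hdeg : S.DegreeCondition) (hv : S.Supporting v) {e : S.E}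
    (he : e ≠ v) (p : List (S.SplitEdge v)) (l : List S.E) (h : S.backInit l = splitInit p) :
    S.backInit (l ++ [e]) = splitInit (p ++ [.old e he]) ++ (SplitEdge.old e he).trail := by
  by_cases hev : S.tgt e = S.src v
  · rw [backInit_concat_of_collecting (hev ▸ hv.1), h, splitInit_concat_of_isD hdeg hv
      (by rw [split_tgt_of_eq hev]; trivial), SplitEdge.trail, if_pos hev]
  · rw [SplitEdge.trail, if_neg hev, List.append_nil]
    by_cases hde : S.Distributing (S.tgt e)
    · rw [backInit_concat_of_not_collecting hde.not_collecting, h, splitInit_concat_of_isD hdeg hv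
        (by rw [split_tgt_of_ne hev]; exact hde)]
    · rw [backInit_concat_of_collecting ((hdeg _).resolve_left hde), h,
        splitInit_concat_of_not_isD hdeg hv (by rw [split_tgt_of_ne hev]; exact hde)]
      exact congrArg (_ ++ ·) (if_neg hev).symm

theorem backInit_map_toEdge (hdeg : S.DegreeCondition) (hv : S.Supporting v) {e : S.SplitEdge v}
    {t : List (S.SplitEdge v)} (hp : (S.split v).IsPath (t ++ [e]))
    (he : (S.split v).StartsIn (fun u : S.SplitVertex => ¬ u.IsD) (t ++ [e])) :
    S.backInit (t.map SplitEdge.toEdge ++ [e.toEdge]) = splitInit (t ++ [e]) ++ e.trail := by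
  induction t using List.reverseRecOn generalizing e with
  | nil =>
    cases e with
    | old f hf => exact backInit_concat_trail_old hdeg hv hf [] [] (backInit_nil.trans splitInit_nil.symm)
    | new x y hx hy => exact ((MGraph.startsIn_cons.mp he) trivial).elim
  | append_singleton t g ih =>
    have hlink : (S.split v).tgt g = (S.split v).src e := hp.link
    have hne : t ++ [g] ≠ [] := by simp
    have ih' := ih (hp.of_infix (List.prefix_append _ _).isInfix hne)
      ((MGraph.startsIn_append hne).mp he)
    rw [List.map_append, List.map_singleton]
    cases e with
    | old f hf =>
      refine backInit_concat_trail_old hdeg hv hf (t ++ [g]) _ ?_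
      have hg : g.trail = [] := by
        cases g with
        | new => rfl
        | old x hx =>
          refine if_neg fun hxv => ?_
          obtain ⟨y, hx, hy, h⟩ := split_src_eq_A (hlink.symm.trans (split_tgt_of_eq hxv))
          cases h
      rw [ih', hg, List.append_nil]
    | new x y hx hy =>
      obtain ⟨h', rfl⟩ := split_eq_old_of_tgt hlink
      have h2 : (SplitEdge.old x h').trail = S.back x := if_pos hx
      have h3 : ¬ S.Collecting (S.tgt (SplitEdge.new x y hx hy).toEdge) :=
        fun h => hv.2.not_collecting h
      rw [backInit_concat_of_not_collecting h3, ih', h2,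
        splitInit_concat_of_not_isD hdeg hv (e := .new x y hx hy) id]
      exact (List.append_nil _).symm

theorem split_F_cons (e : S.SplitEdge v) (p : List (S.SplitEdge v)) :
    (S.split v).F (e :: p) = (S.split v).front e ++ splitTail p := F_cons (S := S.split v) e p

theorem split_Bk_concat (p : List (S.SplitEdge v)) (e : S.SplitEdge v) :
    (S.split v).Bk (p ++ [e]) = splitInit p ++ (S.split v).back e := Bk_concat (S := S.split v) p e

/-- A path of the split graph has the same words as the corresponding path of the original graph,
if it leads from a collecting to a distributing place. -/
theorem exists_restore (hdeg : S.DegreeCondition) (hS : S.Balanced) (hv : S.Supporting v)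
    {p : List (S.SplitEdge v)} (hp : (S.split v).IsPath p)
    (hs : (S.split v).StartsIn (fun u : S.SplitVertex => ¬ u.IsD) p)
    (he : (S.split v).EndsIn SplitVertex.IsD p) :
    ∃ a b, (a = [] ∨ a = [v]) ∧ (b = [] ∨ b = [v]) ∧
      S.IsSymmetricPath (a ++ p.map SplitEdge.toEdge ++ b) ∧
      (S.split v).F p = S.F (a ++ p.map SplitEdge.toEdge ++ b) ∧
      (S.split v).Bk p = S.Bk (a ++ p.map SplitEdge.toEdge ++ b) ∧
      (∀ f ∈ p.head?, f.toEdge ≠ v) ∧ ∀ f ∈ p.getLast?, f.toEdge ≠ v := by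
  have hpath := isPath_map_toEdge hp
  have hne := hpath.1
  have hvc : ¬ S.Distributing (S.src v) := fun h => h.not_collecting hv.1
  obtain ⟨a, ha, hpa, hsa, hFa, hfirst⟩ : ∃ a, (a = [] ∨ a = [v]) ∧
      S.IsPath (a ++ p.map SplitEdge.toEdge) ∧
      S.StartsIn S.Collecting (a ++ p.map SplitEdge.toEdge) ∧
      (S.split v).F p = S.F (a ++ p.map SplitEdge.toEdge) ∧ (∀ f ∈ p.head?, f.toEdge ≠ v) := by
    obtain ⟨e, t, rfl⟩ := List.exists_cons_of_ne_nil hp.1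
    have hs' : ¬ ((S.split v).src e : S.SplitVertex).IsD := MGraph.startsIn_cons.mp hs
    have hmap := frontTail_map_toEdge hdeg hv hp he
    rw [splitTail_cons_of_not_isD hdeg hv hs'] at hmap
    have hF : (S.split v).F (e :: t) = (S.split v).front e ++ splitTail t := split_F_cons e t
    cases e with
    | new x y hx hy => exact (hs' trivial).elim
    | old f hf =>
      -- A path that starts in a vertex `B y` has front word beginning with `V Y`. Restoring `v`
      -- before it accounts for `V` and makes the path start in a collecting vertex.
      by_cases hfv : S.src f = S.tgt v
      · refine ⟨[v], Or.inr rfl, MGraph.isPath_cons_cons.mpr ⟨hfv.symm, hpath⟩,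
          MGraph.startsIn_cons.mpr hv.1, hF.trans ?_, by simpa [SplitEdge.toEdge] using hf⟩
        have h1 : (SplitEdge.old f hf).lead = S.front f := if_pos hfv
        have h2 : (S.split v).front (.old f hf) = S.front v ++ S.front f := if_pos hfv
        rw [List.singleton_append, F_cons, List.map_cons, hmap, h1, h2, List.append_assoc]
      · rw [split_src_of_ne hfv] at hs'
        refine ⟨[], Or.inl rfl, hpath, MGraph.startsIn_cons.mpr ((hdeg _).resolve_left hs'),
          hF.trans ?_, by simpa [SplitEdge.toEdge] using hf⟩
        have h1 : (SplitEdge.old f hf).lead = [] := if_neg hfv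
        have h2 : (S.split v).front (.old f hf) = S.front f := if_neg hfv
        have h3 : ¬ S.Distributing (S.src (SplitEdge.old f hf).toEdge) := hs'
        rw [h1, List.nil_append, frontTail_cons_of_not_distributing h3] at hmap
        rw [List.nil_append, List.map_cons, F_cons, hmap, h2]
        rfl
  obtain ⟨b, hb, hpb, hsb, hBb, hlast⟩ : ∃ b, (b = [] ∨ b = [v]) ∧
      S.IsPath (p.map SplitEdge.toEdge ++ b) ∧
      S.EndsIn S.Distributing (p.map SplitEdge.toEdge ++ b) ∧
      (S.split v).Bk p = S.Bk (p.map SplitEdge.toEdge ++ b) ∧ (∀ f ∈ p.getLast?, f.toEdge ≠ v) := by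
    clear hFa hfirst hsa hpa
    obtain ⟨t, e, rfl⟩ := (List.eq_nil_or_concat' p).resolve_left hp.1
    have he' : ((S.split v).tgt e : S.SplitVertex).IsD := MGraph.endsIn_concat.mp he
    have hmap := backInit_map_toEdge hdeg hv hp hs
    rw [splitInit_concat_of_isD hdeg hv he'] at hmap
    have hB : (S.split v).Bk (t ++ [e]) = splitInit t ++ (S.split v).back e := split_Bk_concat t e
    rw [List.map_append, List.map_singleton] at hne hpath ⊢
    cases e with
    | new x y hx hy => exact he'.elim
    | old f hf =>
      have hl : ∀ g ∈ (t ++ [SplitEdge.old f hf]).getLast?, g.toEdge ≠ v := by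
        simpa [SplitEdge.toEdge] using hf
      by_cases hfv : S.tgt f = S.src v
      · refine ⟨[v], Or.inr rfl, ?_, MGraph.endsIn_concat.mpr hv.2, hB.trans ?_, hl⟩
        · rw [MGraph.isPath_append hne (by simp)]
          refine ⟨hpath, MGraph.isPath_singleton v, ?_⟩
          simpa [SplitEdge.toEdge] using hfv
        · have h1 : (SplitEdge.old f hf).trail = S.back f := if_pos hfv
          have h2 : (S.split v).back (.old f hf) = S.back f ++ S.front v := if_pos hfv
          rw [Bk_concat, hmap, h1, h2, List.append_assoc, hS.front_eq_back hv]
      · rw [split_tgt_of_ne hfv] at he'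
        refine ⟨[], Or.inl rfl, by rwa [List.append_nil], ?_, hB.trans ?_, hl⟩
        · rw [List.append_nil]
          exact MGraph.endsIn_concat.mpr he'
        · have h1 : (SplitEdge.old f hf).trail = [] := if_neg hfv
          have h2 : (S.split v).back (.old f hf) = S.back f := if_neg hfv
          have h3 : ¬ S.Collecting (S.tgt (SplitEdge.old f hf).toEdge) :=
            fun h => (he' : S.Distributing _).not_collecting h
          rw [h1, List.append_nil, backInit_concat_of_not_collecting h3] at hmap
          rw [List.append_nil, Bk_concat, hmap, h2]
          rfl
  refine ⟨a, b, ha, hb, ⟨?_, ?_, ?_⟩, ?_, ?_, hfirst, hlast⟩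
  · rcases hb with rfl | rfl
    · rwa [List.append_nil]
    · rw [MGraph.isPath_append hpa.1 (by simp)]
      refine ⟨hpa, MGraph.isPath_singleton v, ?_⟩
      have := ((MGraph.isPath_append hne (by simp)).mp hpb).2.2
      rwa [List.getLast?_append_of_ne_nil _ hne]
  · rwa [MGraph.startsIn_append hpa.1]
  · rw [List.append_assoc, MGraph.endsIn_append hpb.1]
    exact hsb
  -- A `v` restored at the end leaves a collecting vertex, so it contributes nothing to the front
  -- word; symmetrically, a `v` restored at the beginning does not affect the back word.
  · rcases hb with rfl | rfl
    · rwa [List.append_nil]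
    · rw [F_append hpa.1, frontTail_cons_of_not_distributing hvc, frontTail_nil, List.append_nil, hFa]
  · rcases ha with rfl | rfl
    · exact hBb
    · rw [List.append_assoc, Bk_append _ hpb.1,
        backInit_cons_of_not_collecting (fun h => hv.2.not_collecting h), backInit_nil,
        List.nil_append, hBb]

end WordGraph

/-! ### The elementary evolution of a Rauzy scheme is a Rauzy scheme -/

namespace WordGraph

/-! ### Words of paths expressed through the words of natural extensions. -/

section Generic

variable {B : Type*} {S : WordGraph B}

/-- A path that ends in a distributing vertex is a concatenation of right extensions, and each
contributes only the front word of its first edge. An additive `Φ` that agrees on right extensions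
therefore agrees on the whole path. -/
theorem F_eq_of_front_eq (Φ : List S.E → List B)
    (hΦ : ∀ p q, p ≠ [] → S.StartsIn S.Distributing q → Φ (p ++ q) = Φ p ++ Φ q)
    (hf : ∀ e r, S.IsRightExtension e r → S.front e = Φ r) (q : List S.E) (hq : S.IsPath q)
    (he : S.EndsIn S.Distributing q) : S.F q = Φ q := by
  induction hk : q.length using Nat.strong_induction_on generalizing q with
  | _ k ih =>
    obtain ⟨e, t, rfl⟩ := List.exists_cons_of_ne_nil hq.1
    obtain ⟨r, s, hrs, hr⟩ := MGraph.exists_rightExtension_prefix hq he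
    rw [hrs] at hq he hk ⊢
    by_cases hs : s = []
    · subst hs
      rw [List.append_nil, F_rightExtension hr, hf e r hr]
    · obtain ⟨f, s, rfl⟩ := List.exists_cons_of_ne_nil hs
      have hd : S.Distributing (S.src f) := by
        obtain ⟨r', g, rfl⟩ := (List.eq_nil_or_concat' r).resolve_left hr.1.1
        exact hq.link ▸ MGraph.endsIn_concat.mp hr.2.2.1
      have hlt : (f :: s).length < k := by
        have := List.length_pos_iff.mpr hr.1.1
        rw [List.length_append] at hk
        omega
      rw [F_append hr.1.1, frontTail_eq_F hd,
        hΦ r (f :: s) hr.1.1 (MGraph.startsIn_cons.mpr hd), F_rightExtension hr, hf e r hr,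
        ih _ hlt (f :: s) (hq.of_infix (List.suffix_append _ _).isInfix hs)
          ((MGraph.endsIn_append hs).mp he) rfl]

theorem Bk_eq_of_back_eq (Φ : List S.E → List B)
    (hΦ : ∀ p q, q ≠ [] → S.EndsIn S.Collecting p → Φ (p ++ q) = Φ p ++ Φ q)
    (hb : ∀ e r, S.IsLeftExtension e r → S.back e = Φ r) (q : List S.E) (hq : S.IsPath q)
    (he : S.StartsIn S.Collecting q) : S.Bk q = Φ q := by
  have hD : S.rev.Distributing = S.Collecting := funext fun _ => propext MGraph.rev_distributing
  have key := F_eq_of_front_eq (S := S.rev) (fun p => (Φ p.reverse).reverse) (fun p q hp hq => by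
    have hq' : S.EndsIn S.Collecting q.reverse := by
      rw [← MGraph.startsIn_rev, List.reverse_reverse, ← hD]
      exact hq
    have hp' : p.reverse ≠ [] := fun h => hp (List.reverse_eq_nil_iff.mp h)
    have := hΦ q.reverse p.reverse hp' hq'
    rw [List.reverse_append, this, List.reverse_append]) (fun e r hr => by
    have h1 : S.IsLeftExtension e r.reverse := by
      rw [← MGraph.isRightExtension_rev, List.reverse_reverse]
      exact hr
    exact congrArg List.reverse (hb e _ h1)) q.reverse (MGraph.isPath_rev.mpr hq)
    (hD ▸ MGraph.endsIn_rev.mpr he)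
  rw [F_rev] at key
  simpa using key

/-- The front word of `e` is the word of its right extension, which is contained in `p` because `p`
ends in a distributing vertex. This will show that the words of the evolved scheme are factors of
`W`. -/
theorem Balanced.front_infix_F (hdeg : S.DegreeCondition) (hS : S.Balanced) {p : List S.E}
    (hp : S.IsSymmetricPath p) {e : S.E} (he : e ∈ p) : S.front e <:+: S.F p := by
  obtain ⟨a, b, rfl⟩ := List.append_of_mem he
  have hne : e :: b ≠ [] := List.cons_ne_nil _ _
  obtain ⟨r, s, hrs, hr⟩ := MGraph.exists_rightExtension_prefix
    (hp.1.of_infix (List.suffix_append a _).isInfix hne) ((MGraph.endsIn_append hne).mp hp.2.2)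
  have hF : S.F (e :: b) = S.front e ++ S.frontTail s := by
    rw [hrs, F_append hr.1.1, F_rightExtension hr]
  rcases hdeg (S.src e) with hd | hc
  · have ha : a ≠ [] := by
      rintro rfl
      exact hd.not_collecting (MGraph.startsIn_cons.mp hp.2.1)
    rw [F_append ha, frontTail_eq_F hd, hF]
    exact ⟨S.F a, S.frontTail s, by rw [List.append_assoc]⟩
  · rw [hS.F_suffix hp (hp.suffix hne (MGraph.startsIn_cons.mpr hc)), hF]
    exact ⟨_, S.frontTail s, by rw [List.append_assoc]⟩

theorem Balanced.back_infix_F (hdeg : S.DegreeCondition) (hS : S.Balanced) {p : List S.E}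
    (hp : S.IsSymmetricPath p) {e : S.E} (he : e ∈ p) : S.back e <:+: S.F p := by
  have := Balanced.front_infix_F (S := S.rev)
    (fun u => (hdeg u).symm.imp MGraph.rev_distributing.mpr MGraph.rev_collecting.mpr) hS.rev
    (MGraph.isSymmetricPath_rev.mpr hp) (List.mem_reverse.mpr he)
  rw [F_rev, ← hS p hp] at this
  exact List.reverse_infix.mp this

end Generic

variable {B : Type*} {S : WordGraph B} {W : ℕ → B} {v : S.E}

theorem IsEvolvedEdge.tail_src {p : List (S.split v).E} (hp : S.IsEvolvedEdge v W p) :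
    ∀ f ∈ p.tail, ¬ S.NonVanishing v W ((S.split v).src f) :=
  hp.path.forall_tail_src (P := fun u => ¬ S.NonVanishing v W u) hp.inner

/-- The first edge of an evolved edge leaves a non-vanishing vertex, whereas the other edges leave
vanishing ones. Hence it cannot occur inside another evolved edge. -/
theorem mem_of_head_mem_unfold {E : (S.evolvedGraph v W).E} {q : List (S.evolvedGraph v W).E}
    (h : E.1.head E.2.path.1 ∈ S.unfold v W q) : E ∈ q := by
  obtain ⟨F, hF, hE⟩ := List.mem_flatMap.mp h
  obtain rfl : E = F := by
    refine evolvedEdge_first_unique ?_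
    rcases List.mem_cons.mp ((List.cons_head_tail F.2.path.1).symm ▸ hE) with h' | h'
    · exact h'
    · exact absurd E.2.starts (F.2.tail_src _ h')
  exact hF

theorem prefix_of_unfold_prefix (p q : List (S.evolvedGraph v W).E)
    (h : S.unfold v W p <+: S.unfold v W q) : p <+: q := by
  induction p generalizing q with
  | nil => exact List.nil_prefix
  | cons E p ih =>
    cases q with
    | nil =>
      have h0 : S.unfold v W (E :: p) = [] := List.prefix_nil.mp h
      exact absurd (List.append_eq_nil_iff.mp h0).1 E.2.path.1
    | cons F q =>
      have hhead : E = F := by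
        obtain ⟨r, hr⟩ := h
        refine evolvedEdge_first_unique ?_
        have h1 : ((E.1 ++ S.unfold v W p) ++ r).head? = (F.1 ++ S.unfold v W q).head? :=
          congrArg List.head? hr
        have h2 : ((E.1 ++ S.unfold v W p) ++ r).head? = some (E.1.head E.2.path.1) := by
          rw [List.append_assoc, List.head?_append_of_ne_nil _ E.2.path.1,
            List.head?_eq_some_head E.2.path.1]
        have h3 : (F.1 ++ S.unfold v W q).head? = some (F.1.head F.2.path.1) := by
          rw [List.head?_append_of_ne_nil _ F.2.path.1, List.head?_eq_some_head F.2.path.1]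
        exact Option.some.inj (h2.symm.trans (h1.trans h3))
      subst hhead
      have h' : S.unfold v W p <+: S.unfold v W q := (List.prefix_append_right_inj E.1).mp h
      exact (List.prefix_cons_inj E).mpr (ih q h')

/-- An occurrence of the image of a path of the evolved graph comes from an occurrence of the
path. -/
theorem exists_of_unfold_eq {p : List (S.evolvedGraph v W).E} (hp : p ≠ [])
    (q : List (S.evolvedGraph v W).E) {l r : List (S.split v).E}
    (h : S.unfold v W q = l ++ S.unfold v W p ++ r) :
    ∃ l' r', q = l' ++ p ++ r' ∧ S.unfold v W l' = l := by
  obtain ⟨E, p, rfl⟩ := List.exists_cons_of_ne_nil hp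
  obtain ⟨e, s, hE⟩ := List.exists_cons_of_ne_nil E.2.path.1
  have hN : S.NonVanishing v W ((S.split v).src e) := by
    have := E.2.starts
    simp only [hE, List.head_cons] at this
    exact this
  have hu : S.unfold v W (E :: p) = e :: (s ++ S.unfold v W p) := by
    rw [unfold_cons, hE, List.cons_append]
  induction q generalizing l with
  | nil =>
    rw [hu] at h
    have h' : [] = (l ++ e :: (s ++ S.unfold v W p)) ++ r := h
    simp at h'
  | cons F q ih =>
    by_cases hl : l = []
    · subst hl
      obtain ⟨r', hr'⟩ := prefix_of_unfold_prefix (E :: p) (F :: q) ⟨r, h.symm⟩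
      exact ⟨[], r', hr'.symm, rfl⟩
    · obtain ⟨g, l, rfl⟩ := List.exists_cons_of_ne_nil hl
      have hF := F.2.tail_src
      obtain ⟨f, t, hft⟩ := List.exists_cons_of_ne_nil F.2.path.1
      have h' : f :: (t ++ S.unfold v W q) = g :: (l ++ S.unfold v W (E :: p) ++ r) := by
        rw [unfold_cons F q, hft] at h
        exact h
      obtain ⟨rfl, h2⟩ := List.cons.inj h'
      rw [hft, List.tail_cons] at hF
      rw [hu, List.append_assoc, List.append_eq_append_iff] at h2
      rcases h2 with ⟨c, hc, hc'⟩ | ⟨c, hc, hc'⟩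
      · obtain ⟨l', r', hq, hl'⟩ := ih (l := c) (by rw [hc', hu, List.append_assoc])
        refine ⟨F :: l', r', by rw [hq]; rfl, ?_⟩
        rw [unfold_cons, hft, hl', hc]
        rfl
      · cases c with
        | nil =>
          obtain ⟨l', r', hq, hl'⟩ := ih (l := []) (by
            rw [hu, List.nil_append]
            exact hc'.symm)
          refine ⟨F :: l', r', by rw [hq]; rfl, ?_⟩
          rw [unfold_cons, hft, hl', hc]
          simp
        | cons x c =>
          -- In this case the occurrence would begin inside `F` after its first edge, although `e`
          -- leaves a non-vanishing vertex.
          obtain rfl : e = x := by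
            rw [List.cons_append, List.cons_append] at hc'
            exact (List.cons.inj hc').1
          exact absurd hN (hF e (by rw [hc]; simp))

theorem evolve_front_eq (hdeg : ∀ u, (S.evolvedGraph v W).Distributing u ∨
    (S.evolvedGraph v W).Collecting u) {E : (S.evolvedGraph v W).E}
    {r : List (S.evolvedGraph v W).E} (hr : (S.evolvedGraph v W).IsRightExtension E r) :
    (S.evolve v W).front E = (S.split v).F (S.unfold v W r) := by
  have h : ∃ q, (S.evolvedGraph v W).IsRightExtension E q := ⟨r, hr⟩
  have h1 : (S.evolve v W).front E = (S.split v).F (S.unfold v W h.choose) := dif_pos h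
  rw [h1, h.choose_spec.unique hdeg hr]

theorem evolve_back_eq (hdeg : ∀ u, (S.evolvedGraph v W).Distributing u ∨
    (S.evolvedGraph v W).Collecting u) {E : (S.evolvedGraph v W).E}
    {r : List (S.evolvedGraph v W).E} (hr : (S.evolvedGraph v W).IsLeftExtension E r) :
    (S.evolve v W).back E = (S.split v).Bk (S.unfold v W r) := by
  have h : ∃ q, (S.evolvedGraph v W).IsLeftExtension E q := ⟨r, hr⟩
  have h1 : (S.evolve v W).back E = (S.split v).Bk (S.unfold v W h.choose) := dif_pos h
  rw [h1, h.choose_spec.unique hdeg hr]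

theorem unfold_ne_nil {q : List (S.evolvedGraph v W).E} (hq : q ≠ []) :
    S.unfold v W q ≠ [] := by
  obtain ⟨E, q, rfl⟩ := List.exists_cons_of_ne_nil hq
  rw [unfold_cons]
  exact List.append_ne_nil_of_left_ne_nil E.2.path.1 _

theorem split_F_unfold_append (hdeg : S.DegreeCondition) (hv : S.Supporting v)
    {p : List (S.evolvedGraph v W).E} (hp : p ≠ []) {E : (S.evolvedGraph v W).E}
    (hE : SplitVertex.IsD ((S.evolvedGraph v W).src E).1) (q : List (S.evolvedGraph v W).E) :
    (S.split v).F (S.unfold v W (p ++ E :: q)) =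
      (S.split v).F (S.unfold v W p) ++ (S.split v).F (S.unfold v W (E :: q)) := by
  have h1 : S.unfold v W (E :: q) = E.1.head E.2.path.1 :: (E.1.tail ++ S.unfold v W q) := by
    rw [unfold_cons, ← List.cons_append, List.cons_head_tail]
  rw [unfold_append, F_append (unfold_ne_nil hp), h1,
    frontTail_eq_F ((split_distributing_src hdeg hv _).mpr hE)]

theorem split_Bk_unfold_append (hdeg : S.DegreeCondition) (hv : S.Supporting v)
    {q : List (S.evolvedGraph v W).E} (hq : q ≠ []) {E : (S.evolvedGraph v W).E}
    (hE : ¬ SplitVertex.IsD ((S.evolvedGraph v W).tgt E).1) (p : List (S.evolvedGraph v W).E) :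
    (S.split v).Bk (S.unfold v W ((p ++ [E]) ++ q)) =
      (S.split v).Bk (S.unfold v W (p ++ [E])) ++ (S.split v).Bk (S.unfold v W q) := by
  have h1 : S.unfold v W (p ++ [E]) =
      (S.unfold v W p ++ E.1.dropLast) ++ [E.1.getLast E.2.path.1] := by
    rw [unfold_append, unfold_singleton, List.append_assoc, List.dropLast_append_getLast]
  rw [unfold_append (p ++ [E]), Bk_append _ (unfold_ne_nil hq), h1, Bk_concat,
    backInit_concat_of_collecting ((split_collecting_tgt hdeg hv _).mpr hE)]

namespace IsRauzyScheme

variable {R : ℕ}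

theorem evolve_F_eq (h : S.IsRauzyScheme W) (hv : S.Supporting v) (hR : LinearlyRecurrent W R)
    {q : List (S.evolvedGraph v W).E} (hq : (S.evolvedGraph v W).IsPath q)
    (he : (S.evolvedGraph v W).EndsIn (S.evolvedGraph v W).Distributing q) :
    (S.evolve v W).F q = (S.split v).F (S.unfold v W q) := by
  refine F_eq_of_front_eq (S := S.evolve v W) (fun q => (S.split v).F (S.unfold v W q)) ?_
    (fun e r hr => evolve_front_eq (h.evolved_degrees hv hR) hr) q hq he
  intro p q hp hq
  obtain ⟨E, hE, hd⟩ := hq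
  obtain ⟨q, rfl⟩ : ∃ t, q = E :: t := by
    cases q with
    | nil => simp at hE
    | cons F t => exact ⟨t, by simpa using hE⟩
  exact split_F_unfold_append h.degrees hv hp ((h.evolved_distributing_iff hv hR).mp hd) q

theorem evolve_Bk_eq (h : S.IsRauzyScheme W) (hv : S.Supporting v) (hR : LinearlyRecurrent W R)
    {q : List (S.evolvedGraph v W).E} (hq : (S.evolvedGraph v W).IsPath q)
    (he : (S.evolvedGraph v W).StartsIn (S.evolvedGraph v W).Collecting q) :
    (S.evolve v W).Bk q = (S.split v).Bk (S.unfold v W q) := by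
  refine Bk_eq_of_back_eq (S := S.evolve v W) (fun q => (S.split v).Bk (S.unfold v W q)) ?_
    (fun e r hr => evolve_back_eq (h.evolved_degrees hv hR) hr) q hq he
  intro p q hq hp
  obtain ⟨E, hE, hd⟩ := hp
  obtain ⟨p, rfl⟩ : ∃ t, p = t ++ [E] := by
    rcases List.eq_nil_or_concat' p with rfl | ⟨t, F, rfl⟩
    · simp at hE
    · refine ⟨t, ?_⟩
      rw [List.getLast?_concat, Option.mem_some_iff] at hE
      rw [hE]
  exact split_Bk_unfold_append h.degrees hv hq ((h.evolved_collecting_iff hv hR).mp hd) p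

theorem exists_evolve_restore (h : S.IsRauzyScheme W) (hv : S.Supporting v)
    (hR : LinearlyRecurrent W R) {q : List (S.evolvedGraph v W).E}
    (hq : (S.evolvedGraph v W).IsSymmetricPath q) :
    ∃ a b, (a = [] ∨ a = [v]) ∧ (b = [] ∨ b = [v]) ∧
      S.IsSymmetricPath (a ++ (S.unfold v W q).map SplitEdge.toEdge ++ b) ∧
      (S.evolve v W).F q = S.F (a ++ (S.unfold v W q).map SplitEdge.toEdge ++ b) ∧
      (S.evolve v W).Bk q = S.Bk (a ++ (S.unfold v W q).map SplitEdge.toEdge ++ b) ∧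
      (∀ f ∈ (S.unfold v W q).head?, SplitEdge.toEdge f ≠ v) ∧
      ∀ f ∈ (S.unfold v W q).getLast?, SplitEdge.toEdge f ≠ v := by
  rw [h.evolve_F_eq hv hR hq.1 hq.2.2, h.evolve_Bk_eq hv hR hq.1 hq.2.1]
  refine exists_restore h.degrees h.balanced hv (isGoodPath_unfold hq.1).1 ?_ ?_
  · obtain ⟨E, t, rfl⟩ := List.exists_cons_of_ne_nil hq.1.1
    exact startsIn_unfold.mpr
      ((h.evolved_collecting_iff hv hR).mp (MGraph.startsIn_cons.mp hq.2.1))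
  · obtain ⟨t, E, rfl⟩ := (List.eq_nil_or_concat' q).resolve_left hq.1.1
    exact endsIn_unfold.mpr
      ((h.evolved_distributing_iff hv hR).mp (MGraph.endsIn_concat.mp hq.2.2))

end IsRauzyScheme

end WordGraph

/-- The letters `x` added at the ends can be neither the first nor the last letter of `m`, so the
occurrence of `m` avoids them. It serves to discard the restored copies of `v`. -/
theorem exists_eq_of_append_eq {α : Type*} {x : α} {a b l r m s : List α} (ha : a = [] ∨ a = [x])
    (hb : b = [] ∨ b = [x]) (hm : m ≠ []) (hhead : ∀ y ∈ m.head?, y ≠ x)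
    (hlast : ∀ y ∈ m.getLast?, y ≠ x) (h : a ++ s ++ b = l ++ m ++ r) :
    ∃ l' r', s = l' ++ m ++ r' ∧ l = a ++ l' := by
  have h1 : ∃ l', l = a ++ l' := by
    rcases ha with rfl | rfl
    · exact ⟨l, rfl⟩
    · cases l with
      | nil =>
        obtain ⟨y, t, rfl⟩ := List.exists_cons_of_ne_nil hm
        simp only [List.cons_append, List.nil_append, List.cons.injEq] at h
        exact absurd h.1.symm (hhead y (by simp))
      | cons y l =>
        simp only [List.cons_append, List.cons.injEq] at h
        exact ⟨l, by rw [h.1]; rfl⟩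
  obtain ⟨l', rfl⟩ := h1
  have h2 : ∃ r', r = r' ++ b := by
    rcases hb with rfl | rfl
    · exact ⟨r, by simp⟩
    · rcases List.eq_nil_or_concat' r with rfl | ⟨r, y, rfl⟩
      · obtain ⟨t, y, rfl⟩ := (List.eq_nil_or_concat' m).resolve_left hm
        rw [List.append_nil, ← List.append_assoc] at h
        have := (List.append_inj' h rfl).2
        simp only [List.cons.injEq, and_true] at this
        exact absurd this.symm (hlast y (by simp))
      · rw [← List.append_assoc] at h
        have := (List.append_inj' h rfl).2
        exact ⟨r, by rw [this]⟩
  obtain ⟨r', rfl⟩ := h2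
  refine ⟨l', r', ?_, rfl⟩
  have h3 : a ++ s ++ b = a ++ (l' ++ m ++ r') ++ b := by simpa [List.append_assoc] using h
  exact List.append_cancel_left (List.append_cancel_right h3)

theorem infix_of_infix_append {α : Type*} {x : α} {a b m s : List α} (ha : a = [] ∨ a = [x])
    (hb : b = [] ∨ b = [x]) (hm : m ≠ []) (hhead : ∀ y ∈ m.head?, y ≠ x)
    (hlast : ∀ y ∈ m.getLast?, y ≠ x) (h : m <:+: a ++ s ++ b) : m <:+: s := by
  obtain ⟨l, r, h⟩ := h
  obtain ⟨l', r', rfl, -⟩ := exists_eq_of_append_eq ha hb hm hhead hlast h.symm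
  exact ⟨l', r', rfl⟩

namespace WordGraph

variable {B : Type*} {S : WordGraph B} {W : ℕ → B} {v : S.E}

theorem split_front_old {e : S.E} {he : e ≠ v} (h : S.src e ≠ S.tgt v) :
    (S.split v).front (.old e he) = S.front e := if_neg h

theorem split_back_old {e : S.E} {he : e ≠ v} (h : S.tgt e ≠ S.src v) :
    (S.split v).back (.old e he) = S.back e := if_neg h

theorem split_front_new {x y : S.E} {hx hy} :
    (S.split v).front (.new x y hx hy) = S.front y := rfl

theorem split_back_new {x y : S.E} {hx hy} :
    (S.split v).back (.new x y hx hy) = S.back x := rfl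

/-! ### The scheme axioms for the evolved graph. -/

namespace IsRauzyScheme

variable {R : ℕ}

theorem split_front_ne_nil (h : S.IsRauzyScheme W) (hv : S.Supporting v) {e : S.SplitEdge v}
    (hd : ((S.split v).src e : S.SplitVertex).IsD) : (S.split v).front e ≠ [] := by
  rcases he : (S.split v).src e with u | x | y
  · rw [he] at hd
    obtain ⟨f, hf, rfl, rfl, h2⟩ := split_src_eq_old he
    rw [split_front_old h2]
    exact h.front_ne_nil f hd
  · obtain ⟨y, hx, hy, rfl⟩ := split_src_eq_A he
    rw [split_front_new]
    exact h.front_ne_nil y (hy ▸ hv.2)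
  · rw [he] at hd
    exact hd.elim

theorem split_front_heads (h : S.IsRauzyScheme W) (hv : S.Supporting v) {e f : S.SplitEdge v}
    (hd : ((S.split v).src e : S.SplitVertex).IsD) (hef : (S.split v).src e = (S.split v).src f)
    (hne : e ≠ f) : ((S.split v).front e).head? ≠ ((S.split v).front f).head? := by
  rcases he : (S.split v).src e with u | x | y
  · rw [he] at hd
    obtain ⟨e', h0, rfl, rfl, h2⟩ := split_src_eq_old he
    obtain ⟨f', h3, rfl, h4, -⟩ := split_src_eq_old (hef.symm.trans he)
    rw [split_front_old h2, split_front_old (h4 ▸ h2)]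
    exact h.front_heads _ _ hd h4.symm fun h => hne (by subst h; rfl)
  · obtain ⟨y, hx, hy, rfl⟩ := split_src_eq_A he
    obtain ⟨z, hx', hz, rfl⟩ := split_src_eq_A (hef.symm.trans he)
    rw [split_front_new, split_front_new]
    exact h.front_heads _ _ (hy ▸ hv.2) (hy.trans hz.symm) fun h => hne (by subst h; rfl)
  · rw [he] at hd
    exact hd.elim

theorem split_back_ne_nil (h : S.IsRauzyScheme W) (hv : S.Supporting v) {e : S.SplitEdge v}
    (hd : ¬ ((S.split v).tgt e : S.SplitVertex).IsD) : (S.split v).back e ≠ [] := by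
  rcases he : (S.split v).tgt e with u | x | y
  · rw [he] at hd
    obtain ⟨f, hf, rfl, rfl, h2⟩ := split_tgt_eq_old he
    rw [split_back_old h2]
    exact h.back_ne_nil f ((h.degrees _).resolve_left hd)
  · rw [he] at hd
    exact absurd trivial hd
  · obtain ⟨x, hx, hy, rfl⟩ := split_tgt_eq_B he
    rw [split_back_new]
    exact h.back_ne_nil x (hx ▸ hv.1)

theorem split_back_lasts (h : S.IsRauzyScheme W) (hv : S.Supporting v) {e f : S.SplitEdge v}
    (hd : ¬ ((S.split v).tgt e : S.SplitVertex).IsD) (hef : (S.split v).tgt e = (S.split v).tgt f)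
    (hne : e ≠ f) : ((S.split v).back e).getLast? ≠ ((S.split v).back f).getLast? := by
  rcases he : (S.split v).tgt e with u | x | y
  · rw [he] at hd
    obtain ⟨e', h0, rfl, rfl, h2⟩ := split_tgt_eq_old he
    obtain ⟨f', h3, rfl, h4, -⟩ := split_tgt_eq_old (hef.symm.trans he)
    rw [split_back_old h2, split_back_old (h4 ▸ h2)]
    exact h.back_lasts _ _ ((h.degrees _).resolve_left hd) h4.symm
      fun h => hne (by subst h; rfl)
  · rw [he] at hd
    exact absurd trivial hd
  · obtain ⟨x, hx, hy, rfl⟩ := split_tgt_eq_B he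
    obtain ⟨z, hz, hy', rfl⟩ := split_tgt_eq_B (hef.symm.trans he)
    rw [split_back_new, split_back_new]
    exact h.back_lasts _ _ (hx ▸ hv.1) (hx.trans hz.symm) fun h => hne (by subst h; rfl)

theorem exists_evolved_distributing (h : S.IsRauzyScheme W) (hv : S.Supporting v)
    (hR : LinearlyRecurrent W R) (hper : ¬ EventuallyPeriodic W) :
    ∃ u, (S.evolvedGraph v W).Distributing u := by
  obtain ⟨⟨u, hu, hN⟩, -⟩ := h.exists_nonVanishing_both hv hR hper
  exact ⟨⟨u, hN⟩, h.evolved_distributing_of_isD hv hR hu⟩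

theorem exists_evolved_collecting (h : S.IsRauzyScheme W) (hv : S.Supporting v)
    (hR : LinearlyRecurrent W R) (hper : ¬ EventuallyPeriodic W) :
    ∃ u, (S.evolvedGraph v W).Collecting u := by
  obtain ⟨-, u, hu, hN⟩ := h.exists_nonVanishing_both hv hR hper
  exact ⟨⟨u, hN⟩, h.evolved_collecting_of_not_isD hv hR hu⟩

theorem exists_evolve_front (h : S.IsRauzyScheme W) (hv : S.Supporting v)
    (hR : LinearlyRecurrent W R) (hper : ¬ EventuallyPeriodic W) (E : (S.evolvedGraph v W).E) :
    ∃ z, (S.evolve v W).front E = (S.split v).front (E.1.head E.2.path.1) ++ z := by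
  obtain ⟨r, hr⟩ := (h.evolved_stronglyConnected hv hR).exists_rightExtension
    (h.exists_evolved_distributing hv hR hper) E
  obtain ⟨t, rfl⟩ := hr.eq_cons
  have h1 : S.unfold v W (E :: t) = E.1.head E.2.path.1 :: (E.1.tail ++ S.unfold v W t) := by
    rw [unfold_cons, ← List.cons_append, List.cons_head_tail]
  rw [evolve_front_eq (h.evolved_degrees hv hR) hr, h1, F_cons]
  exact ⟨_, rfl⟩

theorem exists_evolve_back (h : S.IsRauzyScheme W) (hv : S.Supporting v)
    (hR : LinearlyRecurrent W R) (hper : ¬ EventuallyPeriodic W) (E : (S.evolvedGraph v W).E) :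
    ∃ z, (S.evolve v W).back E = z ++ (S.split v).back (E.1.getLast E.2.path.1) := by
  obtain ⟨r, hr⟩ := (h.evolved_stronglyConnected hv hR).exists_leftExtension
    (h.exists_evolved_collecting hv hR hper) E
  obtain ⟨t, rfl⟩ := hr.eq_concat
  have h1 : S.unfold v W (t ++ [E]) =
      (S.unfold v W t ++ E.1.dropLast) ++ [E.1.getLast E.2.path.1] := by
    rw [unfold_append, unfold_singleton, List.append_assoc, List.dropLast_append_getLast]
  rw [evolve_back_eq (h.evolved_degrees hv hR) hr, h1, Bk_concat]
  exact ⟨_, rfl⟩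

theorem evolve_balanced (h : S.IsRauzyScheme W) (hv : S.Supporting v)
    (hR : LinearlyRecurrent W R) : (S.evolve v W).Balanced := by
  intro q hq
  obtain ⟨a, b, -, -, hsym, hF, hBk, -, -⟩ := h.exists_evolve_restore hv hR hq
  exact hF.trans ((h.symmetric_words _ hsym).trans hBk.symm)

/-- A good path from a collecting to a distributing non-vanishing vertex can be routed along a
symmetric path of `S` whose word contains `u`. -/
theorem evolve_covering (h : S.IsRauzyScheme W) (hv : S.Supporting v)
    (hR : LinearlyRecurrent W R) (hper : ¬ EventuallyPeriodic W) {u : List B}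
    (hu : FactorOf u W) :
    ∃ q, (S.evolvedGraph v W).IsSymmetricPath q ∧ u <:+: (S.evolve v W).F q := by
  obtain ⟨⟨d, hd, hdN⟩, c, hc, hcN⟩ := h.exists_nonVanishing_both hv hR hper
  obtain ⟨-, e, he, hec⟩ := h.exists_good_in_out hv hR hcN
  obtain ⟨⟨f, hf, hfd⟩, -⟩ := h.exists_good_in_out hv hR hdN
  obtain ⟨p₁, m, p₂, hp, hpW, hp₁, -, hup, -⟩ := h.exists_admissible_pair hR hu hu
  have hp₁W : FactorOf (S.F p₁) W := hpW.of_infix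
    (h.balanced.F_infix hp hp₁ (by rw [List.append_assoc]; exact (List.prefix_append _ _).isInfix))
  obtain ⟨t, ht, hpt⟩ := h.exists_goodPath_through hv hR he hf hp₁ hp₁W
  obtain ⟨q, hq, hqu⟩ := exists_unfold_eq _ ht
    (by rw [List.cons_append]; exact MGraph.startsIn_cons.mpr (hec ▸ hcN))
    (MGraph.endsIn_concat.mpr (hfd ▸ hdN))
  have hsym : (S.evolvedGraph v W).IsSymmetricPath q := by
    refine ⟨hq, ?_, ?_⟩
    · obtain ⟨E, s, rfl⟩ := List.exists_cons_of_ne_nil hq.1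
      have hE := (startsIn_unfold (P := fun u => ¬ u.IsD) (E := E) (q := s)).mp (by
        rw [hqu, List.cons_append]
        exact MGraph.startsIn_cons.mpr (hec ▸ hc))
      exact MGraph.startsIn_cons.mpr (h.evolved_collecting_of_not_isD hv hR hE)
    · obtain ⟨s, E, rfl⟩ := (List.eq_nil_or_concat' q).resolve_left hq.1
      have hE := (endsIn_unfold (P := SplitVertex.IsD) (E := E) (q := s)).mp (by
        rw [hqu]
        exact MGraph.endsIn_concat.mpr (hfd ▸ hd))
      exact MGraph.endsIn_concat.mpr (h.evolved_distributing_of_isD hv hR hE)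
  refine ⟨q, hsym, ?_⟩
  obtain ⟨a, b, -, -, hr, hF, -⟩ := h.exists_evolve_restore hv hR hsym
  rw [hF]
  refine hup.trans (h.balanced.F_infix hr hp₁ (hpt.trans ?_))
  rw [hqu]
  refine ⟨a ++ [e.toEdge], [f.toEdge] ++ b, ?_⟩
  simp

/-- The word that forces the first split edge of `E` is enough, since this edge identifies `E`. -/
theorem evolve_edge_words (h : S.IsRauzyScheme W) (hv : S.Supporting v)
    (hR : LinearlyRecurrent W R) (E : (S.evolvedGraph v W).E) :
    ∃ u, FactorOf u W ∧
      ∀ q, (S.evolvedGraph v W).IsSymmetricPath q → u <:+: (S.evolve v W).F q → E ∈ q := by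
  obtain ⟨u, hu, hup⟩ := h.exists_pattern_word hv (E.2.good _ (List.head_mem E.2.path.1))
  refine ⟨u, hu, fun q hq huq => mem_of_head_mem_unfold ?_⟩
  obtain ⟨a, b, ha, hb, hr, hF, -⟩ := h.exists_evolve_restore hv hR hq
  rw [hF] at huq
  refine SplitEdge.mem_of_pattern_infix (isGoodPath_unfold hq.1).1 ?_
  exact infix_of_infix_append ha hb (pattern_ne_nil _) (pattern_head_ne hv _)
    (pattern_last_ne hv _) (hup _ hr huq)

end IsRauzyScheme

end WordGraph

theorem forall_head?_map {α β : Type*} {f : α → β} {P : β → Prop} {l : List α}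
    (h : ∀ x ∈ l.head?, P (f x)) : ∀ y ∈ (l.map f).head?, P y := by
  intro y hy
  rw [List.head?_map] at hy
  obtain ⟨x, hx, rfl⟩ := Option.map_eq_some_iff.mp hy
  exact h x hx

theorem forall_getLast?_map {α β : Type*} {f : α → β} {P : β → Prop} {l : List α}
    (h : ∀ x ∈ l.getLast?, P (f x)) : ∀ y ∈ (l.map f).getLast?, P y := by
  intro y hy
  rw [List.getLast?_map] at hy
  obtain ⟨x, hx, rfl⟩ := Option.map_eq_some_iff.mp hy
  exact h x hx

namespace WordGraph

variable {B : Type*} {S : WordGraph B} {W : ℕ → B} {v : S.E}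

namespace IsRauzyScheme

variable {R : ℕ}

/-- Occurrences of the words give occurrences of the restored paths in `S`. Each of these, with the
restored copies of `v` removed, lifts uniquely to the split graph and then folds to an occurrence of
`p` in `q`. -/
theorem evolve_occurrences (h : S.IsRauzyScheme W) (hv : S.Supporting v)
    (hR : LinearlyRecurrent W R) {p q : List (S.evolvedGraph v W).E}
    (hp : (S.evolvedGraph v W).IsSymmetricPath p) (hq : (S.evolvedGraph v W).IsSymmetricPath q)
    {k : ℕ} (hk : OccursAtLeast k ((S.evolve v W).F p) ((S.evolve v W).F q)) :
    OccursAtLeast k p q := by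
  obtain ⟨a, b, -, -, hsp, hFp, -, hhead, hlast⟩ := h.exists_evolve_restore hv hR hp
  obtain ⟨c, d, hc, hd, hsq, hFq, -, -, -⟩ := h.exists_evolve_restore hv hR hq
  rw [hFp, hFq] at hk
  have hocc : _ ≤ _ := h.occurrences _ _ hsp hsq k hk
  -- The restored paths carry `a` and `c` in front, so an occurrence of `p` after `l` corresponds to
  -- one preceded by the image of `l` with `c` added in front and the final `a` removed. It suffices
  -- that `g` reaches all occurrences of the restored path.
  let g : List (S.evolvedGraph v W).E → List S.E := fun l =>
    (c ++ (S.unfold v W l).map SplitEdge.toEdge).take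
      ((c ++ (S.unfold v W l).map SplitEdge.toEdge).length - a.length)
  have hpu := isGoodPath_unfold hp.1
  have hqu := isGoodPath_unfold hq.1
  have hhead' : ∀ y ∈ ((S.unfold v W p).map SplitEdge.toEdge).head?, y ≠ v :=
    forall_head?_map hhead
  have hlast' : ∀ y ∈ ((S.unfold v W p).map SplitEdge.toEdge).getLast?, y ≠ v :=
    forall_getLast?_map hlast
  have hne : (S.unfold v W p).map SplitEdge.toEdge ≠ [] :=
    fun h0 => hpu.1.1 (List.map_eq_nil_iff.mp h0)
  refine hocc.trans ((Set.ncard_le_ncard ?_ ((finite_occurrences p q).image g)).trans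
    (Set.ncard_image_le (finite_occurrences p q)))
  rintro l ⟨r, hr⟩
  have hr' : c ++ (S.unfold v W q).map SplitEdge.toEdge ++ d =
      (l ++ a) ++ (S.unfold v W p).map SplitEdge.toEdge ++ (b ++ r) := by
    rw [hr]
    simp only [List.append_assoc]
  obtain ⟨l', r', hm, hl⟩ := exists_eq_of_append_eq hc hd hne hhead' hlast' hr'
  obtain ⟨s, z, hs, hsm, -⟩ := List.map_eq_append_iff.mp hm
  obtain ⟨x, y, rfl, hx, hy⟩ := List.map_eq_append_iff.mp hsm
  have hyne : y ≠ [] := fun h0 => hne (hy ▸ h0 ▸ rfl)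
  have hyp : y = S.unfold v W p := by
    refine split_path_unique (hqu.1.of_infix (hs ▸ ⟨x, z, rfl⟩) hyne) hpu.1 hy ?_ ?_
    · intro f hf
      refine hhead' _ ?_
      rw [← hy, List.head?_map]
      exact Option.map_eq_some_iff.mpr ⟨f, hf, rfl⟩
    · intro f hf
      refine hlast' _ ?_
      rw [← hy, List.getLast?_map]
      exact Option.map_eq_some_iff.mpr ⟨f, hf, rfl⟩
  obtain ⟨l₀, r₀, hq₀, hl₀⟩ := exists_of_unfold_eq hp.1.1 q (hyp ▸ hs)
  refine ⟨l₀, ⟨r₀, hq₀⟩, ?_⟩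
  have h1 : c ++ (S.unfold v W l₀).map SplitEdge.toEdge = l ++ a := by
    rw [hl₀, hl, ← hx]
  show (c ++ (S.unfold v W l₀).map SplitEdge.toEdge).take _ = l
  rw [h1]
  simp

theorem exists_admissible_mem_evolve (h : S.IsRauzyScheme W) (hv : S.Supporting v)
    (hR : LinearlyRecurrent W R) (hper : ¬ EventuallyPeriodic W) (E : (S.evolvedGraph v W).E) :
    ∃ p, (S.evolvedGraph v W).IsSymmetricPath p ∧ FactorOf ((S.evolve v W).F p) W ∧ E ∈ p := by
  obtain ⟨u, hu, he⟩ := h.evolve_edge_words hv hR E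
  have : Finite (S.evolve v W).E := h.evolved_finite_edges
  obtain ⟨p₁, m, p₂, hp, hF, hp₁, -, hu₁, -⟩ := (h.evolve_balanced hv hR).exists_admissible_pair hR
    (fun u hu => h.evolve_covering hv hR hper hu) hu hu
  exact ⟨_, hp, hF, List.mem_append_left _ (List.mem_append_left _ (he p₁ hp₁ hu₁))⟩

theorem evolve (h : S.IsRauzyScheme W) (hv : S.Supporting v)
    (hR : LinearlyRecurrent W R) (hper : ¬ EventuallyPeriodic W) :
    (S.evolve v W).IsRauzyScheme W where
  finite_vertices := h.evolved_finite_vertices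
  finite_edges := h.evolved_finite_edges
  degrees := h.evolved_degrees hv hR
  strongly_connected := h.evolved_stronglyConnected hv hR
  more_than_one_edge := by
    obtain ⟨u, -, e, f, hne, -⟩ := h.exists_evolved_distributing hv hR hper
    exact ⟨e, f, hne⟩
  front_ne_nil := by
    intro E hE
    obtain ⟨z, hz⟩ := h.exists_evolve_front hv hR hper E
    rw [hz]
    exact List.append_ne_nil_of_left_ne_nil
      (h.split_front_ne_nil hv ((h.evolved_distributing_iff hv hR).mp hE)) _
  front_heads := by
    intro E F hE hEF hne
    obtain ⟨z, hz⟩ := h.exists_evolve_front hv hR hper E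
    obtain ⟨w, hw⟩ := h.exists_evolve_front hv hR hper F
    have hd := (h.evolved_distributing_iff hv hR).mp hE
    have hd' := (h.evolved_distributing_iff hv hR).mp (hEF ▸ hE)
    rw [hz, hw, List.head?_append_of_ne_nil _ (h.split_front_ne_nil hv hd),
      List.head?_append_of_ne_nil _ (h.split_front_ne_nil hv hd')]
    exact h.split_front_heads hv hd (congrArg Subtype.val hEF)
      fun h0 => hne (evolvedEdge_first_unique h0)
  back_ne_nil := by
    intro E hE
    obtain ⟨z, hz⟩ := h.exists_evolve_back hv hR hper E
    rw [hz]
    exact List.append_ne_nil_of_right_ne_nil _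
      (h.split_back_ne_nil hv ((h.evolved_collecting_iff hv hR).mp hE))
  back_lasts := by
    intro E F hE hEF hne
    obtain ⟨z, hz⟩ := h.exists_evolve_back hv hR hper E
    obtain ⟨w, hw⟩ := h.exists_evolve_back hv hR hper F
    have hd := (h.evolved_collecting_iff hv hR).mp hE
    have hd' := (h.evolved_collecting_iff hv hR).mp (hEF ▸ hE)
    rw [hz, hw, List.getLast?_append_of_ne_nil _ (h.split_back_ne_nil hv hd),
      List.getLast?_append_of_ne_nil _ (h.split_back_ne_nil hv hd')]
    exact h.split_back_lasts hv hd (congrArg Subtype.val hEF)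
      fun h0 => hne (evolvedEdge_last_unique h0)
  symmetric_words := h.evolve_balanced hv hR
  occurrences p q hp hq k hk := h.evolve_occurrences hv hR hp hq hk
  factors E := by
    obtain ⟨p, hp, hF, hE⟩ := h.exists_admissible_mem_evolve hv hR hper E
    exact ⟨hF.of_infix (Balanced.front_infix_F (S := S.evolve v W) (h.evolved_degrees hv hR)
        (h.evolve_balanced hv hR) hp hE),
      hF.of_infix (Balanced.back_infix_F (S := S.evolve v W) (h.evolved_degrees hv hR)
        (h.evolve_balanced hv hR) hp hE)⟩
  covering u hu := h.evolve_covering hv hR hper hu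
  edge_words := h.evolve_edge_words hv hR

end IsRauzyScheme

end WordGraph

/-! ### Deterministic evolution -/

namespace NumberedWordGraph

variable {B : Type*} {S : NumberedWordGraph B} {W : ℕ → B}

theorem splitNum_injective (hS : Function.Injective S.num) (v : S.E) :
    Function.Injective (S.splitNum v) := by
  intro e f hef
  cases e with
  | old e he =>
    cases f with
    | old f hf =>
      obtain rfl := hS (Sum.inl.inj hef)
      rfl
    | new => cases hef
  | new x y hx hy =>
    cases f with
    | old => cases hef
    | new x' y' hx' hy' =>
      obtain ⟨h1, h2⟩ := Prod.mk.inj (Sum.inr.inj hef)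
      obtain rfl := hS h1
      obtain rfl := hS h2
      rfl

theorem evolvedNumberedGraph_num_injective (hS : Function.Injective S.num) (v : S.E) :
    Function.Injective (S.evolvedNumberedGraph W v).num :=
  fun _ _ h => WordGraph.evolvedEdge_first_unique (splitNum_injective hS v h)

namespace IsNumberedScheme

theorem exists_least_supporting (h : S.IsNumberedScheme W) :
    ∃ v, S.Supporting v ∧ ∀ w, S.Supporting w → S.num v ≤ S.num w := by
  obtain ⟨v, hv⟩ := h.1.exists_supporting
  obtain ⟨m, hm, hmin⟩ := (measure S.num).wf.has_min {w | S.Supporting w} ⟨v, hv⟩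
  exact ⟨m, hm, fun w hw => not_lt.mp (hmin w hw)⟩

/-- The deterministic evolution of a numbered Rauzy scheme is a numbered Rauzy scheme, whose numbers
do not exceed the number of edges. -/
theorem evol (h : S.IsNumberedScheme W) {R : ℕ} (hR : LinearlyRecurrent W R)
    (hper : ¬ EventuallyPeriodic W) (M : EvolutionMethod) :
    (S.evol W M).IsNumberedScheme W ∧
      ∀ e, (S.evol W M).num e ≤ Nat.card (S.evol W M).E := by
  have hex := h.exists_least_supporting
  have hv := hex.choose_spec.1
  have hEq : S.evol W M =
    { toWordGraph := S.toWordGraph.evolve hex.choose W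
      num := M.renum (S.evolvedNumberedGraph W hex.choose) } := dif_pos hex
  have hbij := M.bijOn (S.evolvedNumberedGraph W hex.choose) (h.1.evolved_finite_edges)
    (evolvedNumberedGraph_num_injective h.2 _)
  rw [hEq]
  exact ⟨⟨h.1.evolve hv hR hper, fun e f hef => hbij.injOn trivial trivial hef⟩,
    fun e => (hbij.mapsTo trivial).2⟩

theorem iterate_evol (h : S.IsNumberedScheme W) {R : ℕ} (hR : LinearlyRecurrent W R)
    (hper : ¬ EventuallyPeriodic W) (M : EvolutionMethod) (n : ℕ) :
    ((NumberedWordGraph.evol W M)^[n] S).IsNumberedScheme W := by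
  induction n with
  | zero => exact h
  | succ n ih =>
    rw [Function.iterate_succ_apply']
    exact (ih.evol hR hper M).1

end IsNumberedScheme

end NumberedWordGraph

/-- Up to isomorphism, there are finitely many numbered graphs of bounded size with bounded
numbers. -/
theorem NumberedGraph.exists_finite_representatives (N : ℕ) :
    ∃ 𝓕 : Set (NumberedGraph ℕ), 𝓕.Finite ∧ ∀ G : NumberedGraph ℕ, Finite G.V → Finite G.E →
      Nat.card G.V ≤ N → Nat.card G.E ≤ N → (∀ e, G.num e ≤ N) →
      ∃ H ∈ 𝓕, Nonempty (G.Iso H) := by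
  let T := Σ a : Fin (N + 1), Σ b : Fin (N + 1),
    (Fin b → Fin a) × (Fin b → Fin a) × (Fin b → Fin (N + 1))
  let f : T → NumberedGraph ℕ := fun t =>
    { V := Fin t.1
      E := Fin t.2.1
      src := t.2.2.1
      tgt := t.2.2.2.1
      num := fun e => t.2.2.2.2 e }
  refine ⟨Set.range f, Set.finite_range f, fun G _ _ hV hE hnum => ?_⟩
  let eV := Finite.equivFin G.V
  let eE := Finite.equivFin G.E
  refine ⟨_, ⟨⟨⟨Nat.card G.V, Nat.lt_succ_of_le hV⟩, ⟨Nat.card G.E, Nat.lt_succ_of_le hE⟩,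
    fun e => eV (G.src (eE.symm e)), fun e => eV (G.tgt (eE.symm e)),
    fun e => ⟨G.num (eE.symm e), Nat.lt_succ_of_le (hnum _)⟩⟩, rfl⟩, ⟨⟨eV, eE, ?_, ?_, ?_⟩⟩⟩
  · intro e
    exact congrArg (fun e => eV (G.src e)) (eE.symm_apply_apply e)
  · intro e
    exact congrArg (fun e => eV (G.tgt e)) (eE.symm_apply_apply e)
  · intro e
    exact congrArg G.num (eE.symm_apply_apply e)

/-- The identity isomorphism. -/
def NumberedGraph.Iso.refl {L : Type} (G : NumberedGraph L) : G.Iso G where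
  vertex := Equiv.refl _
  edge := Equiv.refl _
  src_edge _ := rfl
  tgt_edge _ := rfl
  num_edge _ := rfl

theorem WordGraph.IsRauzyScheme.exists_card_bound {B : Type*} [Finite B] {W : ℕ → B} {R : ℕ}
    (hR : LinearlyRecurrent W R) (hper : ¬ EventuallyPeriodic W) :
    ∃ N, ∀ S : WordGraph B, S.IsRauzyScheme W → Nat.card S.V ≤ N ∧ Nat.card S.E ≤ N := by
  obtain ⟨Q, hQ, hz⟩ := hR.exists_period_bound hper
  let K := (R * (2 * R * (4 * Q) + 2) + 1) * (R * (2 * R * (4 * Q) + 2) + 1)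
  refine ⟨max (K * (Nat.card B + 1)) (K * (2 * Nat.card B)), fun S hS => ?_⟩
  have hD := hS.card_distributing_le hR hQ hz
  obtain ⟨h1, h2⟩ := hS.card_le_card_distributing
  exact ⟨(h1.trans (Nat.mul_le_mul_right _ hD)).trans (le_max_left _ _),
    (h2.trans (Nat.mul_le_mul_right _ hD)).trans (le_max_right _ _)⟩

theorem mainTheorem7 {A B : Type*} [Finite A] [Finite B]
    (φ : FreeMonoid A →* FreeMonoid A) (ψ : FreeMonoid A →* FreeMonoid B) (a₁ : A)
    (X : ℕ → A) (W : ℕ → B)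
    (hφ : IsPrimitiveMorphism φ) (hX : IsPurelyMorphic φ a₁ X) (hW : IsMorphicImage ψ X W)
    (hper : ¬ EventuallyPeriodic W) :
    (∃ C₇ : ℕ, ∀ S : WordGraph B, S.IsRauzyScheme W → Nat.card S.V ≤ C₇) ∧
    (∀ M : EvolutionMethod, ∃ 𝓕 : Set (NumberedGraph ℕ), 𝓕.Finite ∧
      ∀ S : NumberedWordGraph B, S.IsNumberedScheme W → ∀ n, 1 ≤ n →
        ∃ G ∈ 𝓕, Nonempty (((NumberedWordGraph.evol W M)^[n] S).lighten.Iso G)) ∧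
    (∀ (M : EvolutionMethod) (S : NumberedWordGraph B), S.IsNumberedScheme W →
      ∃ 𝓕 : Set (NumberedGraph ℕ), 𝓕.Finite ∧
        ∀ n, ∃ G ∈ 𝓕, Nonempty (((NumberedWordGraph.evol W M)^[n] S).lighten.Iso G)) := by
  obtain ⟨R, hR⟩ := exists_linearlyRecurrent hφ hX hW
  obtain ⟨N, hN⟩ := WordGraph.IsRauzyScheme.exists_card_bound hR hper
  -- `N` depends on `W` alone, so a single family serves for all methods and all initial schemes.
  obtain ⟨𝓕, hfin, h𝓕⟩ := NumberedGraph.exists_finite_representatives N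
  have key : ∀ (M : EvolutionMethod) (S : NumberedWordGraph B), S.IsNumberedScheme W → ∀ n, 1 ≤ n →
      ∃ G ∈ 𝓕, Nonempty (((NumberedWordGraph.evol W M)^[n] S).lighten.Iso G) := by
    intro M S hS n hn
    obtain ⟨m, rfl⟩ := Nat.exists_eq_add_of_le' hn
    -- The last step is separated because the numbers are known to be bounded by the number of edges
    -- only after a renumbering.
    rw [Function.iterate_succ_apply']
    obtain ⟨h1, h2⟩ := (hS.iterate_evol hR hper M m).evol hR hper M
    obtain ⟨hV, hE⟩ := hN _ h1.1
    exact h𝓕 _ h1.1.finite_vertices h1.1.finite_edges hV hE fun e => (h2 e).trans hE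
  -- The numbers of the initial scheme are arbitrary, so for `n = 0` its own lightened scheme is
  -- added to the family.
  refine ⟨⟨N, fun S hS => (hN S hS).1⟩, fun M => ⟨𝓕, hfin, key M⟩, fun M S hS =>
    ⟨insert S.lighten 𝓕, hfin.insert _, fun n => ?_⟩⟩
  rcases Nat.eq_zero_or_pos n with rfl | hn
  · exact ⟨S.lighten, Set.mem_insert _ _, ⟨NumberedGraph.Iso.refl _⟩⟩
  · obtain ⟨G, hG, hiso⟩ := key M S hS n hn
    exact ⟨G, Set.mem_insert_of_mem _ hG, hiso⟩
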